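/- Let $d>2$, $T>0$, $\alpha>0$, and consider on $\mathbb R^d\times[0,T]$ the mean-field game $$-u_t+H(x,Du)=\Delta u+g(m),\qquad m_t-\operatorname{div}(D_pH(x,Du)\,m)=\Delta m,\qquad u(x,T)=u_T(x),\quad m(x,0)=m_0(x).$$ Assume: A1. $H\in C^\infty(\mathbb R^d\times\mathbb R^d)$ is non-negative, strictly convex in $p$, and $\lim_{|p|\to\infty}H(x,p)/|p|=+\infty$ for every $x$. A2. $u_T$ and $m_0$ are smooth and integrable; $m_0\ge 0$ is compactly supported and $\int_{\mathbb R^d}m_0\,dx=1$. A3. The Lagrangian $L(x,v)=\sup_p\,(-p\cdot v-H(x,p))$ satisfies $L(\cdot,0)\in L^1(\mathbb R^d)\cap L^\infty(\mathbb R^d)$ and $L(x,0)\ge 0$. A4. There are $c,C>0$ with $D_pH(x,p)\cdot p-H(x,p)\ge cH(x,p)-C$ for all $x,p$. A5. $g$ is non-decreasing on $[0,\infty)$, $g(0)=0$, and for some $C>0$, $g(z)\le Cz$ for $0\le z\le 1$ and $g(z)\le Cz^\alpha$ for $z>1$; moreover $g$ is on $[0,\infty)$ the derivative of a convex function $G$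 with $C_1z^{\alpha+1}\le G(z)\le C_2z^{\alpha+1}$ for all $z>1$, for some $C_1,C_2>0$. A6. There is $C>0$ with $|D^2_{xp}H|^2\le CH$ and $|D^2_{pp}H\,M|^2\le C\operatorname{Tr}(D^2_{pp}H\,M\,M)$ for all $x,p$ and every symmetric matrix $M$. A solution is a pair $(u,m)$ that solves the system pointwise on $\mathbb R^d\times[0,T]$, where $u$ and $m$ are continuous on $\mathbb R^d\times[0,T]$ together with their derivatives of first order in $t$ and of first and second order in $x$, where $m\ge 0$ and $m\in L^\infty(0,T;L^1(\mathbb R^d))$, and where $Du$ has at most linear growth: $|Du(x,t)|\le K(1+|x|)$ for some $K$ that may depend on the solution. Then there is a constant $C>0$, depending only on $d,T,\alpha,H,g,u_T,m_0$, such that every solution $(u,m)$ satisfies $$\|m\|_{L^{\alpha+1}\left(0,T;\,L^{2^*(\alpha+1)/2}(\mathbb R^d)\right)}\le C,\qquad 2^*=\frac{2d}{d-2}.$$ -/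

import Mathlib

open MeasureTheory Set Filter Topology
open scoped ENNReal ContDiff Gradient InnerProductSpace

noncomputable section

namespace MeanField

/-- The Euclidean space `ℝ^d`. -/
abbrev Space (d : ℕ) := EuclideanSpace ℝ (Fin d)

variable {d : ℕ}

/-- The `i`-th vector of the canonical basis of `ℝ^d`. -/
def basisVec (i : Fin d) : Space d := EuclideanSpace.single i (1 : ℝ)

/-- The divergence of a vector field, `∑ i, ∂_i F_i`. -/
def divergence (F : Space d → Space d) (x : Space d) : ℝ :=
  ∑ i, (fderiv ℝ F x (basisVec i)) i

/-- `D_p H (x, p)`, the gradient of the Hamiltonian in the momentum variable. -/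
def gradP (H : Space d → Space d → ℝ) (x p : Space d) : Space d := ∇ (H x) p

/-- `D²_{pp} H (x, p)`: the matrix of the `∂_{p_i} ∂_{p_j} H`. -/
def hessPP (H : Space d → Space d → ℝ) (x p : Space d) : Matrix (Fin d) (Fin d) ℝ :=
  Matrix.of fun i j => fderiv ℝ (fun q => (gradP H x q) j) p (basisVec i)

/-- `D²_{xp} H (x, p)`: the matrix of the `∂_{x_i} ∂_{p_j} H`. -/
def hessXP (H : Space d → Space d → ℝ) (x p : Space d) : Matrix (Fin d) (Fin d) ℝ :=
  Matrix.of fun i j => fderiv ℝ (fun y => (gradP H y p) j) x (basisVec i)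

/-- The square `|A|²` of the Euclidean (Frobenius) norm of a matrix. -/
def frobSq (A : Matrix (Fin d) (Fin d) ℝ) : ℝ := ∑ i, ∑ j, A i j ^ 2

/-- The Lagrangian `L(x, v) = sup_p (- p · v - H(x, p))`. -/
def lagrangian (H : Space d → Space d → ℝ) (x v : Space d) : ℝ :=
  ⨆ p : Space d, (-(inner ℝ p v) - H x p)

/-- The Hamiltonian is smooth, strictly convex in the momentum, non-negative and coercive. -/
structure HamiltonianAssumption (H : Space d → Space d → ℝ) : Prop where
  smooth : ContDiff ℝ ∞ (fun z : Space d × Space d => H z.1 z.2)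
  strictConvex : ∀ x, StrictConvexOn ℝ univ (H x)
  nonneg : ∀ x p, 0 ≤ H x p
  coercive : ∀ x, Tendsto (fun p => H x p / ‖p‖) (Bornology.cobounded (Space d)) atTop

/-- Terminal and initial data: both are smooth and integrable, and `m₀` is a compactly supported
probability density. -/
structure DataAssumption (uT m₀ : Space d → ℝ) : Prop where
  smooth_uT : ContDiff ℝ ∞ uT
  integrable_uT : Integrable uT
  smooth_m₀ : ContDiff ℝ ∞ m₀
  integrable_m₀ : Integrable m₀
  nonneg_m₀ : ∀ x, 0 ≤ m₀ x
  compactSupport_m₀ : HasCompactSupport m₀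
  integral_m₀ : ∫ x, m₀ x = 1

/-- `L(·, 0)` is integrable, bounded and non-negative. -/
structure LagrangianAssumption (H : Space d → Space d → ℝ) : Prop where
  integrable : Integrable (fun x => lagrangian H x 0)
  bounded : MemLp (fun x => lagrangian H x 0) ∞ volume
  nonneg : ∀ x, 0 ≤ lagrangian H x 0

/-- `D_p H · p - H ≥ c H - C` for some constants `c, C > 0`. -/
def GrowthAssumption (H : Space d → Space d → ℝ) : Prop :=
  ∃ c > (0 : ℝ), ∃ C > (0 : ℝ), ∀ x p,
    c * H x p - C ≤ inner ℝ (gradP H x p) p - H x p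

/-- The assumption on the non-linearity `g`, of which only the values on `[0, ∞)` matter. -/
structure CouplingAssumption (g : ℝ → ℝ) (α : ℝ) : Prop where
  monotone : MonotoneOn g (Ici 0)
  zero : g 0 = 0
  upper : ∃ C > (0 : ℝ), (∀ z, 0 ≤ z → z ≤ 1 → g z ≤ C * z) ∧ (∀ z, 1 < z → g z ≤ C * z ^ α)
  primitive : ∃ G : ℝ → ℝ, ConvexOn ℝ (Ici 0) G ∧
    (∀ z, 0 ≤ z → HasDerivWithinAt G (g z) (Ici 0) z) ∧
    ∃ C₁ > (0 : ℝ), ∃ C₂ > (0 : ℝ), ∀ z, 1 < z →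
      C₁ * z ^ (α + 1) ≤ G z ∧ G z ≤ C₂ * z ^ (α + 1)

/-- `|D²_{xp} H|² ≤ C H`, and `|D²_{pp} H M|² ≤ C Tr(D²_{pp} H M M)` for every symmetric matrix
`M`. -/
def HessianAssumption (H : Space d → Space d → ℝ) : Prop :=
  ∃ C > (0 : ℝ), ∀ x p, frobSq (hessXP H x p) ≤ C * H x p ∧
    ∀ M : Matrix (Fin d) (Fin d) ℝ, M.IsSymm →
      frobSq (hessPP H x p * M) ≤ C * (hessPP H x p * M * M).trace

/-- `f ∈ C^{2,1}(ℝ^d × [0, T])`: the function `f` and its derivatives `f_t`, `D_x f`, `D²_x f`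
exist and are continuous on `ℝ^d × [0, T]` (one-sided time derivatives at `t = 0` and `t = T`). -/
structure IsC21 (T : ℝ) (f : Space d → ℝ → ℝ) : Prop where
  contDiff_space : ∀ t ∈ Icc 0 T, ContDiff ℝ 2 (fun x => f x t)
  differentiable_time : ∀ x, DifferentiableOn ℝ (f x) (Icc 0 T)
  continuous : ContinuousOn (fun z : Space d × ℝ => f z.1 z.2) (univ ×ˢ Icc 0 T)
  continuous_time : ContinuousOn
    (fun z : Space d × ℝ => derivWithin (f z.1) (Icc 0 T) z.2) (univ ×ˢ Icc 0 T)
  continuous_fderiv : ContinuousOn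
    (fun z : Space d × ℝ => fderiv ℝ (fun x => f x z.2) z.1) (univ ×ˢ Icc 0 T)
  continuous_iteratedFDeriv : ContinuousOn
    (fun z : Space d × ℝ => iteratedFDeriv ℝ 2 (fun x => f x z.2) z.1) (univ ×ˢ Icc 0 T)

/-- `(u, m)` is a classical solution on `ℝ^d × [0, T]` of the mean-field game
`-u_t + H(x, Du) = Δu + g(m)`, `m_t - div(D_pH(x, Du) m) = Δm`, `u(·, T) = u_T`, `m(·, 0) = m₀`,
where `m` is a non-negative density of bounded mass and `Du` grows at most linearly in space
(with bounds that may depend on the solution). -/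
structure IsSolution (T : ℝ) (H : Space d → Space d → ℝ) (g : ℝ → ℝ) (uT m₀ : Space d → ℝ)
    (u m : Space d → ℝ → ℝ) : Prop where
  regular_u : IsC21 T u
  regular_m : IsC21 T m
  hamiltonJacobi : ∀ x, ∀ t ∈ Icc 0 T,
    -derivWithin (u x) (Icc 0 T) t + H x (∇ (fun y => u y t) x)
      = Laplacian.laplacian (fun y => u y t) x + g (m x t)
  fokkerPlanck : ∀ x, ∀ t ∈ Icc 0 T,
    derivWithin (m x) (Icc 0 T) t
        - divergence (fun y => m y t • gradP H y (∇ (fun z => u z t) y)) x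
      = Laplacian.laplacian (fun y => m y t) x
  terminal : ∀ x, u x T = uT x
  initial : ∀ x, m x 0 = m₀ x
  nonneg_m : ∀ x, ∀ t ∈ Icc 0 T, 0 ≤ m x t
  mass_m : ∃ A : ℝ, ∀ t ∈ Icc 0 T, Integrable (fun x => m x t) ∧ ∫ x, m x t ≤ A
  growth_u : ∃ K : ℝ, ∀ x, ∀ t ∈ Icc 0 T, ‖∇ (fun y => u y t) x‖ ≤ K * (1 + ‖x‖)

/-- The Sobolev exponent `2* = 2d / (d - 2)`. -/
def sobolevExponent (d : ℕ) : ℝ := 2 * (d : ℝ) / ((d : ℝ) - 2)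

/-- The mixed norm `‖f‖_{L^p(0,T; L^q(ℝ^d))}`, with values in `[0, ∞]`. -/
def mixedNorm (T p q : ℝ) (f : Space d → ℝ → ℝ) : ℝ≥0∞ :=
  eLpNorm (fun t : ℝ => eLpNorm (fun x => f x t) (ENNReal.ofReal q) volume)
    (ENNReal.ofReal p) (volume.restrict (Ioo 0 T))

end MeanField

end

/-!
The constant is allowed to depend on the data in any way, and this is what makes an estimate
possible although the drift `D_pH(x, Du)` of a solution is only known to grow linearly with a
constant that depends on the solution.

* **All solutions share one drift.** For two solutions the Lasry-Lions computation, applied to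
  `∫ (u₁ - u₂) (m₁ - m₂)`, gives a sum of non-negative terms equal to zero: the monotone coupling
  `(g(m₁) - g(m₂)) (m₁ - m₂)` and the Bregman gaps of `H(x, ·)` weighted by `m₁` and `m₂`. Strict
  convexity of `H(x, ·)` then forces `Du₁ = Du₂` where `m₁` or `m₂` is positive, and therefore
  `m₂ D_pH(x, Du₂) = m₂ D_pH(x, Du₁)` everywhere (`hamiltonianFlux_eq`). So the growth constant of
  the drift of one solution serves for all of them. That `D_pH(x, p)` grows at most linearly in `p`,
  uniformly in `x`, follows from the growth and Hessian assumptions (`exists_norm_gradP_le`).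
  The linear growth of the drift makes all spatial moments of a density finite, which justifies
  the integrations by parts on the whole space.
* **A density with a drift of linear growth is bounded a priori.** Let `m` solve
  `m_t = Δm + div F` with `|F| ≤ K (1 + |x|) m`. Testing with powers of `1 + |x|²` bounds all
  moments (`exists_moment_bound`). Testing with the derivative of an entropy that behaves
  like `m^(α+1)` bounds `∫∫ |D Φ(m)|²`, where `Φ(m)` behaves like `m^((α+1)/2)`, by
  `∫∫ Φ(m)² (1 + |x|²)` (`IsFluxSolution.energy_le`). By Hölder's inequality this integral is
  bounded by a moment and a power less than one of the square of the `L^{2*}` norm, so that the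
  Sobolev inequality absorbs it (`exists_integral_truncPow_le`).

Powers of `m` are not known to be integrable beforehand. So `Φ` is truncated to the bounded function
`truncPow`, and everything is localized with a cutoff. The bounds do not depend on the truncation
once the radius is large, and Fatou's lemma removes both (`exists_lintegral_rpow_le`).
-/

open MeasureTheory Set Filter Topology
open scoped ENNReal ContDiff Gradient InnerProductSpace

noncomputable section

namespace MeanField

variable {d : ℕ}

/-! ### Integration by parts and radial functions -/

theorem divergence_eq_sum {F : Space d → Space d} {x : Space d} (hF : DifferentiableAt ℝ F x) :
    divergence F x = ∑ i, fderiv ℝ (fun y => F y i) x (basisVec i) := by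
  unfold divergence
  refine Finset.sum_congr rfl fun i _ => ?_
  have h := ((EuclideanSpace.proj (𝕜 := ℝ) i).hasFDerivAt.comp x hF.hasFDerivAt).fderiv
  have h2 : (fun y => F y i) = (EuclideanSpace.proj (𝕜 := ℝ) i) ∘ F := rfl
  rw [h2, h]
  rfl

theorem sum_smul_basisVec (v : Space d) : v = ∑ i, v i • basisVec i := by
  have := (EuclideanSpace.basisFun (Fin d) ℝ).sum_repr v
  simpa [basisVec] using this.symm

/-- Integration by parts without boundary terms. -/
theorem integral_mul_divergence {ψ : Space d → ℝ} {F : Space d → Space d} (hψ : ContDiff ℝ 1 ψ)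
    (hF : ContDiff ℝ 1 F) (hc : HasCompactSupport ψ ∨ HasCompactSupport F) :
    ∫ x, ψ x * divergence F x = - ∫ x, fderiv ℝ ψ x (F x) := by
  have hFi (i : Fin d) : ContDiff ℝ 1 fun y => F y i :=
    (EuclideanSpace.proj (𝕜 := ℝ) i).contDiff.comp hF
  have hcont (i : Fin d) : Continuous fun x => ψ x * fderiv ℝ (fun y => F y i) x (basisVec i) :=
    hψ.continuous.mul (((hFi i).continuous_fderiv one_ne_zero).clm_apply continuous_const)
  have hcont' (i : Fin d) : Continuous fun x => fderiv ℝ ψ x (basisVec i) * F x i :=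
    ((hψ.continuous_fderiv one_ne_zero).clm_apply continuous_const).mul (hFi i).continuous
  have hcFi (h : HasCompactSupport F) (i : Fin d) : HasCompactSupport fun y => F y i :=
    h.comp_left (g := fun v : Space d => v i) rfl
  have hs (i : Fin d) :
      HasCompactSupport fun x => ψ x * fderiv ℝ (fun y => F y i) x (basisVec i) := by
    rcases hc with hc | hc
    · exact hc.mul_right
    · exact ((hcFi hc i).fderiv_apply ℝ _).mul_left
  have hs' (i : Fin d) : HasCompactSupport fun x => fderiv ℝ ψ x (basisVec i) * F x i := by
    rcases hc with hc | hc
    · exact (hc.fderiv_apply ℝ _).mul_right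
    · exact (hcFi hc i).mul_left
  have hs'' (i : Fin d) : HasCompactSupport fun x => ψ x * F x i := by
    rcases hc with hc | hc
    · exact hc.mul_right
    · exact (hcFi hc i).mul_left
  have e1 : ∀ x, ψ x * divergence F x
      = ∑ i, ψ x * fderiv ℝ (fun y => F y i) x (basisVec i) := fun x => by
    rw [divergence_eq_sum (hF.differentiable one_ne_zero x), Finset.mul_sum]
  have e2 : ∀ x, fderiv ℝ ψ x (F x) = ∑ i, fderiv ℝ ψ x (basisVec i) * F x i := fun x => by
    conv_lhs => rw [sum_smul_basisVec (F x)]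
    simp [mul_comm]
  simp_rw [e1, e2]
  rw [integral_finsetSum _ fun i _ => (hcont i).integrable_of_hasCompactSupport (hs i),
    integral_finsetSum _ fun i _ => (hcont' i).integrable_of_hasCompactSupport (hs' i),
    ← Finset.sum_neg_distrib]
  refine Finset.sum_congr rfl fun i _ => ?_
  exact integral_mul_fderiv_eq_neg_fderiv_mul_of_integrable
    ((hcont' i).integrable_of_hasCompactSupport (hs' i))
    ((hcont i).integrable_of_hasCompactSupport (hs i))
    ((hψ.continuous.mul (hFi i).continuous).integrable_of_hasCompactSupport (hs'' i))
    (fun x _ => hψ.differentiable one_ne_zero x) (fun x _ => (hFi i).differentiable one_ne_zero x)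

theorem contDiff_gradient {f : Space d → ℝ} {n : WithTop ℕ∞} (hf : ContDiff ℝ (n + 1) f) :
    ContDiff ℝ n (∇ f) :=
  (InnerProductSpace.toDual ℝ (Space d)).symm.toContinuousLinearEquiv.contDiff.comp
    (hf.fderiv_right le_rfl)

theorem gradient_apply (f : Space d → ℝ) (x : Space d) (i : Fin d) :
    (∇ f x) i = fderiv ℝ f x (basisVec i) := by
  rw [← inner_gradient_left, basisVec, EuclideanSpace.inner_single_right]
  simp

theorem norm_gradient (f : Space d → ℝ) (x : Space d) : ‖∇ f x‖ = ‖fderiv ℝ f x‖ := by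
  rw [← toDual_gradient, LinearIsometryEquiv.norm_map]

theorem laplacian_eq_divergence_gradient {f : Space d → ℝ} (hf : ContDiff ℝ 2 f) (x : Space d) :
    Laplacian.laplacian f x = divergence (∇ f) x := by
  have h1 : ContDiff ℝ 1 (∇ f) := contDiff_gradient (by simpa [one_add_one_eq_two] using hf)
  have h2 : ContDiff ℝ 1 (fderiv ℝ f) := hf.fderiv_right (by norm_num)
  rw [divergence_eq_sum (h1.differentiable one_ne_zero x),
    InnerProductSpace.laplacian_eq_iteratedFDeriv_orthonormalBasis f
      (EuclideanSpace.basisFun (Fin d) ℝ)]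
  refine Finset.sum_congr rfl fun i _ => ?_
  simp_rw [gradient_apply]
  rw [fderiv_clm_apply (h2.differentiable one_ne_zero x) (differentiableAt_const _),
    iteratedFDeriv_two_apply]
  simp [basisVec]

/-- The weight `1 + ‖x‖²`, in terms of which all moments and radial functions are written. -/
def weight (x : Space d) : ℝ := 1 + ‖x‖ ^ 2

theorem one_le_weight (x : Space d) : 1 ≤ weight x := by unfold weight; nlinarith [sq_nonneg ‖x‖]

theorem weight_pos (x : Space d) : 0 < weight x := zero_lt_one.trans_le (one_le_weight x)

theorem contDiff_weight {n : WithTop ℕ∞} : ContDiff ℝ n (weight (d := d)) :=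
  contDiff_const.add (contDiff_norm_sq ℝ)

theorem hasGradientAt_weight (x : Space d) : HasGradientAt weight ((2 : ℝ) • x) x := by
  have h := ((hasStrictFDerivAt_norm_sq x).hasFDerivAt.const_add 1)
  refine (hasGradientAt_iff_hasFDerivAt).2 (h.congr_fderiv ?_)
  ext v
  simp

theorem gradient_radial {h : ℝ → ℝ} {x : Space d} (hh : DifferentiableAt ℝ h (weight x)) :
    ∇ (fun y => h (weight y)) x = (2 * deriv h (weight x)) • x := by
  have h1 := hh.hasDerivAt.comp_hasFDerivAt x (hasGradientAt_weight x).hasFDerivAt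
  refine HasGradientAt.gradient ?_
  refine (hasGradientAt_iff_hasFDerivAt).2 (h1.congr_fderiv ?_)
  ext v
  simp
  ring

theorem divergence_smul_id {f : Space d → ℝ} {x : Space d} (hf : DifferentiableAt ℝ f x) :
    divergence (fun y => f y • y) x = d * f x + fderiv ℝ f x x := by
  have h : fderiv ℝ (fun y => f y • y) x = _ := (hf.hasFDerivAt.smul (hasFDerivAt_id x)).fderiv
  unfold divergence
  have e : fderiv ℝ f x x = ∑ i, x i * fderiv ℝ f x (basisVec i) := by
    refine (congrArg (fderiv ℝ f x) (sum_smul_basisVec x)).trans ?_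
    simp [map_sum]
  rw [h, e]
  simp [basisVec, Finset.sum_add_distrib, mul_comm]

theorem laplacian_radial {h : ℝ → ℝ} (hh : ContDiff ℝ 2 h) (x : Space d) :
    Laplacian.laplacian (fun y : Space d => h (weight y)) x
      = 4 * ‖x‖ ^ 2 * deriv (deriv h) (weight x) + 2 * d * deriv h (weight x) := by
  have h1 : ContDiff ℝ 1 (deriv h) := by
    have := (contDiff_succ_iff_deriv (n := 1) (f := h)).1 (by simpa [one_add_one_eq_two] using hh)
    exact this.2.2
  have e : ∇ (fun y : Space d => h (weight y)) = fun y => (2 * deriv h (weight y)) • y := by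
    ext1 y
    exact gradient_radial (hh.differentiable two_ne_zero _)
  have h2 : HasFDerivAt (fun y : Space d => 2 * deriv h (weight y)) _ x :=
    ((h1.differentiable one_ne_zero (weight x)).hasDerivAt.comp_hasFDerivAt x
    (hasGradientAt_weight x).hasFDerivAt).const_mul 2
  rw [laplacian_eq_divergence_gradient (f := fun y : Space d => h (weight y))
    (hh.comp contDiff_weight), e,
    divergence_smul_id (f := fun y => 2 * deriv h (weight y)) h2.differentiableAt,
    HasFDerivAt.fderiv h2]
  simp
  ring

/-! ### Integrals over space-time strips -/

/-- The fundamental theorem of calculus in time, integrated over space, for functions whose time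
derivative is supported in a fixed compact set. -/
theorem integral_sub_eq_integral_deriv {f f' : Space d → ℝ → ℝ} {t : ℝ} (ht : 0 ≤ t)
    {K : Set (Space d)} (hK : IsCompact K)
    (hf : ∀ x, ∀ s ∈ Icc 0 t, HasDerivWithinAt (f x) (f' x s) (Icc 0 t) s)
    (hcont : ContinuousOn (fun z : Space d × ℝ => f' z.1 z.2) (univ ×ˢ Icc 0 t))
    (hsupp : ∀ x ∉ K, ∀ s, f' x s = 0) :
    ∫ x, (f x t - f x 0) = ∫ s in 0..t, ∫ x, f' x s := by
  have hx (x : Space d) : f x t - f x 0 = ∫ s in Ioc 0 t, f' x s := by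
    rw [← intervalIntegral.integral_of_le ht]
    symm
    have hc : ContinuousOn (f' x) (Icc 0 t) :=
      hcont.comp (f := fun s : ℝ => (x, s)) (by fun_prop) fun s hs => ⟨mem_univ _, hs⟩
    refine intervalIntegral.integral_eq_sub_of_hasDeriv_right_of_le ht
      (fun s hs => (hf x s hs).continuousWithinAt) (fun s hs => ?_)
      (hc.intervalIntegrable_of_Icc ht)
    exact (hf x s (Ioo_subset_Icc_self hs)).mono_of_mem_nhdsWithin
      (mem_nhdsWithin_of_mem_nhds (Icc_mem_nhds hs.1 hs.2))
  simp_rw [hx]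
  rw [intervalIntegral.integral_of_le ht]
  refine integral_integral_swap ?_
  have h1 : IntegrableOn (fun z : Space d × ℝ => f' z.1 z.2) (K ×ˢ Icc 0 t)
      (volume.prod volume) :=
    (hcont.mono (prod_mono (subset_univ _) le_rfl)).integrableOn_compact (hK.prod isCompact_Icc)
  have h2 : IntegrableOn (fun z : Space d × ℝ => f' z.1 z.2) (univ ×ˢ Icc 0 t)
      (volume.prod volume) := by
    refine h1.of_forall_sdiff_eq_zero (MeasurableSet.univ.prod measurableSet_Icc) fun z hz => ?_
    exact hsupp _ (fun h => hz.2 ⟨h, hz.1.2⟩) _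
  have h3 := h2.mono_set (prod_mono le_rfl Ioc_subset_Icc_self : univ ×ˢ Ioc 0 t ⊆ _)
  rw [IntegrableOn, ← Measure.prod_restrict, Measure.restrict_univ] at h3
  exact h3

theorem continuousOn_integral_strip {f : Space d → ℝ → ℝ} {T : ℝ}
    {K : Set (Space d)} (hK : IsCompact K)
    (hcont : ContinuousOn (fun z : Space d × ℝ => f z.1 z.2) (univ ×ˢ Icc 0 T))
    (hsupp : ∀ x ∉ K, ∀ s ∈ Icc 0 T, f x s = 0) :
    ContinuousOn (fun s => ∫ x, f x s) (Icc 0 T) := by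
  refine continuousOn_integral_of_compact_support hK (f := fun s x => f x s) ?_
    fun p x hp hx => hsupp x hx p hp
  exact hcont.comp continuous_swap.continuousOn fun z hz => ⟨mem_univ _, hz.1⟩

/-! ### Radial cutoffs -/

/-- Smooth cutoff on the line: `1` for `s ≤ R` and `0` for `s ≥ 2 R`. -/
def cutoff (R s : ℝ) : ℝ := Real.smoothTransition (2 - s / R)

theorem contDiff_cutoff (R : ℝ) {n : ℕ∞} : ContDiff ℝ n (cutoff R) :=
  Real.smoothTransition.contDiff.comp (contDiff_const.sub (contDiff_id.div_const R))

theorem cutoff_nonneg (R s : ℝ) : 0 ≤ cutoff R s := Real.smoothTransition.nonneg _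

theorem cutoff_le_one (R s : ℝ) : cutoff R s ≤ 1 := Real.smoothTransition.le_one _

theorem cutoff_eq_one {R s : ℝ} (hR : 0 < R) (h : s ≤ R) : cutoff R s = 1 :=
  Real.smoothTransition.one_of_one_le (by have := (div_le_one hR).2 h; linarith)

theorem cutoff_eq_zero {R s : ℝ} (hR : 0 < R) (h : 2 * R ≤ s) : cutoff R s = 0 :=
  Real.smoothTransition.zero_of_nonpos (by have := (le_div_iff₀ hR).2 h; linarith)

theorem deriv_cutoff (R : ℝ) : deriv (cutoff R) = fun s => deriv (cutoff 1) (s / R) / R := by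
  ext s
  have h : cutoff R = fun s => cutoff 1 (s / R) := by ext; simp [cutoff]
  have h1 : HasDerivAt (cutoff 1) (deriv (cutoff 1) (s / R)) (s / R) :=
    ((contDiff_cutoff 1 (n := 1)).differentiable (by simp) _).hasDerivAt
  rw [h]
  have := (HasDerivAt.comp s h1 ((hasDerivAt_id s).div_const R)).deriv
  simpa [Function.comp_def, div_eq_mul_inv] using this

theorem deriv_deriv_cutoff (R : ℝ) :
    deriv (deriv (cutoff R)) = fun s => deriv (deriv (cutoff 1)) (s / R) / R / R := by
  ext s
  have h0 : ContDiff ℝ 1 (deriv (cutoff 1)) :=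
    ((contDiff_succ_iff_deriv (n := 1)).1 (contDiff_cutoff 1 (n := 2))).2.2
  have h1 : HasDerivAt (deriv (cutoff 1)) (deriv (deriv (cutoff 1)) (s / R)) (s / R) :=
    (h0.differentiable (by simp) _).hasDerivAt
  rw [deriv_cutoff R]
  have := ((HasDerivAt.comp s h1 ((hasDerivAt_id s).div_const R)).div_const R).deriv
  simpa [Function.comp_def, div_eq_mul_inv] using this

/-- Both derivatives of the cutoff are of order `1 / R`, where the second is even of order
`1 / R²`. A bound of order `1 / R` is all that is needed for the cutoff terms to vanish, because
all moments of the densities are finite. -/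
theorem exists_bound_deriv_cutoff : ∃ C > (0 : ℝ), ∀ R ≥ (1 : ℝ), ∀ s,
    |deriv (cutoff R) s| ≤ C / R ∧ |deriv (deriv (cutoff R)) s| ≤ C / R := by
  have h0 : ContDiff ℝ 1 (deriv (cutoff 1)) :=
    ((contDiff_succ_iff_deriv (n := 1)).1 (contDiff_cutoff 1 (n := 2))).2.2
  have hs : HasCompactSupport (deriv (cutoff 1)) := by
    refine HasCompactSupport.intro (isCompact_Icc (a := (1 : ℝ)) (b := 2)) fun s hs => ?_
    rcases lt_or_ge s 1 with h | h
    · have : cutoff 1 =ᶠ[𝓝 s] fun _ => 1 := by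
        filter_upwards [Iio_mem_nhds h] with y hy using cutoff_eq_one one_pos (le_of_lt hy)
      rw [this.deriv_eq, deriv_const]
    · have h' : 2 < s := by
        by_contra! h'
        exact hs ⟨h, h'⟩
      have : cutoff 1 =ᶠ[𝓝 s] fun _ => 0 := by
        filter_upwards [Ioi_mem_nhds h'] with y hy
        exact cutoff_eq_zero one_pos (by simpa using le_of_lt hy)
      rw [this.deriv_eq, deriv_const]
  obtain ⟨C₁, h₁⟩ := hs.exists_bound_of_continuous h0.continuous
  obtain ⟨C₂, h₂⟩ := hs.deriv.exists_bound_of_continuous (h0.continuous_deriv le_rfl)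
  have p₁ := (norm_nonneg _).trans (h₁ 0)
  have p₂ := (norm_nonneg _).trans (h₂ 0)
  refine ⟨C₁ + C₂ + 1, by positivity, fun R hR s => ⟨?_, ?_⟩⟩
  · rw [deriv_cutoff, abs_div, abs_of_pos (zero_lt_one.trans_le hR)]
    gcongr
    have := h₁ (s / R)
    rw [Real.norm_eq_abs] at this
    linarith
  · rw [deriv_deriv_cutoff, abs_div, abs_div, abs_of_pos (zero_lt_one.trans_le hR), div_div]
    have := h₂ (s / R)
    rw [Real.norm_eq_abs] at this
    refine div_le_div₀ (by positivity) (by linarith) (by linarith) ?_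
    nlinarith

theorem exists_bound_deriv_cutoff_sq : ∃ C > (0 : ℝ), ∀ R ≥ (1 : ℝ), ∀ s,
    |deriv (fun r => cutoff R r ^ 2) s| ≤ C / R ∧
      |deriv (deriv fun r => cutoff R r ^ 2) s| ≤ C / R := by
  obtain ⟨C, hC, h⟩ := exists_bound_deriv_cutoff
  refine ⟨2 * C + 2 * C ^ 2, by positivity, fun R hR => ?_⟩
  have hR0 : 0 < R := zero_lt_one.trans_le hR
  have d0 (s : ℝ) : HasDerivAt (cutoff R) (deriv (cutoff R) s) s :=
    ((contDiff_cutoff R (n := 1)).differentiable (by simp) _).hasDerivAt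
  have h0 : ContDiff ℝ 1 (deriv (cutoff R)) :=
    ((contDiff_succ_iff_deriv (n := 1)).1 (contDiff_cutoff R (n := 2))).2.2
  have d1 (s : ℝ) : HasDerivAt (deriv (cutoff R)) (deriv (deriv (cutoff R)) s) s :=
    (h0.differentiable (by simp) _).hasDerivAt
  have e1 : deriv (fun r => cutoff R r ^ 2) = fun s => 2 * (cutoff R s * deriv (cutoff R) s) := by
    ext s
    refine (HasDerivAt.deriv ((d0 s).pow 2)).trans ?_
    simp
    ring
  have key (a b : ℝ) (ha0 : 0 ≤ a) (ha : a ≤ 1) (hb : |b| ≤ C / R) : |a * b| ≤ C / R := by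
    rw [abs_mul, abs_of_nonneg ha0]
    exact (mul_le_of_le_one_left (abs_nonneg _) ha).trans hb
  intro s
  have k1 := key _ _ (cutoff_nonneg R s) (cutoff_le_one R s) (h R hR s).1
  have k2 := key _ _ (cutoff_nonneg R s) (cutoff_le_one R s) (h R hR s).2
  constructor
  · rw [e1]
    have e : |2 * (cutoff R s * deriv (cutoff R) s)| = 2 * |cutoff R s * deriv (cutoff R) s| := by
      rw [abs_mul, abs_two]
    calc _ = _ := e
      _ ≤ 2 * (C / R) := by gcongr
      _ = 2 * C / R := by ring
      _ ≤ _ := by gcongr; nlinarith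
  · have e2 : deriv (fun s => 2 * (cutoff R s * deriv (cutoff R) s)) s = _ :=
      (((d0 s).mul (d1 s)).const_mul 2).deriv
    rw [e1, e2, abs_mul, abs_two]
    have k3 : |deriv (cutoff R) s * deriv (cutoff R) s| ≤ C ^ 2 / R := by
      rw [abs_mul]
      calc _ ≤ C / R * (C / R) := by gcongr <;> exact (h R hR s).1
        _ = C ^ 2 / R / R := by ring
        _ ≤ C ^ 2 / R := div_le_self (by positivity) hR
    calc _ ≤ 2 * (C ^ 2 / R + C / R) := by
          gcongr
          exact (abs_add_le _ _).trans (add_le_add k3 k2)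
      _ = _ := by ring

theorem norm_gradient_radial_le {h : ℝ → ℝ} (hh : ContDiff ℝ 2 h) {C : ℝ}
    (h1 : ∀ s, |deriv h s| ≤ C) (x : Space d) :
    ‖∇ (fun y : Space d => h (weight y)) x‖ ≤ 2 * C * ‖x‖ := by
  rw [gradient_radial (hh.differentiable two_ne_zero _), norm_smul, Real.norm_eq_abs, abs_mul,
    abs_two]
  gcongr
  exact h1 _

theorem abs_laplacian_radial_le {h : ℝ → ℝ} (hh : ContDiff ℝ 2 h) {C : ℝ}
    (h1 : ∀ s, |deriv h s| ≤ C) (h2 : ∀ s, |deriv (deriv h) s| ≤ C) (x : Space d) :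
    |Laplacian.laplacian (fun y : Space d => h (weight y)) x| ≤ (4 + 2 * d) * C * weight x := by
  have hC : 0 ≤ C := (abs_nonneg _).trans (h1 0)
  rw [laplacian_radial hh]
  refine (abs_add_le _ _).trans ?_
  rw [abs_mul, abs_mul (2 * (d : ℝ)), abs_of_nonneg (by positivity : (0 : ℝ) ≤ 4 * ‖x‖ ^ 2),
    abs_of_nonneg (by positivity : (0 : ℝ) ≤ 2 * d)]
  have e1 : 4 * ‖x‖ ^ 2 * |deriv (deriv h) (weight x)| ≤ 4 * weight x * C := by
    have : ‖x‖ ^ 2 ≤ weight x := by unfold weight; linarith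
    have := weight_pos x
    gcongr
    exact h2 _
  have e2 : 2 * d * |deriv h (weight x)| ≤ 2 * d * (C * weight x) := by
    gcongr
    exact (h1 _).trans (le_mul_of_one_le_right hC (one_le_weight x))
  calc _ ≤ _ := add_le_add e1 e2
    _ = _ := by ring

theorem isCompact_weight_le (R : ℝ) : IsCompact {x : Space d | weight x ≤ R} := by
  refine Metric.isCompact_of_isClosed_isBounded
    (isClosed_le (contDiff_weight (n := 0)).continuous continuous_const) ?_
  refine (Metric.isBounded_closedBall (x := (0 : Space d)) (r := |R| + 1)).subset fun x hx => ?_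
  have h : 1 + ‖x‖ ^ 2 ≤ R := hx
  rw [mem_closedBall_zero_iff]
  nlinarith [le_abs_self R, norm_nonneg x]

/-- The radial cutoff on `ℝ^d`, equal to `1` where `1 + ‖x‖² ≤ R` and to `0` where
`1 + ‖x‖² ≥ 2 R`. -/
def spaceCutoff (R : ℝ) (x : Space d) : ℝ := cutoff R (weight x)

theorem contDiff_spaceCutoff (R : ℝ) {n : ℕ∞} : ContDiff ℝ n (spaceCutoff (d := d) R) :=
  (contDiff_cutoff R).comp contDiff_weight

theorem spaceCutoff_eq_zero {R : ℝ} (hR : 0 < R) {x : Space d}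
    (hx : x ∉ {x : Space d | weight x ≤ 2 * R}) : spaceCutoff R x = 0 :=
  cutoff_eq_zero hR (le_of_lt (not_le.1 hx))

theorem hasCompactSupport_spaceCutoff {R : ℝ} (hR : 0 < R) :
    HasCompactSupport (spaceCutoff (d := d) R) :=
  HasCompactSupport.intro (isCompact_weight_le (2 * R)) fun _ hx => spaceCutoff_eq_zero hR hx

theorem spaceCutoff_nonneg (R : ℝ) (x : Space d) : 0 ≤ spaceCutoff R x := cutoff_nonneg _ _

theorem spaceCutoff_le_one (R : ℝ) (x : Space d) : spaceCutoff R x ≤ 1 := cutoff_le_one _ _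

theorem spaceCutoff_eq_one {R : ℝ} (hR : 0 < R) {x : Space d} (h : weight x ≤ R) :
    spaceCutoff R x = 1 := cutoff_eq_one hR h

/-! ### Consequences of the structure conditions on the Hamiltonian -/

theorem HamiltonianAssumption.contDiff {H : Space d → Space d → ℝ} (hH : HamiltonianAssumption H)
    (x : Space d) : ContDiff ℝ ∞ (H x) :=
  hH.smooth.comp (contDiff_const.prodMk contDiff_id)

theorem HamiltonianAssumption.contDiff_gradP {H : Space d → Space d → ℝ}
    (hH : HamiltonianAssumption H) : ContDiff ℝ 2 fun z : Space d × Space d => gradP H z.1 z.2 := by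
  have h1 : ContDiff ℝ 2 fun z : Space d × Space d => fderiv ℝ (H z.1) z.2 := by
    refine ContDiff.fderiv (m := 3) (f := fun (z : Space d × Space d) q => H z.1 q) ?_
      contDiff_snd (by norm_num)
    exact (contDiff_infty.1 hH.smooth 3).comp
      ((contDiff_fst.comp contDiff_fst).prodMk contDiff_snd)
  exact (InnerProductSpace.toDual ℝ (Space d)).symm.toContinuousLinearEquiv.contDiff.comp h1

/-- The tangent plane inequality for the convex function `H x`. -/
theorem HamiltonianAssumption.tangent {H : Space d → Space d → ℝ} (hH : HamiltonianAssumption H)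
    (x p q : Space d) : 0 ≤ H x q - H x p - inner ℝ (gradP H x p) (q - p) := by
  have hl : ConvexOn ℝ univ fun t : ℝ => H x (p + t • (q - p)) := by
    have := (hH.strictConvex x).convexOn.comp_affineMap (AffineMap.lineMap (k := ℝ) p q)
    simpa [Function.comp_def, AffineMap.lineMap_apply, add_comm] using this
  have hd : HasDerivAt (fun t : ℝ => H x (p + t • (q - p)))
      (inner ℝ (gradP H x p) (q - p)) 0 := by
    have h1 : HasFDerivAt (H x) (fderiv ℝ (H x) p) (p + (0 : ℝ) • (q - p)) := by
      simpa using ((hH.contDiff x).differentiable (by simp) p).hasFDerivAt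
    have h2 : HasDerivAt (fun t : ℝ => p + t • (q - p)) (q - p) 0 := by
      simpa using ((hasDerivAt_id (0 : ℝ)).smul_const (q - p)).const_add p
    have h3 := h1.comp_hasDerivAt (0 : ℝ) h2
    rw [gradP, inner_gradient_left]
    exact h3
  have := hl.le_slope_of_hasDerivAt (mem_univ 0) (mem_univ 1) zero_lt_one hd
  simp [slope_def_field] at this
  linarith

/-- Equality in the tangent plane inequality holds only at the point of contact, by strict
convexity. -/
theorem HamiltonianAssumption.eq_of_tangent_eq {H : Space d → Space d → ℝ}
    (hH : HamiltonianAssumption H) {x p q : Space d}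
    (h : H x q - H x p - inner ℝ (gradP H x p) (q - p) = 0) : p = q := by
  by_contra hne
  have h1 := (hH.strictConvex x).2 (mem_univ p) (mem_univ q) hne
    (by norm_num : (0 : ℝ) < 1 / 2) (by norm_num : (0 : ℝ) < 1 / 2) (by norm_num)
  have h2 := hH.tangent x p ((1 / 2 : ℝ) • p + (1 / 2 : ℝ) • q)
  have e : (1 / 2 : ℝ) • p + (1 / 2 : ℝ) • q - p = (1 / 2 : ℝ) • (q - p) := by module
  rw [e, inner_smul_right] at h2
  simp only [smul_eq_mul] at h1
  linarith

theorem frobSq_nonneg (A : Matrix (Fin d) (Fin d) ℝ) : 0 ≤ frobSq A :=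
  Finset.sum_nonneg fun _ _ => Finset.sum_nonneg fun _ _ => sq_nonneg _

theorem sq_trace_le (A : Matrix (Fin d) (Fin d) ℝ) : A.trace ^ 2 ≤ d * frobSq A := by
  have h := sq_sum_le_card_mul_sum_sq (s := Finset.univ) (f := fun i => A i i)
  simp only [Finset.card_univ, Fintype.card_fin] at h
  refine h.trans ?_
  gcongr
  exact Finset.sum_le_sum fun i _ =>
    Finset.single_le_sum (f := fun j => A i j ^ 2) (fun _ _ => sq_nonneg _) (Finset.mem_univ i)

theorem HamiltonianAssumption.norm_fderiv_gradP_sq_le {H : Space d → Space d → ℝ}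
    (hH : HamiltonianAssumption H) (x p : Space d) :
    ‖fderiv ℝ (gradP H x) p‖ ^ 2 ≤ frobSq (hessPP H x p) := by
  have hd : DifferentiableAt ℝ (gradP H x) p :=
    (hH.contDiff_gradP.comp (contDiff_const.prodMk contDiff_id)).differentiable two_ne_zero p
  suffices ‖fderiv ℝ (gradP H x) p‖ ≤ √(frobSq (hessPP H x p)) by
    calc _ ≤ √(frobSq (hessPP H x p)) ^ 2 := by gcongr
      _ = _ := Real.sq_sqrt (frobSq_nonneg _)
  refine ContinuousLinearMap.opNorm_le_bound _ (Real.sqrt_nonneg _) fun v => ?_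
  have hj (j : Fin d) : (fderiv ℝ (gradP H x) p v) j = ∑ i, hessPP H x p i j * v i := by
    have h1 := ((EuclideanSpace.proj (𝕜 := ℝ) j).hasFDerivAt.comp p hd.hasFDerivAt).fderiv
    have h2 : (fun q => (gradP H x q) j) = (EuclideanSpace.proj (𝕜 := ℝ) j) ∘ gradP H x := rfl
    have h3 : (fderiv ℝ (gradP H x) p v) j = fderiv ℝ (fun q => (gradP H x q) j) p v := by
      rw [h2, h1]
      rfl
    rw [h3]
    refine (congrArg _ (sum_smul_basisVec v)).trans ?_
    simp [hessPP, map_sum, mul_comm]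
  refine le_of_sq_le_sq ?_ (by positivity)
  rw [mul_pow, Real.sq_sqrt (frobSq_nonneg _), EuclideanSpace.real_norm_sq_eq,
    EuclideanSpace.real_norm_sq_eq, frobSq, Finset.sum_comm, Finset.sum_mul]
  refine Finset.sum_le_sum fun j _ => ?_
  rw [hj]
  exact Finset.sum_mul_sq_le_sq_mul_sq _ _ _

/-- Taking `M = 1` in the second part of the Hessian assumption bounds the square of the
Frobenius norm of `D²_{pp} H` by its trace, hence bounds `D²_{pp} H`. -/
theorem exists_lipschitz_gradP {H : Space d → Space d → ℝ} (hH : HamiltonianAssumption H)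
    (hhess : HessianAssumption H) :
    ∃ L > (0 : ℝ), ∀ x p q, ‖gradP H x q - gradP H x p‖ ≤ L * ‖q - p‖ := by
  obtain ⟨C, hC, h⟩ := hhess
  refine ⟨C * (d + 1), by positivity, fun x p q => ?_⟩
  have hd : Differentiable ℝ (gradP H x) :=
    (hH.contDiff_gradP.comp (contDiff_const.prodMk contDiff_id)).differentiable two_ne_zero
  refine Convex.norm_image_sub_le_of_norm_fderiv_le (𝕜 := ℝ) (s := univ) (fun y _ => hd y)
    (fun y _ => ?_) convex_univ (mem_univ p) (mem_univ q)
  have h1 := (h x y).2 1 Matrix.isSymm_one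
  simp only [mul_one] at h1
  have h2 := sq_trace_le (hessPP H x y)
  set f := frobSq (hessPP H x y)
  have hf : 0 ≤ f := frobSq_nonneg _
  have h3 : f ≤ C ^ 2 * d := by
    by_contra! hlt
    have hfp : 0 < f := lt_of_le_of_lt (by positivity) hlt
    have h4 : f ^ 2 ≤ C ^ 2 * (d * f) := by
      calc f ^ 2 ≤ (C * (hessPP H x y).trace) ^ 2 := by gcongr
        _ = C ^ 2 * (hessPP H x y).trace ^ 2 := by ring
        _ ≤ _ := by gcongr
    nlinarith
  refine le_of_sq_le_sq ((hH.norm_fderiv_gradP_sq_le x y).trans (h3.trans ?_)) (by positivity)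
  rw [mul_pow]
  gcongr
  have : (0 : ℝ) ≤ d := by positivity
  nlinarith

/-- The drift grows at most linearly in the momentum, uniformly in the position. The bound at
`p = 0` uses that `H (·, 0)` is bounded, by the growth condition, and that a non-negative function
with Lipschitz gradient controls the square of its gradient. -/
theorem exists_norm_gradP_le {H : Space d → Space d → ℝ} (hH : HamiltonianAssumption H)
    (hgrowth : GrowthAssumption H) (hhess : HessianAssumption H) :
    ∃ L > (0 : ℝ), ∀ x p, ‖gradP H x p‖ ≤ L * (1 + ‖p‖) := by
  obtain ⟨L, hL, hlip⟩ := exists_lipschitz_gradP hH hhess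
  obtain ⟨c, hc, C, hC, hg⟩ := hgrowth
  have h0 (x : Space d) : H x 0 ≤ C := by
    have := hg x 0
    have := hH.nonneg x 0
    simp at *
    nlinarith
  have h1 (x : Space d) : ‖gradP H x 0‖ ^ 2 ≤ 4 * L * C := by
    -- a step of gradient descent from `0`, of a length adapted to the Lipschitz constant
    set v := gradP H x 0 with hv
    set q : Space d := -(1 / (2 * L)) • v with hq
    have t := hH.tangent x q 0
    have nn := hH.nonneg x q
    have e : inner ℝ (gradP H x q) (0 - q) = inner ℝ (gradP H x q - v) (0 - q)
        + 1 / (2 * L) * ‖v‖ ^ 2 := by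
      rw [inner_sub_left, hq, zero_sub, ← neg_smul, neg_neg, inner_smul_right v v,
        real_inner_self_eq_norm_sq]
      ring
    have b : |inner ℝ (gradP H x q - v) (0 - q)| ≤ L * ‖q‖ ^ 2 := by
      refine (abs_real_inner_le_norm _ _).trans ?_
      have := hlip x 0 q
      rw [sub_zero] at this
      rw [zero_sub, norm_neg, pow_two, ← mul_assoc]
      gcongr
    have nq : L * ‖q‖ ^ 2 = 1 / (4 * L) * ‖v‖ ^ 2 := by
      rw [hq, norm_smul, Real.norm_eq_abs, abs_neg, abs_of_pos (by positivity)]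
      field_simp
      ring
    have b' := neg_le_of_abs_le b
    have : 1 / (4 * L) * ‖v‖ ^ 2 ≤ C := by
      have e2 : 1 / (2 * L) * ‖v‖ ^ 2 = 2 * (1 / (4 * L) * ‖v‖ ^ 2) := by field_simp; ring
      linarith [h0 x]
    calc ‖v‖ ^ 2 = 4 * L * (1 / (4 * L) * ‖v‖ ^ 2) := by field_simp
      _ ≤ _ := by gcongr
  refine ⟨L + √(4 * L * C), by positivity, fun x p => ?_⟩
  have h2 : ‖gradP H x 0‖ ≤ √(4 * L * C) := Real.le_sqrt_of_sq_le (h1 x)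
  have h3 := hlip x 0 p
  rw [sub_zero] at h3
  have h4 : ‖gradP H x p‖ ≤ ‖gradP H x p - gradP H x 0‖ + ‖gradP H x 0‖ := norm_le_norm_sub_add _ _
  nlinarith [norm_nonneg p, Real.sqrt_nonneg (4 * L * C),
    mul_nonneg (Real.sqrt_nonneg (4 * L * C)) (norm_nonneg p)]

/-! ### Fokker-Planck equations with a prescribed bound on the flux -/

theorem integral_mul_laplacian {ψ f : Space d → ℝ} (hψ : ContDiff ℝ 1 ψ) (hf : ContDiff ℝ 2 f)
    (hc : HasCompactSupport ψ) :
    ∫ x, ψ x * Laplacian.laplacian f x = - ∫ x, fderiv ℝ ψ x (∇ f x) := by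
  simp_rw [laplacian_eq_divergence_gradient hf]
  exact integral_mul_divergence hψ (contDiff_gradient (by simpa [one_add_one_eq_two] using hf))
    (Or.inl hc)

theorem hasCompactSupport_gradient {ψ : Space d → ℝ} (hc : HasCompactSupport ψ) :
    HasCompactSupport (∇ ψ) :=
  (hc.fderiv ℝ).comp_left (g := (InnerProductSpace.toDual ℝ (Space d)).symm) (map_zero _)

theorem fderiv_gradient_comm (ψ f : Space d → ℝ) (x : Space d) :
    fderiv ℝ ψ x (∇ f x) = fderiv ℝ f x (∇ ψ x) := by
  rw [← inner_gradient_left, ← inner_gradient_left, real_inner_comm]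

theorem integral_fderiv_gradient {ψ f : Space d → ℝ} (hψ : ContDiff ℝ 2 ψ) (hf : ContDiff ℝ 1 f)
    (hc : HasCompactSupport ψ) :
    ∫ x, fderiv ℝ ψ x (∇ f x) = - ∫ x, f x * Laplacian.laplacian ψ x := by
  simp_rw [laplacian_eq_divergence_gradient hψ]
  rw [integral_congr_ae (Eventually.of_forall (fderiv_gradient_comm ψ f))]
  rw [integral_mul_divergence hf (contDiff_gradient (by simpa [one_add_one_eq_two] using hψ))
    (Or.inr (hasCompactSupport_gradient hc)), neg_neg]

theorem continuous_divergence {F : Space d → Space d} (hF : ContDiff ℝ 1 F) :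
    Continuous (divergence F) :=
  continuous_finsetSum _ fun i _ => (EuclideanSpace.proj (𝕜 := ℝ) i).continuous.comp
    ((hF.continuous_fderiv one_ne_zero).clm_apply continuous_const)

theorem continuous_laplacian {f : Space d → ℝ} (hf : ContDiff ℝ 2 f) :
    Continuous (Laplacian.laplacian f) := by
  rw [show Laplacian.laplacian f = divergence (∇ f) from
    funext (laplacian_eq_divergence_gradient hf)]
  exact continuous_divergence (contDiff_gradient (by simpa [one_add_one_eq_two] using hf))

theorem hasCompactSupport_laplacian {f : Space d → ℝ} (hc : HasCompactSupport f) :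
    HasCompactSupport (Laplacian.laplacian f) := by
  refine HasCompactSupport.intro hc fun x hx => ?_
  rw [(InnerProductSpace.laplacian_congr_nhds
    (notMem_tsupport_iff_eventuallyEq.1 hx)).eq_of_nhds]
  exact congrFun (InnerProductSpace.laplacian_const (c := (0 : ℝ))) x

theorem integrable_fderiv_apply {ψ : Space d → ℝ} {F : Space d → Space d} (hψ : ContDiff ℝ 1 ψ)
    (hc : HasCompactSupport ψ) (hF : Continuous F) : Integrable fun x => fderiv ℝ ψ x (F x) := by
  refine ((hψ.continuous_fderiv one_ne_zero).clm_apply hF).integrable_of_hasCompactSupport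
    (HasCompactSupport.intro (hc.fderiv ℝ) fun x hx => ?_)
  rw [image_eq_zero_of_notMem_tsupport hx]
  rfl

/-- `m` is a classical non-negative solution of `m_t = Δm + div F` of bounded mass, whose flux `F`
satisfies `|F| ≤ K (1 + |x|) m`. Only the size of the flux enters the estimates below, so that no
drift has to be specified where `m` vanishes. -/
structure IsFluxSolution (T K : ℝ) (m₀ : Space d → ℝ) (m : Space d → ℝ → ℝ)
    (F : ℝ → Space d → Space d) : Prop where
  regular : IsC21 T m
  contDiff_flux : ∀ t ∈ Icc 0 T, ContDiff ℝ 1 (F t)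
  norm_flux_le : ∀ x, ∀ t ∈ Icc 0 T, ‖F t x‖ ≤ K * (1 + ‖x‖) * m x t
  equation : ∀ x, ∀ t ∈ Icc 0 T, derivWithin (m x) (Icc 0 T) t
    = Laplacian.laplacian (fun y => m y t) x + divergence (F t) x
  initial : ∀ x, m x 0 = m₀ x
  nonneg : ∀ x, ∀ t ∈ Icc 0 T, 0 ≤ m x t
  mass : ∃ A : ℝ, ∀ t ∈ Icc 0 T, Integrable (fun x => m x t) ∧ ∫ x, m x t ≤ A

/-- The field `m D_pH(x, Du)`. -/
def hamiltonianFlux (H : Space d → Space d → ℝ) (u m : Space d → ℝ → ℝ) (t : ℝ) (x : Space d) :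
    Space d := m x t • gradP H x (∇ (fun z => u z t) x)

theorem IsC21.contDiff_gradient {T : ℝ} {f : Space d → ℝ → ℝ} (hf : IsC21 T f) {t : ℝ}
    (ht : t ∈ Icc 0 T) : ContDiff ℝ 1 (∇ fun x => f x t) :=
  MeanField.contDiff_gradient (by simpa [one_add_one_eq_two] using hf.contDiff_space t ht)

theorem IsC21.continuous_gradient {T : ℝ} {f : Space d → ℝ → ℝ} (hf : IsC21 T f) :
    ContinuousOn (fun z : Space d × ℝ => ∇ (fun x => f x z.2) z.1) (univ ×ˢ Icc 0 T) :=
  (InnerProductSpace.toDual ℝ (Space d)).symm.continuous.comp_continuousOn hf.continuous_fderiv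

theorem IsC21.hasDerivWithinAt {T : ℝ} {f : Space d → ℝ → ℝ} (hf : IsC21 T f) (x : Space d)
    {t : ℝ} (ht : t ∈ Icc 0 T) :
    HasDerivWithinAt (f x) (derivWithin (f x) (Icc 0 T) t) (Icc 0 T) t :=
  (hf.differentiable_time x t ht).hasDerivWithinAt

theorem continuous_slice {T : ℝ} {E : Type*} [TopologicalSpace E] {f : Space d × ℝ → E}
    (hf : ContinuousOn f (univ ×ˢ Icc 0 T)) {t : ℝ} (ht : t ∈ Icc 0 T) :
    Continuous fun x => f (x, t) :=
  continuousOn_univ.1 (hf.comp (by fun_prop) fun _ _ => ⟨mem_univ _, ht⟩)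

theorem IsSolution.contDiff_flux {T : ℝ} {H : Space d → Space d → ℝ} {g : ℝ → ℝ}
    {uT m₀ : Space d → ℝ} {u m : Space d → ℝ → ℝ} (hH : HamiltonianAssumption H)
    (h : IsSolution T H g uT m₀ u m) {t : ℝ} (ht : t ∈ Icc 0 T) :
    ContDiff ℝ 1 (hamiltonianFlux H u m t) :=
  ((h.regular_m.contDiff_space t ht).of_le one_le_two).smul
    ((hH.contDiff_gradP.of_le one_le_two).comp
      (contDiff_id.prodMk (h.regular_u.contDiff_gradient ht)))

theorem IsSolution.isFluxSolution {T K : ℝ} {H : Space d → Space d → ℝ} {g : ℝ → ℝ}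
    {uT m₀ : Space d → ℝ} {u m : Space d → ℝ → ℝ} (hH : HamiltonianAssumption H)
    (h : IsSolution T H g uT m₀ u m)
    (hK : ∀ x, ∀ t ∈ Icc 0 T, ‖hamiltonianFlux H u m t x‖ ≤ K * (1 + ‖x‖) * m x t) :
    IsFluxSolution T K m₀ m (hamiltonianFlux H u m) where
  regular := h.regular_m
  contDiff_flux _ ht := h.contDiff_flux hH ht
  norm_flux_le := hK
  equation x t ht := sub_eq_iff_eq_add.1 (h.fokkerPlanck x t ht)
  initial := h.initial
  nonneg := h.nonneg_m
  mass := h.mass_m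

theorem IsSolution.exists_norm_drift_le {T : ℝ} {H : Space d → Space d → ℝ} {g : ℝ → ℝ}
    {uT m₀ : Space d → ℝ} {u m : Space d → ℝ → ℝ} (hH : HamiltonianAssumption H)
    (hgrowth : GrowthAssumption H) (hhess : HessianAssumption H)
    (h : IsSolution T H g uT m₀ u m) :
    ∃ K ≥ (0 : ℝ), ∀ x, ∀ t ∈ Icc 0 T,
      ‖gradP H x (∇ (fun z => u z t) x)‖ ≤ K * (1 + ‖x‖) := by
  obtain ⟨L, hL, hb⟩ := exists_norm_gradP_le hH hgrowth hhess
  obtain ⟨K, hK⟩ := h.growth_u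
  refine ⟨L * (1 + |K|), by positivity, fun x t ht => (hb x _).trans ?_⟩
  rw [mul_assoc]
  gcongr
  have h1 := hK x t ht
  have h2 : K * (1 + ‖x‖) ≤ |K| * (1 + ‖x‖) := by gcongr; exact le_abs_self K
  nlinarith [norm_nonneg x, abs_nonneg K]

/-- The weak form of the equation at a fixed time. -/
theorem IsFluxSolution.integral_mul_deriv {T K : ℝ} {m₀ : Space d → ℝ} {m : Space d → ℝ → ℝ}
    {F : ℝ → Space d → Space d} (h : IsFluxSolution T K m₀ m F) {ψ : Space d → ℝ}
    (hψ : ContDiff ℝ 1 ψ) (hc : HasCompactSupport ψ) {t : ℝ} (ht : t ∈ Icc 0 T) :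
    ∫ x, ψ x * derivWithin (m x) (Icc 0 T) t
      = - (∫ x, fderiv ℝ ψ x (∇ (fun y => m y t) x)) - ∫ x, fderiv ℝ ψ x (F t x) := by
  have hm := h.regular.contDiff_space t ht
  simp_rw [h.equation _ t ht, mul_add]
  rw [integral_add, integral_mul_laplacian hψ hm hc,
    integral_mul_divergence hψ (h.contDiff_flux t ht) (Or.inl hc), sub_eq_add_neg]
  · exact (hψ.continuous.mul (continuous_laplacian hm)).integrable_of_hasCompactSupport hc.mul_right
  · exact (hψ.continuous.mul (continuous_divergence
      (h.contDiff_flux t ht))).integrable_of_hasCompactSupport hc.mul_right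

/-! ### Moment bounds -/

/-- A smooth approximation of `s ^ k` that decays like `s ^ (-k - 2)` at infinity. -/
def momentWeight (k : ℕ) (ε s : ℝ) : ℝ := s ^ k / (1 + ε * s ^ 2) ^ (k + 1)

section momentWeight

variable {k : ℕ} {ε : ℝ}

theorem contDiff_momentWeight (hε : 0 < ε) : ContDiff ℝ 2 (momentWeight k ε) := by
  unfold momentWeight
  refine ContDiff.div (by fun_prop) (by fun_prop) fun s => ?_
  positivity

theorem momentWeight_nonneg (hε : 0 < ε) {s : ℝ} (hs : 0 ≤ s) : 0 ≤ momentWeight k ε s := by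
  unfold momentWeight
  positivity

theorem momentWeight_le (hε : 0 < ε) {s : ℝ} (hs : 0 ≤ s) : momentWeight k ε s ≤ s ^ k :=
  div_le_self (by positivity) (one_le_pow₀ (by nlinarith [sq_nonneg s]))

theorem mul_momentWeight_le (hε : 0 < ε) {s : ℝ} (hs : 1 ≤ s) :
    s * momentWeight k ε s ≤ (1 / ε) ^ (k + 1) := by
  have hs0 : 0 < s := by linarith
  have e : s * momentWeight k ε s = (s / (1 + ε * s ^ 2)) ^ (k + 1) := by
    unfold momentWeight
    rw [div_pow, pow_succ s k]
    ring
  rw [e]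
  refine pow_le_pow_left₀ (by positivity) ?_ _
  rw [div_le_div_iff₀ (by positivity) hε]
  nlinarith [mul_le_mul_of_nonneg_left hs (mul_pos hε hs0).le]

/-- The logarithmic derivative of `momentWeight k ε`. -/
def momentLogDeriv (k : ℕ) (ε s : ℝ) : ℝ := k * s⁻¹ - (k + 1) * (2 * ε * s / (1 + ε * s ^ 2))

/-- The derivative is written as a multiple of the function itself, so that the bounds on the
logarithmic derivative carry over with constants independent of `ε`. -/
theorem hasDerivAt_momentWeight (hε : 0 < ε) {s : ℝ} (hs : 0 < s) :
    HasDerivAt (momentWeight k ε) (momentWeight k ε s * momentLogDeriv k ε s) s := by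
  have e : ∀ r > 0, momentWeight k ε r
      = Real.exp (k * Real.log r - (k + 1) * Real.log (1 + ε * r ^ 2)) := fun r hr => by
    have : (0 : ℝ) < 1 + ε * r ^ 2 := by positivity
    rw [Real.exp_sub, ← Real.log_pow, Real.exp_log (by positivity), momentWeight]
    congr 1
    rw [show ((k : ℝ) + 1) = ((k + 1 : ℕ) : ℝ) by push_cast; ring, ← Real.log_pow,
      Real.exp_log (by positivity)]
  have h1 : HasDerivAt (fun r => (k : ℝ) * Real.log r - (k + 1) * Real.log (1 + ε * r ^ 2))
      (momentLogDeriv k ε s) s := by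
    have h2 : HasDerivAt (fun r => 1 + ε * r ^ 2) (2 * ε * s) s := by
      have := (((hasDerivAt_id s).pow 2).const_mul ε).const_add 1
      refine this.congr_deriv ?_
      simp
      ring
    exact ((Real.hasDerivAt_log hs.ne').const_mul _).sub ((h2.log (by positivity)).const_mul _)
  have h3 := h1.exp
  rw [← e s hs] at h3
  refine h3.congr_of_eventuallyEq ?_
  filter_upwards [Ioi_mem_nhds hs] with r hr using e r hr

theorem hasDerivAt_momentLogDeriv (hε : 0 < ε) {s : ℝ} (hs : 0 < s) :
    HasDerivAt (momentLogDeriv k ε) (-(k * (s⁻¹) ^ 2)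
      - (k + 1) * (2 * ε * (1 - ε * s ^ 2) / (1 + ε * s ^ 2) ^ 2)) s := by
  have h2 : HasDerivAt (fun r => 1 + ε * r ^ 2) (2 * ε * s) s := by
    have := (((hasDerivAt_id s).pow 2).const_mul ε).const_add 1
    refine this.congr_deriv ?_
    simp
    ring
  have h3 : HasDerivAt (fun r => 2 * ε * r) (2 * ε) s := by
    simpa using (hasDerivAt_id s).const_mul (2 * ε)
  have hne : 1 + ε * s ^ 2 ≠ 0 := by positivity
  have h4 := ((hasDerivAt_inv hs.ne').const_mul (k : ℝ)).sub
    ((h3.div h2 hne).const_mul ((k : ℝ) + 1))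
  refine h4.congr_deriv ?_
  rw [inv_pow]
  ring

theorem abs_momentLogDeriv_le (hε : 0 < ε) {s : ℝ} (hs : 0 < s) :
    |momentLogDeriv k ε s| ≤ (3 * k + 2) * s⁻¹ := by
  have h1 : 2 * ε * s / (1 + ε * s ^ 2) ≤ 2 * s⁻¹ := by
    rw [← div_eq_mul_inv, div_le_div_iff₀ (by positivity) hs]
    nlinarith
  have h2 : 0 ≤ 2 * ε * s / (1 + ε * s ^ 2) := by positivity
  have h3 : 0 < s⁻¹ := by positivity
  have hk : (0 : ℝ) ≤ k := by positivity
  unfold momentLogDeriv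
  rw [abs_le]
  constructor <;> nlinarith [mul_le_mul_of_nonneg_left h1 (by positivity : (0 : ℝ) ≤ k + 1),
    mul_nonneg (by positivity : (0 : ℝ) ≤ k + 1) h2, mul_nonneg hk h3.le]

theorem abs_deriv_momentLogDeriv_le (hε : 0 < ε) {s : ℝ} (hs : 0 < s) :
    |-(k * (s⁻¹) ^ 2) - (k + 1) * (2 * ε * (1 - ε * s ^ 2) / (1 + ε * s ^ 2) ^ 2)|
      ≤ (3 * k + 2) * (s⁻¹) ^ 2 := by
  have h1 : |2 * ε * (1 - ε * s ^ 2) / (1 + ε * s ^ 2) ^ 2| ≤ 2 * (s⁻¹) ^ 2 := by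
    have a : |1 - ε * s ^ 2| ≤ 1 + ε * s ^ 2 := by
      rw [abs_le]
      constructor <;> nlinarith [mul_nonneg hε.le (sq_nonneg s)]
    rw [abs_div, abs_mul, abs_of_pos (by positivity : 0 < 2 * ε),
      abs_of_pos (by positivity : 0 < (1 + ε * s ^ 2) ^ 2), inv_pow, ← div_eq_mul_inv,
      div_le_div_iff₀ (by positivity) (by positivity)]
    calc 2 * ε * |1 - ε * s ^ 2| * s ^ 2 ≤ 2 * ε * (1 + ε * s ^ 2) * s ^ 2 := by gcongr
      _ ≤ 2 * (1 + ε * s ^ 2) ^ 2 := by nlinarith [mul_nonneg hε.le (sq_nonneg s)]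
  have h3 : (0 : ℝ) ≤ k * (s⁻¹) ^ 2 := by positivity
  rw [← neg_add', abs_neg]
  refine (abs_add_le _ _).trans ?_
  rw [abs_of_nonneg h3, abs_mul, abs_of_pos (by positivity : (0 : ℝ) < k + 1)]
  nlinarith [mul_le_mul_of_nonneg_left h1 (by positivity : (0 : ℝ) ≤ k + 1)]

theorem abs_deriv_momentWeight_le (hε : 0 < ε) {s : ℝ} (hs : 0 < s) :
    |deriv (momentWeight k ε) s| ≤ (3 * k + 2) * momentWeight k ε s * s⁻¹ := by
  rw [(hasDerivAt_momentWeight hε hs).deriv, abs_mul, abs_of_nonneg (momentWeight_nonneg hε hs.le)]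
  nlinarith [mul_le_mul_of_nonneg_left (abs_momentLogDeriv_le (k := k) hε hs)
    (momentWeight_nonneg (k := k) hε hs.le)]

theorem abs_deriv_deriv_momentWeight_le (hε : 0 < ε) {s : ℝ} (hs : 0 < s) :
    |deriv (deriv (momentWeight k ε)) s|
      ≤ ((3 * k + 2) ^ 2 + (3 * k + 2)) * momentWeight k ε s * (s⁻¹) ^ 2 := by
  have e : deriv (momentWeight k ε) =ᶠ[𝓝 s]
      fun r => momentWeight k ε r * momentLogDeriv k ε r := by
    filter_upwards [Ioi_mem_nhds hs] with r hr using (hasDerivAt_momentWeight hε hr).deriv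
  have h0 := momentWeight_nonneg (k := k) hε hs.le
  have h1 := abs_momentLogDeriv_le (k := k) hε hs
  have h2 := abs_deriv_momentLogDeriv_le (k := k) hε hs
  have hd : deriv (fun r => momentWeight k ε r * momentLogDeriv k ε r) s = _ :=
    ((hasDerivAt_momentWeight (k := k) hε hs).mul (hasDerivAt_momentLogDeriv hε hs)).deriv
  rw [e.deriv_eq, hd, mul_assoc, ← mul_add, abs_mul, abs_of_nonneg h0]
  have h3 : |momentLogDeriv k ε s * momentLogDeriv k ε s| ≤ ((3 * k + 2) * s⁻¹) ^ 2 := by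
    rw [abs_mul, ← pow_two]
    gcongr
  have h4 := (abs_add_le _ _).trans (add_le_add h3 h2)
  calc _ ≤ _ := mul_le_mul_of_nonneg_left h4 h0
    _ = _ := by ring

end momentWeight

/-- The radial test functions for the moments are compactly supported and, up to an error that
vanishes with the cutoff, are only multiplied by a constant under the adjoint operator
`Δ - b · D` for every drift `b` of linear growth. -/
theorem exists_moment_test_bound (d k : ℕ) {K : ℝ} (hK : 0 ≤ K) : ∃ Λ ≥ (0 : ℝ), ∀ ε > 0, ∃ B ≥ 0,
    ∀ R ≥ (1 : ℝ), ∀ x : Space d,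
      |Laplacian.laplacian (fun y : Space d => momentWeight k ε (weight y) * spaceCutoff R y) x|
        + K * (1 + ‖x‖) *
          ‖∇ (fun y : Space d => momentWeight k ε (weight y) * spaceCutoff R y) x‖
      ≤ Λ * (momentWeight k ε (weight x) * spaceCutoff R x) + B / R := by
  obtain ⟨C, hC, hcut⟩ := exists_bound_deriv_cutoff
  set q : ℝ := 3 * k + 2 with hq
  have hq0 : 0 < q := by positivity
  refine ⟨4 * (q ^ 2 + q) + (2 * d + 4 * K) * q, by positivity, fun ε hε =>
    ⟨(8 * q + 4 + (2 * d + 4 * K)) * C * (1 / ε) ^ (k + 1), by positivity, fun R hR x => ?_⟩⟩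
  set h := momentWeight k ε with hh
  set s := weight x with hs
  have hs1 : 1 ≤ s := one_le_weight x
  have hs0 : 0 < s := by linarith
  have hR0 : 0 < R := by linarith
  have hc0 : ContDiff ℝ 2 (cutoff R) := contDiff_cutoff R (n := 2)
  have hm0 : ContDiff ℝ 2 h := contDiff_momentWeight hε
  have hg : ContDiff ℝ 2 fun r => h r * cutoff R r := hm0.mul hc0
  have e1 : deriv (fun r => h r * cutoff R r)
      = fun r => deriv h r * cutoff R r + h r * deriv (cutoff R) r := by
    ext r
    exact ((hm0.differentiable two_ne_zero r).hasDerivAt.mul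
      (hc0.differentiable two_ne_zero r).hasDerivAt).deriv
  have hc1 : ContDiff ℝ 1 (deriv (cutoff R)) := ((contDiff_succ_iff_deriv (n := 1)).1 hc0).2.2
  have hm1 : ContDiff ℝ 1 (deriv h) := ((contDiff_succ_iff_deriv (n := 1)).1 hm0).2.2
  have e2 : deriv (deriv fun r => h r * cutoff R r) s
      = (deriv (deriv h) s * cutoff R s + deriv h s * deriv (cutoff R) s)
        + (deriv h s * deriv (cutoff R) s + h s * deriv (deriv (cutoff R)) s) := by
    rw [e1]
    exact (((hm1.differentiable one_ne_zero s).hasDerivAt.mul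
      (hc0.differentiable two_ne_zero s).hasDerivAt).add
      ((hm0.differentiable two_ne_zero s).hasDerivAt.mul
        (hc1.differentiable one_ne_zero s).hasDerivAt)).deriv
  have hh0 : 0 ≤ h s := momentWeight_nonneg hε hs0.le
  have hη0 := cutoff_nonneg R s
  have hi1 : s⁻¹ ≤ 1 := inv_le_one_of_one_le₀ hs1
  have hi0 : 0 < s⁻¹ := by positivity
  have b1 : |deriv h s| ≤ q * h s * s⁻¹ := abs_deriv_momentWeight_le hε hs0
  have b2 : |deriv (deriv h) s| ≤ (q ^ 2 + q) * h s * (s⁻¹) ^ 2 :=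
    abs_deriv_deriv_momentWeight_le hε hs0
  obtain ⟨c1, c2⟩ := hcut R hR s
  have bB : s * h s ≤ (1 / ε) ^ (k + 1) := mul_momentWeight_le hε hs1
  set B := (1 / ε) ^ (k + 1) with hB
  have hhs : h s ≤ s * h s := le_mul_of_one_le_left hh0 hs1
  have hCR : 0 ≤ C / R := by positivity
  have g1 : s * |deriv (fun r => h r * cutoff R r) s| ≤ q * (h s * cutoff R s) + B * (C / R) := by
    rw [e1]
    calc s * |deriv h s * cutoff R s + h s * deriv (cutoff R) s|
        ≤ s * (|deriv h s| * cutoff R s + h s * |deriv (cutoff R) s|) := by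
          gcongr
          refine (abs_add_le _ _).trans (le_of_eq ?_)
          rw [abs_mul, abs_mul, abs_of_nonneg hη0, abs_of_nonneg hh0]
      _ ≤ s * (q * h s * s⁻¹ * cutoff R s + h s * (C / R)) := by gcongr
      _ = q * (h s * cutoff R s) + s * h s * (C / R) := by field_simp
      _ ≤ _ := by gcongr
  have g2 : s * |deriv (deriv fun r => h r * cutoff R r) s|
      ≤ (q ^ 2 + q) * (h s * cutoff R s) + (2 * q + 1) * (B * (C / R)) := by
    rw [e2]
    calc _ ≤ s * ((|deriv (deriv h) s| * cutoff R s + |deriv h s| * |deriv (cutoff R) s|)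
          + (|deriv h s| * |deriv (cutoff R) s| + h s * |deriv (deriv (cutoff R)) s|)) := by
          gcongr
          refine (abs_add_le _ _).trans (add_le_add ?_ ?_)
          · refine (abs_add_le _ _).trans (le_of_eq ?_)
            rw [abs_mul, abs_mul, abs_of_nonneg hη0]
          · refine (abs_add_le _ _).trans (le_of_eq ?_)
            rw [abs_mul, abs_mul, abs_of_nonneg hh0]
      _ ≤ s * (((q ^ 2 + q) * h s * (s⁻¹) ^ 2 * cutoff R s + q * h s * s⁻¹ * (C / R))
          + (q * h s * s⁻¹ * (C / R) + h s * (C / R))) := by gcongr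
      _ = (q ^ 2 + q) * (h s * cutoff R s) * s⁻¹ + (2 * q) * (h s * (C / R))
          + s * h s * (C / R) := by field_simp; ring
      _ ≤ (q ^ 2 + q) * (h s * cutoff R s) * 1 + (2 * q) * (s * h s * (C / R))
          + s * h s * (C / R) := by gcongr
      _ = (q ^ 2 + q) * (h s * cutoff R s) + (2 * q + 1) * (s * h s * (C / R)) := by ring
      _ ≤ _ := by gcongr
  have hx2 : ‖x‖ ^ 2 ≤ s := by rw [hs, weight]; linarith
  have hx3 : (1 + ‖x‖) * ‖x‖ ≤ 2 * s := by
    rw [hs, weight]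
    nlinarith [sq_nonneg (‖x‖ - 1)]
  have eφ : (fun y : Space d => h (weight y) * spaceCutoff R y)
      = fun y => (fun r => h r * cutoff R r) (weight y) := rfl
  rw [eφ, laplacian_radial hg, gradient_radial (hg.differentiable two_ne_zero _), norm_smul,
    Real.norm_eq_abs, abs_mul, abs_two, ← hs]
  change _ ≤ _ * (h s * cutoff R s) + _
  set D1 := |deriv (fun r => h r * cutoff R r) s|
  have hD1 : 0 ≤ D1 := abs_nonneg _
  have hD1s : D1 ≤ s * D1 := le_mul_of_one_le_left hD1 hs1
  calc _ ≤ (4 * ‖x‖ ^ 2 * |deriv (deriv fun r => h r * cutoff R r) s| + 2 * d * D1)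
        + K * (1 + ‖x‖) * (2 * D1 * ‖x‖) := by
        gcongr
        refine (abs_add_le _ _).trans (le_of_eq ?_)
        rw [abs_mul, abs_mul (2 * (d : ℝ)), abs_of_nonneg (by positivity : (0 : ℝ) ≤ 4 * ‖x‖ ^ 2),
          abs_of_nonneg (by positivity : (0 : ℝ) ≤ 2 * d)]
    _ = 4 * ‖x‖ ^ 2 * |deriv (deriv fun r => h r * cutoff R r) s| + 2 * d * D1
        + 2 * K * ((1 + ‖x‖) * ‖x‖) * D1 := by ring
    _ ≤ 4 * s * |deriv (deriv fun r => h r * cutoff R r) s| + 2 * d * (s * D1)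
        + 2 * K * (2 * s) * D1 := by gcongr
    _ = 4 * (s * |deriv (deriv fun r => h r * cutoff R r) s|)
        + (2 * d + 4 * K) * (s * D1) := by ring
    _ ≤ 4 * ((q ^ 2 + q) * (h s * cutoff R s) + (2 * q + 1) * (B * (C / R)))
        + (2 * d + 4 * K) * (q * (h s * cutoff R s) + B * (C / R)) := by gcongr
    _ = _ := by ring

/-- Fatou's lemma for non-negative integrable functions that converge pointwise. -/
theorem integrable_and_integral_le_of_tendsto {X : Type*} [MeasurableSpace X] {μ : Measure X}
    {f : ℕ → X → ℝ} {F : X → ℝ} {c : ℕ → ℝ} {a : ℝ} (hint : ∀ n, Integrable (f n) μ)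
    (hnn : ∀ n x, 0 ≤ f n x) (hlim : ∀ x, Tendsto (fun n => f n x) atTop (𝓝 (F x)))
    (hle : ∀ n, ∫ x, f n x ∂μ ≤ c n) (hc : Tendsto c atTop (𝓝 a)) :
    Integrable F μ ∧ ∫ x, F x ∂μ ≤ a := by
  have hF0 (x : X) : 0 ≤ F x := ge_of_tendsto' (hlim x) fun n => hnn n x
  have ha : 0 ≤ a := ge_of_tendsto' hc fun n => (integral_nonneg (hnn n)).trans (hle n)
  have hmeas : AEStronglyMeasurable F μ :=
    aestronglyMeasurable_of_tendsto_ae atTop (fun n => (hint n).1) (ae_of_all _ hlim)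
  have key : ∫⁻ x, ENNReal.ofReal (F x) ∂μ ≤ ENNReal.ofReal a := by
    have e (x : X) : ENNReal.ofReal (F x) = liminf (fun n => ENNReal.ofReal (f n x)) atTop :=
      ((ENNReal.continuous_ofReal.tendsto _).comp (hlim x)).liminf_eq.symm
    simp_rw [e]
    refine (lintegral_liminf_le' fun n => (hint n).1.aemeasurable.ennreal_ofReal).trans ?_
    rw [← ((ENNReal.continuous_ofReal.tendsto _).comp hc).liminf_eq]
    refine liminf_le_liminf (Eventually.of_forall fun n => ?_)
    rw [← ofReal_integral_eq_lintegral_ofReal (hint n) (ae_of_all _ (hnn n))]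
    exact ENNReal.ofReal_le_ofReal (hle n)
  have hi : Integrable F μ := by
    refine ⟨hmeas, ?_⟩
    rw [hasFiniteIntegral_iff_ofReal (ae_of_all _ hF0)]
    exact key.trans_lt ENNReal.ofReal_lt_top
  refine ⟨hi, ?_⟩
  rw [← ofReal_integral_eq_lintegral_ofReal hi (ae_of_all _ hF0)] at key
  exact (ENNReal.ofReal_le_ofReal_iff ha).1 key

theorem contDiff_weight_mul_cutoff {k : ℕ} {ε : ℝ} (hε : 0 < ε) (R : ℝ) :
    ContDiff ℝ 2 fun y : Space d => momentWeight k ε (weight y) * spaceCutoff R y :=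
  ((contDiff_momentWeight hε).comp contDiff_weight).mul (contDiff_spaceCutoff R (n := 2))

/-- Gronwall's argument for one test function: if `φ` satisfies the inequality for the adjoint
operator up to an error `b`, then `∫ m φ` grows at most exponentially, up to a multiple of `b`. -/
theorem IsFluxSolution.integral_mul_le {T K : ℝ} {m₀ : Space d → ℝ}
    {m : Space d → ℝ → ℝ} {F : ℝ → Space d → Space d} (h : IsFluxSolution T K m₀ m F)
    {φ : Space d → ℝ} (hφ : ContDiff ℝ 2 φ) (hc : HasCompactSupport φ)
    (hnn : ∀ x, 0 ≤ φ x) {Λ b A : ℝ} (hΛ : 0 ≤ Λ) (hb : 0 ≤ b)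
    (hle : ∀ x, |Laplacian.laplacian φ x| + K * (1 + ‖x‖) * ‖∇ φ x‖ ≤ Λ * φ x + b)
    (hA : ∀ t ∈ Icc 0 T, Integrable (fun x => m x t) ∧ ∫ x, m x t ≤ A) {t : ℝ}
    (ht : t ∈ Icc 0 T) :
    ∫ x, m x t * φ x ≤ Real.exp (Λ * T) * ((∫ x, m₀ x * φ x) + T * (A * b)) := by
  have hT : 0 ≤ T := ht.1.trans ht.2
  have hsub : Icc 0 t ⊆ Icc 0 T := Icc_subset_Icc_right ht.2
  have hA0 : 0 ≤ A := (integral_nonneg fun x => h.nonneg x t ht).trans (hA t ht).2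
  set f : Space d → ℝ → ℝ := fun x s => Real.exp (-Λ * s) * (m x s * φ x) with hf
  set f' : Space d → ℝ → ℝ := fun x s =>
    Real.exp (-Λ * s) * (φ x * derivWithin (m x) (Icc 0 T) s - Λ * (m x s * φ x)) with hf'
  have hd (x : Space d) (s : ℝ) (hs : s ∈ Icc 0 t) :
      HasDerivWithinAt (f x) (f' x s) (Icc 0 t) s := by
    have h1 := (h.regular.hasDerivWithinAt x (hsub hs)).mono hsub
    have h2 : HasDerivAt (fun s => Real.exp (-Λ * s)) (Real.exp (-Λ * s) * -Λ) s := by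
      simpa using ((hasDerivAt_id s).const_mul (-Λ)).exp
    refine (h2.hasDerivWithinAt.mul (h1.mul_const (φ x))).congr_deriv ?_
    simp only [hf']
    ring
  have hcont : ContinuousOn (fun z : Space d × ℝ => f' z.1 z.2) (univ ×ˢ Icc 0 t) := by
    have h1 := h.regular.continuous
    have h2 := h.regular.continuous_time
    have h3 : Continuous φ := hφ.continuous
    have : ContinuousOn (fun z : Space d × ℝ => f' z.1 z.2) (univ ×ˢ Icc 0 T) := by
      simp only [hf']
      fun_prop
    exact this.mono (prod_mono le_rfl hsub)
  have hsupp (x : Space d) (hx : x ∉ tsupport φ) (s : ℝ) : f' x s = 0 := by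
    simp [hf', image_eq_zero_of_notMem_tsupport hx]
  have hFTC := integral_sub_eq_integral_deriv ht.1 hc hd hcont hsupp
  have hmul (s : ℝ) (hs : s ∈ Icc 0 T) : Integrable fun x => m x s * φ x :=
    ((continuous_slice h.regular.continuous hs).mul hφ.continuous).integrable_of_hasCompactSupport
      hc.mul_left
  have hslice (s : ℝ) (hs : s ∈ Icc 0 t) : ∫ x, f' x s ≤ A * b := by
    have hs' := hsub hs
    have hms := h.regular.contDiff_space s hs'
    have mc := continuous_slice h.regular.continuous hs'
    have c1 : Continuous fun x => derivWithin (m x) (Icc 0 T) s :=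
      continuous_slice h.regular.continuous_time hs'
    have i1 : Integrable fun x => φ x * derivWithin (m x) (Icc 0 T) s :=
      (hφ.continuous.mul c1).integrable_of_hasCompactSupport hc.mul_right
    have i2 : Integrable fun x => m x s * Laplacian.laplacian φ x :=
      (mc.mul (continuous_laplacian hφ)).integrable_of_hasCompactSupport
        (hasCompactSupport_laplacian hc).mul_left
    have i3 : Integrable fun x => fderiv ℝ φ x (F s x) :=
      integrable_fderiv_apply (hφ.of_le one_le_two) hc (h.contDiff_flux s hs').continuous
    have i23 : Integrable fun x => m x s * Laplacian.laplacian φ x - fderiv ℝ φ x (F s x) :=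
      i2.sub i3
    have e : ∫ x, f' x s = Real.exp (-Λ * s) *
        ∫ x, (m x s * Laplacian.laplacian φ x - fderiv ℝ φ x (F s x) - Λ * (m x s * φ x)) := by
      simp only [hf']
      rw [integral_const_mul, integral_sub i1 ((hmul s hs').const_mul Λ),
        integral_sub i23 ((hmul s hs').const_mul Λ), integral_sub i2 i3,
        h.integral_mul_deriv (hφ.of_le one_le_two) hc hs',
        integral_fderiv_gradient hφ (hms.of_le one_le_two) hc, neg_neg]
    have l : ∫ x, (m x s * Laplacian.laplacian φ x - fderiv ℝ φ x (F s x) - Λ * (m x s * φ x))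
        ≤ A * b := by
      calc _ ≤ ∫ x, m x s * b := by
            refine integral_mono (i23.sub ((hmul s hs').const_mul Λ))
              ((hA s hs').1.mul_const b) fun x => ?_
            have m0 := h.nonneg x s hs'
            have a1 : m x s * Laplacian.laplacian φ x ≤ m x s * |Laplacian.laplacian φ x| := by
              gcongr
              exact le_abs_self _
            have a2 : -fderiv ℝ φ x (F s x) ≤ ‖∇ φ x‖ * (K * (1 + ‖x‖) * m x s) := by
              rw [← inner_gradient_left]
              refine (neg_le_abs _).trans ((abs_real_inner_le_norm _ _).trans ?_)
              gcongr
              exact h.norm_flux_le x s hs'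
            have a3 := mul_le_mul_of_nonneg_left (hle x) m0
            nlinarith
        _ = (∫ x, m x s) * b := integral_mul_const _ _
        _ ≤ A * b := by gcongr; exact (hA s hs').2
    rw [e]
    have h1 : Real.exp (-Λ * s) ≤ 1 := Real.exp_le_one_iff.2 (by nlinarith [hs.1])
    calc _ ≤ Real.exp (-Λ * s) * (A * b) := by gcongr
      _ ≤ 1 * (A * b) := by gcongr
      _ = _ := one_mul _
  have hI : ∫ s in 0..t, ∫ x, f' x s ≤ T * (A * b) := by
    calc _ ≤ ∫ s in 0..t, A * b := by
          refine intervalIntegral.integral_mono_on ht.1 ?_ intervalIntegrable_const hslice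
          exact (continuousOn_integral_strip hc hcont
            fun x hx s _ => hsupp x hx s).intervalIntegrable_of_Icc ht.1
      _ = t * (A * b) := by simp [mul_left_comm]
      _ ≤ _ := by gcongr; exact ht.2
  have h0 : (0 : ℝ) ∈ Icc 0 T := ⟨le_rfl, hT⟩
  have hl : ∫ x, (f x t - f x 0)
      = Real.exp (-Λ * t) * (∫ x, m x t * φ x) - ∫ x, m₀ x * φ x := by
    simp only [hf, mul_zero, Real.exp_zero, one_mul]
    rw [integral_sub ((hmul t ht).const_mul _) (hmul 0 h0), integral_const_mul]
    simp_rw [h.initial]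
  rw [hl] at hFTC
  have hfin : Real.exp (-Λ * t) * (∫ x, m x t * φ x) ≤ (∫ x, m₀ x * φ x) + T * (A * b) := by
    linarith
  have e1 : ∫ x, m x t * φ x
      = Real.exp (Λ * t) * (Real.exp (-Λ * t) * ∫ x, m x t * φ x) := by
    rw [← mul_assoc, ← Real.exp_add]
    simp
  have hφ0 : 0 ≤ Real.exp (-Λ * t) * ∫ x, m x t * φ x := by
    refine mul_nonneg (Real.exp_nonneg _) (integral_nonneg fun x => mul_nonneg (h.nonneg x t ht) ?_)
    exact hnn x
  rw [e1]
  calc _ ≤ Real.exp (Λ * T) * (Real.exp (-Λ * t) * ∫ x, m x t * φ x) := by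
        gcongr
        exact ht.2
    _ ≤ _ := by gcongr

/-- All moments of a density are bounded in terms of the growth constant of its flux and of its
initial value. The total mass, whose bound may depend on the solution, enters only through the
error terms and disappears in the limit. -/
theorem exists_moment_bound {T K : ℝ} (hK : 0 ≤ K) {m₀ : Space d → ℝ} (hm₀ : Continuous m₀)
    (hc₀ : HasCompactSupport m₀) (k : ℕ) : ∃ C > (0 : ℝ), ∀ (m : Space d → ℝ → ℝ)
      (F : ℝ → Space d → Space d), IsFluxSolution T K m₀ m F → ∀ t ∈ Icc 0 T,
      Integrable (fun x => m x t * weight x ^ k) ∧ ∫ x, m x t * weight x ^ k ≤ C := by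
  obtain ⟨Λ, hΛ, htest⟩ := exists_moment_test_bound d k hK
  set M := ∫ x, |m₀ x| * weight x ^ k with hM
  have hM0 : 0 ≤ M := integral_nonneg fun x => mul_nonneg (abs_nonneg _)
    (pow_nonneg (weight_pos x).le _)
  refine ⟨Real.exp (Λ * T) * (M + 1), by positivity, fun m F h t ht => ?_⟩
  have hT : 0 ≤ T := ht.1.trans ht.2
  obtain ⟨A, hA⟩ := h.mass
  have hε (n : ℕ) : (0 : ℝ) < 1 / ((n : ℝ) + 1) := by positivity
  choose B hB0 hB using fun n : ℕ => htest (1 / ((n : ℝ) + 1)) (hε n)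
  -- the radius beats the constant that degenerates with `ε`
  set R : ℕ → ℝ := fun n => (n + 1) * (1 + B n) with hR
  have hR1 (n : ℕ) : (n : ℝ) + 1 ≤ R n :=
    le_mul_of_one_le_right (by positivity) (by linarith [hB0 n])
  have hR1' (n : ℕ) : 1 ≤ R n := by linarith [hR1 n, Nat.cast_nonneg (α := ℝ) n]
  have hR0 (n : ℕ) : 0 < R n := zero_lt_one.trans_le (hR1' n)
  have hBR (n : ℕ) : B n / R n ≤ 1 / ((n : ℝ) + 1) := by
    rw [div_le_div_iff₀ (hR0 n) (by positivity)]
    simp only [hR]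
    have : (0 : ℝ) < n + 1 := by positivity
    nlinarith [hB0 n]
  set φ : ℕ → Space d → ℝ := fun n y =>
    momentWeight k (1 / ((n : ℝ) + 1)) (weight y) * spaceCutoff (R n) y with hφ
  have hφc (n : ℕ) : HasCompactSupport (φ n) := (hasCompactSupport_spaceCutoff (hR0 n)).mul_left
  have hφ2 (n : ℕ) : ContDiff ℝ 2 (φ n) := contDiff_weight_mul_cutoff (hε n) (R n)
  have hφ0 (n : ℕ) (x : Space d) : 0 ≤ φ n x :=
    mul_nonneg (momentWeight_nonneg (hε n) (weight_pos x).le) (spaceCutoff_nonneg _ _)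
  have hφle (n : ℕ) (x : Space d) : φ n x ≤ weight x ^ k :=
    (mul_le_of_le_one_right (momentWeight_nonneg (hε n) (weight_pos x).le)
      (spaceCutoff_le_one _ _)).trans (momentWeight_le (hε n) (weight_pos x).le)
  have hint0 : Integrable fun x => |m₀ x| * weight x ^ k :=
    (hm₀.abs.mul ((contDiff_weight (n := 0)).continuous.pow k)).integrable_of_hasCompactSupport
      (hc₀.comp_left (g := fun r : ℝ => |r|) abs_zero).mul_right
  have hlim (x : Space d) : Tendsto (fun n => m x t * φ n x) atTop (𝓝 (m x t * weight x ^ k)) := by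
    refine Tendsto.const_mul _ ?_
    have l1 : Tendsto (fun n : ℕ => momentWeight k (1 / ((n : ℝ) + 1)) (weight x)) atTop
        (𝓝 (weight x ^ k)) := by
      have : Tendsto (fun ε : ℝ => momentWeight k ε (weight x)) (𝓝 0)
          (𝓝 (momentWeight k 0 (weight x))) := by
        refine ContinuousAt.tendsto ?_
        unfold momentWeight
        exact ContinuousAt.div (by fun_prop) (by fun_prop) (by simp)
      have := this.comp tendsto_one_div_add_atTop_nhds_zero_nat
      simpa [momentWeight, Function.comp_def] using this
    refine l1.congr' ?_
    filter_upwards [eventually_ge_atTop ⌈weight x⌉₊] with n hn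
    have : weight x ≤ R n :=
      (Nat.ceil_le.1 hn).trans ((by linarith : (n : ℝ) ≤ n + 1).trans (hR1 n))
    simp [hφ, spaceCutoff_eq_one (hR0 n) this]
  have hc : Tendsto (fun n : ℕ => Real.exp (Λ * T) * (M + T * (A * (1 / ((n : ℝ) + 1))))) atTop
      (𝓝 (Real.exp (Λ * T) * M)) := by
    have := ((tendsto_one_div_add_atTop_nhds_zero_nat (𝕜 := ℝ)).const_mul A).const_mul T
    simpa using (this.const_add M).const_mul (Real.exp (Λ * T))
  have hA0 : 0 ≤ A := (integral_nonneg fun x => h.nonneg x t ht).trans (hA t ht).2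
  have := integrable_and_integral_le_of_tendsto
    (f := fun n x => m x t * φ n x) (μ := volume) (fun n =>
      ((continuous_slice h.regular.continuous ht).mul
        (hφ2 n).continuous).integrable_of_hasCompactSupport (hφc n).mul_left)
    (fun n x => mul_nonneg (h.nonneg x t ht) (hφ0 n x)) hlim (fun n => ?_) hc
  · refine ⟨this.1, this.2.trans ?_⟩
    gcongr
    linarith
  · refine (h.integral_mul_le (hφ2 n) (hφc n) (hφ0 n) hΛ (div_nonneg (hB0 n) (hR0 n).le)
      (hB n (R n) (hR1' n)) hA ht).trans ?_
    refine mul_le_mul_of_nonneg_left (add_le_add ?_ (mul_le_mul_of_nonneg_left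
      (mul_le_mul_of_nonneg_left (hBR n) hA0) hT)) (Real.exp_nonneg _)
    · refine integral_mono ((hm₀.mul (hφ2 n).continuous).integrable_of_hasCompactSupport
        hc₀.mul_right) hint0 fun x => ?_
      exact mul_le_mul (le_abs_self _) (hφle n x) (hφ0 n x) (abs_nonneg _)

/-! ### Monotonicity: all solutions share the drift of a given one -/

theorem laplacian_mul {f g : Space d → ℝ} (hf : ContDiff ℝ 2 f) (hg : ContDiff ℝ 2 g)
    (x : Space d) : Laplacian.laplacian (fun y => f y * g y) x
      = f x * Laplacian.laplacian g x + 2 * inner ℝ (∇ f x) (∇ g x)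
        + g x * Laplacian.laplacian f x := by
  have hf1 : ContDiff ℝ 1 (∇ f) := contDiff_gradient (by simpa [one_add_one_eq_two] using hf)
  have hg1 : ContDiff ℝ 1 (∇ g) := contDiff_gradient (by simpa [one_add_one_eq_two] using hg)
  have e : ∇ (fun y => f y * g y) = fun y => f y • ∇ g y + g y • ∇ f y := by
    ext1 y
    refine HasGradientAt.gradient (hasGradientAt_iff_hasFDerivAt.2 ?_)
    refine ((hf.differentiable two_ne_zero y).hasFDerivAt.mul
      (hg.differentiable two_ne_zero y).hasFDerivAt).congr_fderiv ?_
    ext v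
    simp
  have hd : HasFDerivAt (fun y => f y • ∇ g y + g y • ∇ f y) _ x :=
    ((hf.differentiable two_ne_zero x).hasFDerivAt.smul
      (hg1.differentiable one_ne_zero x).hasFDerivAt).add
    ((hg.differentiable two_ne_zero x).hasFDerivAt.smul
      (hf1.differentiable one_ne_zero x).hasFDerivAt)
  rw [laplacian_eq_divergence_gradient (hf.mul hg), e, laplacian_eq_divergence_gradient hf,
    laplacian_eq_divergence_gradient hg]
  have e1 (a b : Space d → ℝ) : ∑ i, fderiv ℝ a x (basisVec i) * (∇ b x) i
      = inner ℝ (∇ a x) (∇ b x) := by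
    rw [PiLp.inner_apply]
    refine Finset.sum_congr rfl fun i _ => ?_
    rw [gradient_apply a, gradient_apply b]
    simp [mul_comm]
  unfold divergence
  rw [hd.fderiv]
  simp only [add_apply, ContinuousLinearMap.smulRight_apply, PiLp.add_apply, PiLp.smul_apply,
    smul_eq_mul, smul_apply, Finset.sum_add_distrib, ← Finset.mul_sum, e1]
  rw [real_inner_comm (∇ f x) (∇ g x)]
  ring

/-- Linear growth of `Du` gives quadratic growth of `u`. -/
theorem IsSolution.exists_abs_u_le {T : ℝ} (hT : 0 ≤ T) {H : Space d → Space d → ℝ} {g : ℝ → ℝ}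
    {uT m₀ : Space d → ℝ} {u m : Space d → ℝ → ℝ} (h : IsSolution T H g uT m₀ u m) :
    ∃ C ≥ (0 : ℝ), ∀ x, ∀ t ∈ Icc 0 T, |u x t| ≤ C * weight x ∧
      ‖∇ (fun y => u y t) x‖ ≤ C * (1 + ‖x‖) := by
  obtain ⟨K, hK⟩ := h.growth_u
  have hK0 : 0 ≤ K := by
    have := (norm_nonneg _).trans (hK 0 0 ⟨le_rfl, hT⟩)
    simpa using this
  have hc : ContinuousOn (u 0) (Icc 0 T) := fun t ht =>
    (h.regular_u.differentiable_time 0 t ht).continuousWithinAt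
  obtain ⟨U, hU⟩ := isCompact_Icc.exists_bound_of_continuousOn hc
  have hU0 : 0 ≤ U := (norm_nonneg _).trans (hU 0 ⟨le_rfl, hT⟩)
  refine ⟨2 * K + U, by positivity, fun x t ht => ⟨?_, ?_⟩⟩
  · have h1 : ‖u x t - u 0 t‖ ≤ K * (1 + ‖x‖) * ‖x - 0‖ := by
      refine Convex.norm_image_sub_le_of_norm_fderiv_le (𝕜 := ℝ) (f := fun y => u y t)
        (s := Metric.closedBall 0 ‖x‖)
        (fun y _ => (h.regular_u.contDiff_space t ht).differentiable two_ne_zero y)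
        (fun y hy => ?_) (convex_closedBall _ _) (by simp) (by simp)
      rw [← norm_gradient]
      refine (hK y t ht).trans ?_
      gcongr
      simpa using hy
    rw [sub_zero, Real.norm_eq_abs] at h1
    have h2 := hU t ht
    rw [Real.norm_eq_abs] at h2
    have h3 : |u x t| ≤ |u x t - u 0 t| + |u 0 t| := by
      simpa using abs_add_le (u x t - u 0 t) (u 0 t)
    have h4 : (1 + ‖x‖) * ‖x‖ ≤ 2 * weight x := by
      rw [weight]
      nlinarith [sq_nonneg (‖x‖ - 1)]
    have h5 := mul_le_mul_of_nonneg_left h4 hK0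
    have h6 := mul_le_mul_of_nonneg_left (one_le_weight x) hU0
    nlinarith
  · refine (hK x t ht).trans ?_
    gcongr
    linarith

/-- The gap in the tangent plane inequality for `H x` between the momenta `p` and `q`. -/
def tangentGap (H : Space d → Space d → ℝ) (x p q : Space d) : ℝ :=
  H x q - H x p - inner ℝ (gradP H x p) (q - p)

theorem HamiltonianAssumption.continuous_tangentGap {H : Space d → Space d → ℝ}
    (hH : HamiltonianAssumption H) :
    Continuous fun z : Space d × Space d × Space d => tangentGap H z.1 z.2.1 z.2.2 := by
  have h1 : Continuous fun z : Space d × Space d => H z.1 z.2 := hH.smooth.continuous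
  have h2 : Continuous fun z : Space d × Space d => gradP H z.1 z.2 :=
    hH.contDiff_gradP.continuous
  have h3 : Continuous fun z : Space d × Space d × Space d => H z.1 z.2.2 :=
    h1.comp (by fun_prop : Continuous fun z : Space d × Space d × Space d => (z.1, z.2.2))
  have h4 : Continuous fun z : Space d × Space d × Space d => H z.1 z.2.1 :=
    h1.comp (by fun_prop : Continuous fun z : Space d × Space d × Space d => (z.1, z.2.1))
  have h5 : Continuous fun z : Space d × Space d × Space d => gradP H z.1 z.2.1 :=
    h2.comp (by fun_prop : Continuous fun z : Space d × Space d × Space d => (z.1, z.2.1))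
  exact (h3.sub h4).sub (h5.inner (by fun_prop))

/-- The sum of the two tangent plane gaps between the momenta of two solutions, each weighted by the
density of the solution at whose momentum the tangent is taken. -/
def monotonicityGap (H : Space d → Space d → ℝ) (u₁ m₁ u₂ m₂ : Space d → ℝ → ℝ) (x : Space d)
    (t : ℝ) : ℝ :=
  m₁ x t * tangentGap H x (∇ (fun y => u₁ y t) x) (∇ (fun y => u₂ y t) x)
    + m₂ x t * tangentGap H x (∇ (fun y => u₂ y t) x) (∇ (fun y => u₁ y t) x)

section monotonicity

variable {T : ℝ} {H : Space d → Space d → ℝ} {g : ℝ → ℝ} {uT m₀ : Space d → ℝ}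
  {u₁ m₁ u₂ m₂ : Space d → ℝ → ℝ}

theorem monotonicityGap_nonneg (hH : HamiltonianAssumption H)
    (h₁ : IsSolution T H g uT m₀ u₁ m₁) (h₂ : IsSolution T H g uT m₀ u₂ m₂) (x : Space d) {t : ℝ}
    (ht : t ∈ Icc 0 T) : 0 ≤ monotonicityGap H u₁ m₁ u₂ m₂ x t :=
  add_nonneg (mul_nonneg (h₁.nonneg_m x t ht) (hH.tangent x _ _))
    (mul_nonneg (h₂.nonneg_m x t ht) (hH.tangent x _ _))

theorem continuousOn_monotonicityGap (hH : HamiltonianAssumption H)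
    (h₁ : IsSolution T H g uT m₀ u₁ m₁) (h₂ : IsSolution T H g uT m₀ u₂ m₂) :
    ContinuousOn (fun z : Space d × ℝ => monotonicityGap H u₁ m₁ u₂ m₂ z.1 z.2)
      (univ ×ˢ Icc 0 T) := by
  have g1 := h₁.regular_u.continuous_gradient
  have g2 := h₂.regular_u.continuous_gradient
  exact (h₁.regular_m.continuous.mul (hH.continuous_tangentGap.comp_continuousOn
    (continuousOn_fst.prodMk (g1.prodMk g2)))).add
    (h₂.regular_m.continuous.mul (hH.continuous_tangentGap.comp_continuousOn
    (continuousOn_fst.prodMk (g2.prodMk g1))))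

/-- Pointwise form of the Lasry-Lions computation. The test function is the difference of the
value functions times a cutoff, and every term in which the cutoff is differentiated is of order
`1 / R` times the integrand of a fourth moment. -/
theorem monotonicity_integrand_le (hg : MonotoneOn g (Ici 0))
    (h₁ : IsSolution T H g uT m₀ u₁ m₁) (h₂ : IsSolution T H g uT m₀ u₂ m₂) {K V C R : ℝ}
    (hK0 : 0 ≤ K) (hV0 : 0 ≤ V) (hR : 1 ≤ R) {t : ℝ} (ht : t ∈ Icc 0 T)
    (hF₁ : ∀ x, ‖hamiltonianFlux H u₁ m₁ t x‖ ≤ K * (1 + ‖x‖) * m₁ x t)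
    (hF₂ : ∀ x, ‖hamiltonianFlux H u₂ m₂ t x‖ ≤ K * (1 + ‖x‖) * m₂ x t)
    (hv : ∀ x, |u₁ x t - u₂ x t| ≤ V * weight x)
    (hdv : ∀ x, ‖∇ (fun y => u₁ y t - u₂ y t) x‖ ≤ V * (1 + ‖x‖))
    (hcut : ∀ s, |deriv (cutoff R) s| ≤ C / R ∧ |deriv (deriv (cutoff R)) s| ≤ C / R)
    (x : Space d) :
    spaceCutoff R x * ((derivWithin (u₁ x) (Icc 0 T) t - derivWithin (u₂ x) (Icc 0 T) t)
        * (m₁ x t - m₂ x t))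
      + (m₁ x t - m₂ x t) *
        Laplacian.laplacian (fun y => spaceCutoff R y * (u₁ y t - u₂ y t)) x
      - fderiv ℝ (fun y => spaceCutoff R y * (u₁ y t - u₂ y t)) x
        (hamiltonianFlux H u₁ m₁ t x - hamiltonianFlux H u₂ m₂ t x)
    ≤ -(spaceCutoff R x * monotonicityGap H u₁ m₁ u₂ m₂ x t)
      + (8 + (4 + 2 * d) + 4 * K) * V * C / R * ((m₁ x t + m₂ x t) * weight x ^ 2) := by
  have hu₁ := h₁.regular_u.contDiff_space t ht
  have hu₂ := h₂.regular_u.contDiff_space t ht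
  have hvC : ContDiff ℝ 2 fun y => u₁ y t - u₂ y t := hu₁.sub hu₂
  have hχ : ContDiff ℝ 2 (spaceCutoff (d := d) R) := contDiff_spaceCutoff R (n := 2)
  have hR0 : 0 < R := by linarith
  have a1 := h₁.nonneg_m x t ht
  have a2 := h₂.nonneg_m x t ht
  set χ := spaceCutoff R x with hχx
  have hχ0 : 0 ≤ χ := spaceCutoff_nonneg R x
  have n1 : ‖∇ (spaceCutoff (d := d) R) x‖ ≤ 2 * (C / R) * ‖x‖ :=
    norm_gradient_radial_le (contDiff_cutoff R (n := 2)) (fun s => (hcut s).1) x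
  have n2 : |Laplacian.laplacian (spaceCutoff (d := d) R) x| ≤ (4 + 2 * d) * (C / R) * weight x :=
    abs_laplacian_radial_le (contDiff_cutoff R (n := 2)) (fun s => (hcut s).1)
      (fun s => (hcut s).2) x
  have hCR : 0 ≤ C / R := (abs_nonneg _).trans (hcut 0).1
  have eg : ∇ (fun y => u₁ y t - u₂ y t) x = ∇ (fun y => u₁ y t) x - ∇ (fun y => u₂ y t) x := by
    simp only [gradient, ← map_sub]
    congr 1
    exact fderiv_sub (hu₁.differentiable two_ne_zero x) (hu₂.differentiable two_ne_zero x)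
  have eL : Laplacian.laplacian (fun y => u₁ y t - u₂ y t) x
      = Laplacian.laplacian (fun y => u₁ y t) x - Laplacian.laplacian (fun y => u₂ y t) x :=
    hu₁.contDiffAt.laplacian_sub hu₂.contDiffAt
  have ef (w : Space d) : fderiv ℝ (fun y => spaceCutoff R y * (u₁ y t - u₂ y t)) x w
      = χ * inner ℝ (∇ (fun y => u₁ y t - u₂ y t) x) w
        + (u₁ x t - u₂ x t) * inner ℝ (∇ (spaceCutoff (d := d) R) x) w := by
    have : fderiv ℝ (fun y => spaceCutoff R y * (u₁ y t - u₂ y t)) x = _ :=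
      ((hχ.differentiable two_ne_zero x).hasFDerivAt.mul
        (hvC.differentiable two_ne_zero x).hasFDerivAt).fderiv
    rw [this]
    simp [inner_gradient_left, hχx]
  rw [laplacian_mul hχ hvC, ef]
  -- the coupling terms have the favourable sign
  have hgm : 0 ≤ (g (m₁ x t) - g (m₂ x t)) * (m₁ x t - m₂ x t) := by
    rcases le_total (m₁ x t) (m₂ x t) with hle | hle
    · exact mul_nonneg_of_nonpos_of_nonpos (sub_nonpos.2 (hg a1 a2 hle)) (sub_nonpos.2 hle)
    · exact mul_nonneg (sub_nonneg.2 (hg a2 a1 hle)) (sub_nonneg.2 hle)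
  have q1 := h₁.hamiltonJacobi x t ht
  have q2 := h₂.hamiltonJacobi x t ht
  have hx3 : (1 + ‖x‖) * ‖x‖ ≤ 2 * weight x := by
    rw [weight]
    nlinarith [sq_nonneg (‖x‖ - 1)]
  have hw1 := one_le_weight x
  have hw2 : weight x ≤ weight x ^ 2 := by nlinarith
  have hμ : |m₁ x t - m₂ x t| ≤ m₁ x t + m₂ x t := by
    rw [abs_le]
    constructor <;> linarith
  have hFF : ‖hamiltonianFlux H u₁ m₁ t x - hamiltonianFlux H u₂ m₂ t x‖
      ≤ K * (1 + ‖x‖) * (m₁ x t + m₂ x t) := by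
    refine (norm_sub_le _ _).trans ?_
    linarith [hF₁ x, hF₂ x]
  -- the Hamiltonian terms combine to the two tangent plane gaps
  have main : (m₁ x t - m₂ x t) * (H x (∇ (fun y => u₁ y t) x) - H x (∇ (fun y => u₂ y t) x))
      - inner ℝ (∇ (fun y => u₁ y t - u₂ y t) x)
        (hamiltonianFlux H u₁ m₁ t x - hamiltonianFlux H u₂ m₂ t x)
      = - monotonicityGap H u₁ m₁ u₂ m₂ x t := by
    rw [eg]
    simp only [monotonicityGap, tangentGap, hamiltonianFlux, inner_sub_left, inner_sub_right,
      inner_smul_right]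
    simp only [real_inner_comm (gradP H x _)]
    ring
  have hm0 : 0 ≤ m₁ x t + m₂ x t := by linarith
  -- the terms in which the cutoff is differentiated
  have err1 : 2 * (m₁ x t - m₂ x t) *
      inner ℝ (∇ (spaceCutoff (d := d) R) x) (∇ (fun y => u₁ y t - u₂ y t) x)
      ≤ 8 * V * (C / R) * ((m₁ x t + m₂ x t) * weight x ^ 2) := by
    calc _ ≤ |2 * (m₁ x t - m₂ x t) *
          inner ℝ (∇ (spaceCutoff (d := d) R) x) (∇ (fun y => u₁ y t - u₂ y t) x)| := le_abs_self _
      _ ≤ 2 * (m₁ x t + m₂ x t) * ((2 * (C / R) * ‖x‖) * (V * (1 + ‖x‖))) := by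
          rw [abs_mul, abs_mul, abs_two]
          gcongr
          exact (abs_real_inner_le_norm _ _).trans (by gcongr; exact hdv x)
      _ = 4 * V * (C / R) * ((m₁ x t + m₂ x t) * ((1 + ‖x‖) * ‖x‖)) := by ring
      _ ≤ 4 * V * (C / R) * ((m₁ x t + m₂ x t) * (2 * weight x ^ 2)) := by
          have := hx3.trans (mul_le_mul_of_nonneg_left hw2 zero_le_two)
          gcongr
      _ = _ := by ring
  have err2 : (m₁ x t - m₂ x t) * ((u₁ x t - u₂ x t) *
      Laplacian.laplacian (spaceCutoff (d := d) R) x)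
      ≤ (4 + 2 * d) * V * (C / R) * ((m₁ x t + m₂ x t) * weight x ^ 2) := by
    calc _ ≤ |(m₁ x t - m₂ x t) * ((u₁ x t - u₂ x t) *
          Laplacian.laplacian (spaceCutoff (d := d) R) x)| := le_abs_self _
      _ ≤ (m₁ x t + m₂ x t) * ((V * weight x) * ((4 + 2 * d) * (C / R) * weight x)) := by
          rw [abs_mul, abs_mul]
          gcongr
          exact hv x
      _ = _ := by ring
  have err3 : -((u₁ x t - u₂ x t) * inner ℝ (∇ (spaceCutoff (d := d) R) x)
      (hamiltonianFlux H u₁ m₁ t x - hamiltonianFlux H u₂ m₂ t x))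
      ≤ 4 * K * V * (C / R) * ((m₁ x t + m₂ x t) * weight x ^ 2) := by
    calc _ ≤ |(u₁ x t - u₂ x t) * inner ℝ (∇ (spaceCutoff (d := d) R) x)
          (hamiltonianFlux H u₁ m₁ t x - hamiltonianFlux H u₂ m₂ t x)| := neg_le_abs _
      _ ≤ (V * weight x) * ((2 * (C / R) * ‖x‖) * (K * (1 + ‖x‖) * (m₁ x t + m₂ x t))) := by
          rw [abs_mul]
          gcongr
          · exact hv x
          · exact (abs_real_inner_le_norm _ _).trans (by gcongr)
      _ = 2 * K * V * (C / R) * ((m₁ x t + m₂ x t) * (weight x * ((1 + ‖x‖) * ‖x‖))) := by ring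
      _ ≤ 2 * K * V * (C / R) * ((m₁ x t + m₂ x t) * (weight x * (2 * weight x))) := by
          gcongr
      _ = _ := by ring
  have q3 : derivWithin (u₁ x) (Icc 0 T) t - derivWithin (u₂ x) (Icc 0 T) t
      = H x (∇ (fun y => u₁ y t) x) - H x (∇ (fun y => u₂ y t) x)
        - Laplacian.laplacian (fun y => u₁ y t - u₂ y t) x - (g (m₁ x t) - g (m₂ x t)) := by
    rw [eL]
    linarith
  have hχg := mul_nonneg hχ0 hgm
  have hmain := congrArg (fun r => χ * r) main
  rw [q3]
  have etot : (8 + (4 + 2 * d) + 4 * K) * V * C / R * ((m₁ x t + m₂ x t) * weight x ^ 2)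
      = 8 * V * (C / R) * ((m₁ x t + m₂ x t) * weight x ^ 2)
        + (4 + 2 * d) * V * (C / R) * ((m₁ x t + m₂ x t) * weight x ^ 2)
        + 4 * K * V * (C / R) * ((m₁ x t + m₂ x t) * weight x ^ 2) := by ring
  rw [etot]
  linarith

/-- The Lasry-Lions computation at a fixed time: the left-hand side is the time derivative of
`∫ χ (u₁ - u₂) (m₁ - m₂)`, where `χ` is the cutoff. -/
theorem integral_monotonicity_slice_le (hH : HamiltonianAssumption H) (hg : MonotoneOn g (Ici 0))
    (h₁ : IsSolution T H g uT m₀ u₁ m₁) (h₂ : IsSolution T H g uT m₀ u₂ m₂) {K V C R M : ℝ}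
    (hK0 : 0 ≤ K) (hV0 : 0 ≤ V) (hR : 1 ≤ R) {t : ℝ} (ht : t ∈ Icc 0 T)
    (hf₁ : IsFluxSolution T K m₀ m₁ (hamiltonianFlux H u₁ m₁))
    (hf₂ : IsFluxSolution T K m₀ m₂ (hamiltonianFlux H u₂ m₂))
    (hv : ∀ x, |u₁ x t - u₂ x t| ≤ V * weight x)
    (hdv : ∀ x, ‖∇ (fun y => u₁ y t - u₂ y t) x‖ ≤ V * (1 + ‖x‖))
    (hcut : ∀ s, |deriv (cutoff R) s| ≤ C / R ∧ |deriv (deriv (cutoff R)) s| ≤ C / R)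
    (hM₁ : Integrable (fun x => m₁ x t * weight x ^ 2) ∧ ∫ x, m₁ x t * weight x ^ 2 ≤ M)
    (hM₂ : Integrable (fun x => m₂ x t * weight x ^ 2) ∧ ∫ x, m₂ x t * weight x ^ 2 ≤ M) :
    ∫ x, spaceCutoff R x * ((derivWithin (u₁ x) (Icc 0 T) t - derivWithin (u₂ x) (Icc 0 T) t)
        * (m₁ x t - m₂ x t) + (u₁ x t - u₂ x t)
        * (derivWithin (m₁ x) (Icc 0 T) t - derivWithin (m₂ x) (Icc 0 T) t))
      ≤ -(∫ x, spaceCutoff R x * monotonicityGap H u₁ m₁ u₂ m₂ x t)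
        + (8 + (4 + 2 * d) + 4 * K) * V * C / R * (2 * M) := by
  have hR0 : 0 < R := by linarith
  have hC0 : 0 ≤ C / R := (abs_nonneg _).trans (hcut 0).1
  have hu₁ := h₁.regular_u.contDiff_space t ht
  have hu₂ := h₂.regular_u.contDiff_space t ht
  have hm₁ := h₁.regular_m.contDiff_space t ht
  have hm₂ := h₂.regular_m.contDiff_space t ht
  have hχ : ContDiff ℝ 2 (spaceCutoff (d := d) R) := contDiff_spaceCutoff R (n := 2)
  have hχc : HasCompactSupport (spaceCutoff (d := d) R) := hasCompactSupport_spaceCutoff hR0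
  set ψ : Space d → ℝ := fun y => spaceCutoff R y * (u₁ y t - u₂ y t) with hψ
  have hψ2 : ContDiff ℝ 2 ψ := hχ.mul (hu₁.sub hu₂)
  have hψc : HasCompactSupport ψ := hχc.mul_right
  have cu₁ : Continuous fun x => derivWithin (u₁ x) (Icc 0 T) t :=
    continuous_slice h₁.regular_u.continuous_time ht
  have cu₂ : Continuous fun x => derivWithin (u₂ x) (Icc 0 T) t :=
    continuous_slice h₂.regular_u.continuous_time ht
  have cm₁ : Continuous fun x => derivWithin (m₁ x) (Icc 0 T) t :=
    continuous_slice h₁.regular_m.continuous_time ht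
  have cm₂ : Continuous fun x => derivWithin (m₂ x) (Icc 0 T) t :=
    continuous_slice h₂.regular_m.continuous_time ht
  have iu : Integrable fun x => spaceCutoff R x * ((derivWithin (u₁ x) (Icc 0 T) t
      - derivWithin (u₂ x) (Icc 0 T) t) * (m₁ x t - m₂ x t)) :=
    (hχ.continuous.mul ((cu₁.sub cu₂).mul
      (hm₁.continuous.sub hm₂.continuous))).integrable_of_hasCompactSupport hχc.mul_right
  have id₁ : Integrable fun x => ψ x * derivWithin (m₁ x) (Icc 0 T) t :=
    (hψ2.continuous.mul cm₁).integrable_of_hasCompactSupport hψc.mul_right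
  have id₂ : Integrable fun x => ψ x * derivWithin (m₂ x) (Icc 0 T) t :=
    (hψ2.continuous.mul cm₂).integrable_of_hasCompactSupport hψc.mul_right
  have iL {m : Space d → ℝ} (hm : ContDiff ℝ 2 m) :
      Integrable fun x => m x * Laplacian.laplacian ψ x :=
    (hm.continuous.mul (continuous_laplacian hψ2)).integrable_of_hasCompactSupport
      (hasCompactSupport_laplacian hψc).mul_left
  have iF₁ := integrable_fderiv_apply (hψ2.of_le one_le_two) hψc (h₁.contDiff_flux hH ht).continuous
  have iF₂ := integrable_fderiv_apply (hψ2.of_le one_le_two) hψc (h₂.contDiff_flux hH ht).continuous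
  have e₁ : ∫ x, ψ x * derivWithin (m₁ x) (Icc 0 T) t = (∫ x, m₁ x t * Laplacian.laplacian ψ x)
      - ∫ x, fderiv ℝ ψ x (hamiltonianFlux H u₁ m₁ t x) := by
    rw [hf₁.integral_mul_deriv (hψ2.of_le one_le_two) hψc ht,
      integral_fderiv_gradient hψ2 (hm₁.of_le one_le_two) hψc, neg_neg]
  have e₂ : ∫ x, ψ x * derivWithin (m₂ x) (Icc 0 T) t = (∫ x, m₂ x t * Laplacian.laplacian ψ x)
      - ∫ x, fderiv ℝ ψ x (hamiltonianFlux H u₂ m₂ t x) := by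
    rw [hf₂.integral_mul_deriv (hψ2.of_le one_le_two) hψc ht,
      integral_fderiv_gradient hψ2 (hm₂.of_le one_le_two) hψc, neg_neg]
  have iΔ : Integrable fun x => (m₁ x t - m₂ x t) * Laplacian.laplacian ψ x :=
    iL (m := fun x => m₁ x t - m₂ x t) (hm₁.sub hm₂)
  have iF : Integrable fun x => fderiv ℝ ψ x
      (hamiltonianFlux H u₁ m₁ t x - hamiltonianFlux H u₂ m₂ t x) := by
    simp_rw [map_sub]
    exact iF₁.sub iF₂
  have iuΔ : Integrable fun x => spaceCutoff R x * ((derivWithin (u₁ x) (Icc 0 T) t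
      - derivWithin (u₂ x) (Icc 0 T) t) * (m₁ x t - m₂ x t))
      + (m₁ x t - m₂ x t) * Laplacian.laplacian ψ x := iu.add iΔ
  have etot : ∫ x, spaceCutoff R x * ((derivWithin (u₁ x) (Icc 0 T) t
        - derivWithin (u₂ x) (Icc 0 T) t) * (m₁ x t - m₂ x t) + (u₁ x t - u₂ x t)
        * (derivWithin (m₁ x) (Icc 0 T) t - derivWithin (m₂ x) (Icc 0 T) t))
      = ∫ x, (spaceCutoff R x * ((derivWithin (u₁ x) (Icc 0 T) t
        - derivWithin (u₂ x) (Icc 0 T) t) * (m₁ x t - m₂ x t))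
        + (m₁ x t - m₂ x t) * Laplacian.laplacian ψ x
        - fderiv ℝ ψ x (hamiltonianFlux H u₁ m₁ t x - hamiltonianFlux H u₂ m₂ t x)) := by
    rw [integral_sub iuΔ iF, integral_add iu iΔ]
    have s1 : ∫ x, (m₁ x t - m₂ x t) * Laplacian.laplacian ψ x
        = (∫ x, m₁ x t * Laplacian.laplacian ψ x) - ∫ x, m₂ x t * Laplacian.laplacian ψ x := by
      simp_rw [sub_mul]
      exact integral_sub (iL hm₁) (iL hm₂)
    have s2 : ∫ x, fderiv ℝ ψ x (hamiltonianFlux H u₁ m₁ t x - hamiltonianFlux H u₂ m₂ t x)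
        = (∫ x, fderiv ℝ ψ x (hamiltonianFlux H u₁ m₁ t x))
          - ∫ x, fderiv ℝ ψ x (hamiltonianFlux H u₂ m₂ t x) := by
      simp_rw [map_sub]
      exact integral_sub iF₁ iF₂
    have s3 : ∫ x, spaceCutoff R x * ((derivWithin (u₁ x) (Icc 0 T) t
        - derivWithin (u₂ x) (Icc 0 T) t) * (m₁ x t - m₂ x t) + (u₁ x t - u₂ x t)
        * (derivWithin (m₁ x) (Icc 0 T) t - derivWithin (m₂ x) (Icc 0 T) t))
        = (∫ x, spaceCutoff R x * ((derivWithin (u₁ x) (Icc 0 T) t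
          - derivWithin (u₂ x) (Icc 0 T) t) * (m₁ x t - m₂ x t)))
        + ((∫ x, ψ x * derivWithin (m₁ x) (Icc 0 T) t)
          - ∫ x, ψ x * derivWithin (m₂ x) (Icc 0 T) t) := by
      have i12 : Integrable fun x => ψ x * derivWithin (m₁ x) (Icc 0 T) t
          - ψ x * derivWithin (m₂ x) (Icc 0 T) t := id₁.sub id₂
      rw [← integral_sub id₁ id₂, ← integral_add iu i12]
      refine integral_congr_ae (ae_of_all _ fun x => ?_)
      simp only [hψ]
      ring
    rw [s1, s2, s3, e₁, e₂]
    ring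
  have iQ : Integrable fun x => spaceCutoff R x * monotonicityGap H u₁ m₁ u₂ m₂ x t :=
    (hχ.continuous.mul (continuous_slice (continuousOn_monotonicityGap hH h₁ h₂)
      ht)).integrable_of_hasCompactSupport hχc.mul_right
  have iM : Integrable fun x => (m₁ x t + m₂ x t) * weight x ^ 2 := by
    simp_rw [add_mul]
    exact hM₁.1.add hM₂.1
  have bM : ∫ x, (m₁ x t + m₂ x t) * weight x ^ 2 ≤ 2 * M := by
    simp_rw [add_mul]
    rw [integral_add hM₁.1 hM₂.1]
    linarith [hM₁.2, hM₂.2]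
  have iQn : Integrable fun x => -(spaceCutoff R x * monotonicityGap H u₁ m₁ u₂ m₂ x t) := iQ.neg
  rw [etot]
  calc _ ≤ ∫ x, (-(spaceCutoff R x * monotonicityGap H u₁ m₁ u₂ m₂ x t)
        + (8 + (4 + 2 * d) + 4 * K) * V * C / R * ((m₁ x t + m₂ x t) * weight x ^ 2)) := by
        refine integral_mono (iuΔ.sub iF) (iQn.add (iM.const_mul _)) fun x => ?_
        exact monotonicity_integrand_le hg h₁ h₂ hK0 hV0 hR ht (fun y => hf₁.norm_flux_le y t ht)
          (fun y => hf₂.norm_flux_le y t ht) hv hdv hcut x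
    _ = -(∫ x, spaceCutoff R x * monotonicityGap H u₁ m₁ u₂ m₂ x t)
        + (8 + (4 + 2 * d) + 4 * K) * V * C / R * ∫ x, (m₁ x t + m₂ x t) * weight x ^ 2 := by
        rw [integral_add iQn (iM.const_mul _), integral_neg, integral_const_mul]
    _ ≤ _ := by
        have : 0 ≤ (8 + (4 + 2 * d) + 4 * K) * V * C / R := by
          rw [mul_div_assoc]
          positivity
        gcongr

/-- Both solutions have the same initial density and the same terminal value, so that
`∫ χ (u₁ - u₂) (m₁ - m₂)` vanishes at both ends and the gap has integral zero as `R` tends to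
infinity. -/
theorem monotonicityGap_eq_zero (hT : 0 < T) (hH : HamiltonianAssumption H)
    (hdata : DataAssumption uT m₀) (hgrowth : GrowthAssumption H) (hhess : HessianAssumption H)
    (hg : MonotoneOn g (Ici 0)) (h₁ : IsSolution T H g uT m₀ u₁ m₁)
    (h₂ : IsSolution T H g uT m₀ u₂ m₂) (x : Space d) {t : ℝ} (ht : t ∈ Icc 0 T) :
    monotonicityGap H u₁ m₁ u₂ m₂ x t = 0 := by
  obtain ⟨K₁, hK₁, hb₁⟩ := h₁.exists_norm_drift_le hH hgrowth hhess
  obtain ⟨K₂, hK₂, hb₂⟩ := h₂.exists_norm_drift_le hH hgrowth hhess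
  obtain ⟨V₁, hV₁, hv₁⟩ := h₁.exists_abs_u_le hT.le
  obtain ⟨V₂, hV₂, hv₂⟩ := h₂.exists_abs_u_le hT.le
  obtain ⟨C, hC, hcut⟩ := exists_bound_deriv_cutoff
  have hflux {K' : ℝ} (hK' : K' ≤ K₁ + K₂) {u m : Space d → ℝ → ℝ}
      (h : IsSolution T H g uT m₀ u m) (hb : ∀ x, ∀ t ∈ Icc 0 T,
        ‖gradP H x (∇ (fun z => u z t) x)‖ ≤ K' * (1 + ‖x‖)) :
      IsFluxSolution T (K₁ + K₂) m₀ m (hamiltonianFlux H u m) := by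
    refine h.isFluxSolution hH fun x t ht => ?_
    have h0 := h.nonneg_m x t ht
    rw [hamiltonianFlux, norm_smul, Real.norm_eq_abs, abs_of_nonneg h0, mul_comm]
    gcongr
    refine (hb x t ht).trans ?_
    gcongr
  have hf₁ := hflux (by linarith) h₁ hb₁
  have hf₂ := hflux (by linarith) h₂ hb₂
  obtain ⟨M, hM, hmom⟩ := exists_moment_bound (T := T) (add_nonneg hK₁ hK₂)
    hdata.smooth_m₀.continuous hdata.compactSupport_m₀ 2
  set D := (8 + (4 + 2 * d) + 4 * (K₁ + K₂)) * (V₁ + V₂) * C * (2 * M) with hD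
  have hslice {R : ℝ} (hR : 1 ≤ R) {t : ℝ} (ht : t ∈ Icc 0 T) :=
    integral_monotonicity_slice_le hH hg h₁ h₂ (add_nonneg hK₁ hK₂) (add_nonneg hV₁ hV₂) hR ht
      hf₁ hf₂ (fun x => by
        refine (abs_sub _ _).trans ?_
        rw [add_mul]
        exact add_le_add (hv₁ x t ht).1 (hv₂ x t ht).1)
      (fun x => by
        have eg : ∇ (fun y => u₁ y t - u₂ y t) x
            = ∇ (fun y => u₁ y t) x - ∇ (fun y => u₂ y t) x := by
          simp only [gradient, ← map_sub]
          congr 1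
          exact fderiv_sub ((h₁.regular_u.contDiff_space t ht).differentiable two_ne_zero x)
            ((h₂.regular_u.contDiff_space t ht).differentiable two_ne_zero x)
        rw [eg, add_mul]
        exact (norm_sub_le _ _).trans (add_le_add (hv₁ x t ht).2 (hv₂ x t ht).2))
      (hcut R hR) (hmom _ _ hf₁ t ht) (hmom _ _ hf₂ t ht)
  have hQc := continuousOn_monotonicityGap hH h₁ h₂
  have hχQc (R : ℝ) : ContinuousOn (fun z : Space d × ℝ =>
      spaceCutoff R z.1 * monotonicityGap H u₁ m₁ u₂ m₂ z.1 z.2) (univ ×ˢ Icc 0 T) :=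
    ((contDiff_spaceCutoff R (n := 0)).continuous.comp continuous_fst).continuousOn.mul hQc
  have hIc {R : ℝ} (hR : 1 ≤ R) : ContinuousOn
      (fun s => ∫ x, spaceCutoff R x * monotonicityGap H u₁ m₁ u₂ m₂ x s) (Icc 0 T) :=
    continuousOn_integral_strip (isCompact_weight_le (2 * R)) (hχQc R) fun x hx s _ => by
      rw [spaceCutoff_eq_zero (by linarith) hx, zero_mul]
  have hbound {R : ℝ} (hR : 1 ≤ R) :
      ∫ s in 0..T, ∫ x, spaceCutoff R x * monotonicityGap H u₁ m₁ u₂ m₂ x s ≤ T * D / R := by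
    set f : Space d → ℝ → ℝ := fun x s =>
      spaceCutoff R x * ((u₁ x s - u₂ x s) * (m₁ x s - m₂ x s)) with hf
    set f' : Space d → ℝ → ℝ := fun x s =>
      spaceCutoff R x * ((derivWithin (u₁ x) (Icc 0 T) s - derivWithin (u₂ x) (Icc 0 T) s)
        * (m₁ x s - m₂ x s) + (u₁ x s - u₂ x s)
        * (derivWithin (m₁ x) (Icc 0 T) s - derivWithin (m₂ x) (Icc 0 T) s)) with hf'
    have hsupp : ∀ x ∉ {x : Space d | weight x ≤ 2 * R}, ∀ s, f' x s = 0 := fun x hx s => by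
      simp only [hf']
      rw [spaceCutoff_eq_zero (by linarith) hx, zero_mul]
    have hcont : ContinuousOn (fun z : Space d × ℝ => f' z.1 z.2) (univ ×ˢ Icc 0 T) := by
      refine ((contDiff_spaceCutoff R (n := 0)).continuous.comp continuous_fst).continuousOn.mul ?_
      exact ((h₁.regular_u.continuous_time.sub h₂.regular_u.continuous_time).mul
        (h₁.regular_m.continuous.sub h₂.regular_m.continuous)).add
        ((h₁.regular_u.continuous.sub h₂.regular_u.continuous).mul
        (h₁.regular_m.continuous_time.sub h₂.regular_m.continuous_time))
    have hFTC := integral_sub_eq_integral_deriv (f := f) (f' := f') hT.le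
      (isCompact_weight_le (2 * R))
      (fun x s hs => (((h₁.regular_u.hasDerivWithinAt x hs).sub
        (h₂.regular_u.hasDerivWithinAt x hs)).mul ((h₁.regular_m.hasDerivWithinAt x hs).sub
        (h₂.regular_m.hasDerivWithinAt x hs))).const_mul (spaceCutoff R x)) hcont hsupp
    have e0 : ∀ x, f x T - f x 0 = 0 := fun x => by
      simp [hf, h₁.terminal, h₂.terminal, h₁.initial, h₂.initial]
    simp only [e0, integral_zero] at hFTC
    have hle : ∫ s in 0..T, ∫ x, f' x s ≤ ∫ s in 0..T,
        (-(∫ x, spaceCutoff R x * monotonicityGap H u₁ m₁ u₂ m₂ x s) + D / R) := by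
      refine intervalIntegral.integral_mono_on hT.le
        ((continuousOn_integral_strip (isCompact_weight_le (2 * R)) hcont
          fun x hx s _ => hsupp x hx s).intervalIntegrable_of_Icc hT.le)
        (((hIc hR).neg.add continuousOn_const).intervalIntegrable_of_Icc hT.le) fun s hs => ?_
      refine (hslice hR hs).trans (le_of_eq ?_)
      rw [hD]
      ring
    have hIn : IntervalIntegrable
        (fun s => -∫ x, spaceCutoff R x * monotonicityGap H u₁ m₁ u₂ m₂ x s) volume 0 T :=
      (hIc hR).neg.intervalIntegrable_of_Icc hT.le
    rw [intervalIntegral.integral_add hIn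
      intervalIntegrable_const, intervalIntegral.integral_neg,
      intervalIntegral.integral_const] at hle
    simp only [sub_zero, smul_eq_mul] at hle
    rw [mul_div_assoc]
    linarith
  by_contra hne
  have hpos : 0 < monotonicityGap H u₁ m₁ u₂ m₂ x t :=
    lt_of_le_of_ne (monotonicityGap_nonneg hH h₁ h₂ x ht) (Ne.symm hne)
  -- the gap is positive near `x`, which bounds the localized integrals from below
  set R₀ := weight x with hR₀
  have hR₀1 : 1 ≤ R₀ := one_le_weight x
  have hnn (R : ℝ) {s : ℝ} (hs : s ∈ Icc 0 T) (y : Space d) :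
      0 ≤ spaceCutoff R y * monotonicityGap H u₁ m₁ u₂ m₂ y s :=
    mul_nonneg (spaceCutoff_nonneg _ _) (monotonicityGap_nonneg hH h₁ h₂ y hs)
  have hint {R : ℝ} (hR : 1 ≤ R) {s : ℝ} (hs : s ∈ Icc 0 T) :
      Integrable fun y => spaceCutoff R y * monotonicityGap H u₁ m₁ u₂ m₂ y s :=
    (continuous_slice (hχQc R) hs).integrable_of_hasCompactSupport
      (hasCompactSupport_spaceCutoff (by linarith)).mul_right
  have hI0 : 0 < ∫ s in 0..T, ∫ y, spaceCutoff R₀ y * monotonicityGap H u₁ m₁ u₂ m₂ y s := by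
    refine intervalIntegral.integral_pos hT (hIc hR₀1)
      (fun s hs => integral_nonneg (hnn R₀ (Ioc_subset_Icc_self hs))) ⟨t, ht, ?_⟩
    refine (continuous_slice (hχQc R₀) ht).integral_pos_of_hasCompactSupport_nonneg_nonzero
      (hasCompactSupport_spaceCutoff (by linarith)).mul_right (hnn R₀ ht) (x := x) ?_
    rw [spaceCutoff_eq_one (by linarith) le_rfl, one_mul]
    exact hne
  set I₀ := ∫ s in 0..T, ∫ y, spaceCutoff R₀ y * monotonicityGap H u₁ m₁ u₂ m₂ y s with hI₀
  have hle {R : ℝ} (hR : 2 * R₀ ≤ R) : I₀ ≤ T * D / R := by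
    have hR1 : 1 ≤ R := by linarith
    refine le_trans ?_ (hbound hR1)
    refine intervalIntegral.integral_mono_on hT.le ((hIc hR₀1).intervalIntegrable_of_Icc hT.le)
      ((hIc hR1).intervalIntegrable_of_Icc hT.le) fun s hs => ?_
    refine integral_mono (hint hR₀1 hs) (hint hR1 hs) fun y => ?_
    have hQ := monotonicityGap_nonneg hH h₁ h₂ y hs
    refine mul_le_mul_of_nonneg_right ?_ hQ
    by_cases hy : weight y ≤ 2 * R₀
    · rw [spaceCutoff_eq_one (by linarith) (hy.trans hR)]
      exact spaceCutoff_le_one _ _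
    · rw [spaceCutoff_eq_zero (by linarith) hy]
      exact spaceCutoff_nonneg _ _
  have hTD : 0 ≤ T * D := by positivity
  have hR := hle (R := 2 * R₀ + 2 * (T * D) / I₀ ) (by
    have : 0 ≤ 2 * (T * D) / I₀ := by positivity
    linarith)
  rw [le_div_iff₀ (by positivity), mul_add] at hR
  have : I₀ * (2 * (T * D) / I₀) = 2 * (T * D) := by field_simp
  nlinarith

/-- The density of any solution is transported by the drift of a given one: where the density is
positive the two momenta agree. -/
theorem hamiltonianFlux_eq (hT : 0 < T) (hH : HamiltonianAssumption H)
    (hdata : DataAssumption uT m₀) (hgrowth : GrowthAssumption H) (hhess : HessianAssumption H)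
    (hg : MonotoneOn g (Ici 0)) (h₁ : IsSolution T H g uT m₀ u₁ m₁)
    (h₂ : IsSolution T H g uT m₀ u₂ m₂) (x : Space d) {t : ℝ} (ht : t ∈ Icc 0 T) :
    hamiltonianFlux H u₂ m₂ t x = m₂ x t • gradP H x (∇ (fun z => u₁ z t) x) := by
  have h0 := monotonicityGap_eq_zero hT hH hdata hgrowth hhess hg h₁ h₂ x ht
  have n1 := mul_nonneg (h₁.nonneg_m x t ht)
    (hH.tangent x (∇ (fun y => u₁ y t) x) (∇ (fun y => u₂ y t) x))
  have n2 := mul_nonneg (h₂.nonneg_m x t ht)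
    (hH.tangent x (∇ (fun y => u₂ y t) x) (∇ (fun y => u₁ y t) x))
  have h2 : m₂ x t * tangentGap H x (∇ (fun y => u₂ y t) x) (∇ (fun y => u₁ y t) x) = 0 := by
    unfold monotonicityGap at h0
    unfold tangentGap at *
    linarith
  rcases mul_eq_zero.1 h2 with h | h
  · simp [hamiltonianFlux, h]
  · rw [hamiltonianFlux, hH.eq_of_tangent_eq h]

end monotonicity

/-! ### Truncated powers and the associated convex entropies -/

/-- A smooth function on `[0, ∞)` that is comparable to `s ^ (a + 1)` for `1 ≤ s ≤ 1 / ε` and, for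
`-1 < a`, bounded at infinity. The factor `(1 + s) ^ a` avoids the singularity of `s ^ a` at `0`
for negative `a`. -/
def truncPow (a ε s : ℝ) : ℝ := s * ((1 + s) ^ a * (1 + ε * s) ^ (-(a + 1)))

/-- The derivative of `truncPow a ε` on `[0, ∞)`. -/
def truncPowDeriv (a ε s : ℝ) : ℝ := (1 + s) ^ a * (1 + ε * s) ^ (-(a + 1)) *
  (1 + a * (s / (1 + s)) - (a + 1) * (ε * s / (1 + ε * s)))

section truncPow

variable {a ε : ℝ}

theorem hasDerivAt_truncPow (hε : 0 < ε) {s : ℝ} (hs : 0 ≤ s) :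
    HasDerivAt (truncPow a ε) (truncPowDeriv a ε s) s := by
  have p1 : 0 < 1 + s := by positivity
  have p2 : 0 < 1 + ε * s := by positivity
  have h1 : HasDerivAt (fun r => (1 + r) ^ a) (a * (1 + s) ^ (a - 1)) s := by
    have := ((hasDerivAt_id s).const_add 1).rpow_const (p := a) (Or.inl p1.ne')
    simpa using this
  have h2 : HasDerivAt (fun r => (1 + ε * r) ^ (-(a + 1)))
      (ε * (-(a + 1)) * (1 + ε * s) ^ (-(a + 1) - 1)) s := by
    have := (((hasDerivAt_id s).const_mul ε).const_add 1).rpow_const (p := -(a + 1))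
      (Or.inl p2.ne')
    simpa using this
  have h3 := (hasDerivAt_id s).mul (h1.mul h2)
  refine h3.congr_deriv ?_
  rw [Real.rpow_sub_one p1.ne', Real.rpow_sub_one p2.ne', truncPowDeriv]
  simp only [id, Pi.mul_apply]
  ring

theorem truncPow_nonneg (hε : 0 < ε) {s : ℝ} (hs : 0 ≤ s) : 0 ≤ truncPow a ε s := by
  unfold truncPow
  positivity

theorem rpow_mul_rpow_le (ha : -1 < a) (hε : 0 < ε) {s : ℝ} (hs : 0 ≤ s) :
    (1 + s) ^ a * (1 + ε * s) ^ (-(a + 1)) ≤ (1 + s) ^ a := by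
  refine mul_le_of_le_one_right (by positivity) ?_
  exact Real.rpow_le_one_of_one_le_of_nonpos (by nlinarith) (by linarith)

/-- For fixed `ε` the factor in `truncPow` decays like `1 / s`. The constant degenerates with
`ε`, and serves only in terms that vanish with the cutoff. -/
theorem rpow_mul_rpow_le' (ha : -1 < a) (hε : 0 < ε) (hε1 : ε ≤ 1) {s : ℝ} (hs : 0 ≤ s) :
    (1 + s) ^ a * (1 + ε * s) ^ (-(a + 1)) ≤ ε ^ (-(a + 1)) / (1 + s) := by
  have p1 : 0 < 1 + s := by positivity
  have h : (1 + ε * s) ^ (-(a + 1)) ≤ (ε * (1 + s)) ^ (-(a + 1)) :=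
    Real.rpow_le_rpow_of_nonpos (by positivity) (by nlinarith) (by linarith)
  calc _ ≤ (1 + s) ^ a * (ε * (1 + s)) ^ (-(a + 1)) := by gcongr
    _ = ε ^ (-(a + 1)) * ((1 + s) ^ a * (1 + s) ^ (-(a + 1))) := by
        rw [Real.mul_rpow hε.le p1.le]
        ring
    _ = _ := by
        rw [← Real.rpow_add p1, show a + -(a + 1) = -1 by ring, Real.rpow_neg_one, div_eq_mul_inv]

theorem truncPow_le (ha : -1 < a) (hε : 0 < ε) {s : ℝ} (hs : 0 ≤ s) :
    truncPow a ε s ≤ s * (1 + s) ^ a :=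
  mul_le_mul_of_nonneg_left (rpow_mul_rpow_le ha hε hs) hs

theorem truncPow_sq_le (ha : -1 < a) (hε : 0 < ε) (hε1 : ε ≤ 1) {s : ℝ} (hs : 0 ≤ s) :
    truncPow a ε s ^ 2 ≤ (ε ^ (-(a + 1))) ^ 2 * s := by
  have p1 : 0 < 1 + s := by positivity
  have h := mul_le_mul_of_nonneg_left (rpow_mul_rpow_le' ha hε hε1 hs) hs
  calc truncPow a ε s ^ 2 ≤ (s * (ε ^ (-(a + 1)) / (1 + s))) ^ 2 := by
        gcongr
        · exact truncPow_nonneg hε hs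
        · exact h
    _ = (ε ^ (-(a + 1))) ^ 2 * (s ^ 2 / (1 + s) ^ 2) := by
        rw [← mul_div_assoc, div_pow, mul_pow]
        ring
    _ ≤ _ := by
        gcongr
        rw [div_le_iff₀ (by positivity)]
        nlinarith [mul_nonneg hs hs, mul_nonneg hs (mul_nonneg hs hs)]

theorem abs_logDeriv_factor_le (ha : -1 < a) (hε : 0 < ε) {s : ℝ} (hs : 0 ≤ s) :
    |1 + a * (s / (1 + s)) - (a + 1) * (ε * s / (1 + ε * s))| ≤ 2 * |a| + 2 := by
  have h1 : s / (1 + s) ≤ 1 := (div_le_one (by positivity)).2 (by linarith)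
  have h2 : ε * s / (1 + ε * s) ≤ 1 := (div_le_one (by positivity)).2 (by linarith)
  have h3 : 0 ≤ s / (1 + s) := by positivity
  have h4 : 0 ≤ ε * s / (1 + ε * s) := by positivity
  have h5 : |a * (s / (1 + s))| ≤ |a| := by
    rw [abs_mul, abs_of_nonneg h3]
    exact mul_le_of_le_one_right (abs_nonneg _) h1
  have h6 := abs_le.1 h5
  have h7 := neg_abs_le a
  have h8 := le_abs_self a
  have h9 : (a + 1) * (ε * s / (1 + ε * s)) ≤ a + 1 := mul_le_of_le_one_right (by linarith) h2
  have h10 : 0 ≤ (a + 1) * (ε * s / (1 + ε * s)) := mul_nonneg (by linarith) h4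
  rw [abs_le]
  constructor <;> linarith [h6.1, h6.2, abs_nonneg a]

theorem abs_truncPowDeriv_le (ha : -1 < a) (hε : 0 < ε) {s : ℝ} (hs : 0 ≤ s) :
    |truncPowDeriv a ε s| ≤ (2 * |a| + 2) * ((1 + s) ^ a * (1 + ε * s) ^ (-(a + 1))) := by
  have h0 : 0 ≤ (1 + s) ^ a * (1 + ε * s) ^ (-(a + 1)) := by positivity
  rw [truncPowDeriv, abs_mul, abs_of_nonneg h0, mul_comm]
  gcongr
  exact abs_logDeriv_factor_le ha hε hs

theorem sq_truncPowDeriv_mul_sq_le (ha : -1 < a) (hε : 0 < ε) {s : ℝ} (hs : 0 ≤ s) :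
    truncPowDeriv a ε s ^ 2 * s ^ 2 ≤ (2 * |a| + 2) ^ 2 * truncPow a ε s ^ 2 := by
  have h := mul_le_mul_of_nonneg_right (abs_truncPowDeriv_le ha hε hs) hs
  calc truncPowDeriv a ε s ^ 2 * s ^ 2 = (|truncPowDeriv a ε s| * s) ^ 2 := by
        rw [mul_pow, sq_abs]
    _ ≤ _ := pow_le_pow_left₀ (by positivity) h 2
    _ = _ := by unfold truncPow; ring

theorem sq_truncPowDeriv_le (ha : -1 < a) (hε : 0 < ε) {s M : ℝ} (hs : 0 ≤ s) (hsM : s ≤ M) :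
    truncPowDeriv a ε s ^ 2 ≤ ((2 * |a| + 2) * (1 + M) ^ |a|) ^ 2 := by
  rw [← sq_abs (truncPowDeriv a ε s)]
  refine pow_le_pow_left₀ (abs_nonneg _) ?_ 2
  refine (abs_truncPowDeriv_le ha hε hs).trans ?_
  gcongr
  refine (rpow_mul_rpow_le ha hε hs).trans ?_
  calc (1 + s) ^ a ≤ (1 + s) ^ |a| :=
        Real.rpow_le_rpow_of_exponent_le (by linarith) (le_abs_self a)
    _ ≤ _ := by gcongr

theorem sq_truncPowDeriv_le' (ha : -1 < a) (hε : 0 < ε) (hε1 : ε ≤ 1) {s : ℝ} (hs : 0 ≤ s) :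
    truncPowDeriv a ε s ^ 2 ≤ ((2 * |a| + 2) * ε ^ (-(a + 1))) ^ 2 / (1 + s) ^ 2 := by
  rw [← sq_abs (truncPowDeriv a ε s), ← div_pow]
  refine pow_le_pow_left₀ (abs_nonneg _) ?_ 2
  refine (abs_truncPowDeriv_le ha hε hs).trans ?_
  rw [mul_div_assoc]
  gcongr
  exact rpow_mul_rpow_le' ha hε hε1 hs

theorem continuous_truncPowDeriv_abs (hε : 0 < ε) :
    Continuous fun s => truncPowDeriv a ε |s| := by
  have p1 (s : ℝ) : 1 + |s| ≠ 0 := by positivity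
  have p2 (s : ℝ) : 1 + ε * |s| ≠ 0 := by positivity
  unfold truncPowDeriv
  refine Continuous.mul (Continuous.mul ?_ ?_) ?_
  · exact (continuous_const.add continuous_abs).rpow_const fun s => Or.inl (p1 s)
  · exact (continuous_const.add (continuous_const.mul continuous_abs)).rpow_const
      fun s => Or.inl (p2 s)
  · exact (continuous_const.add (continuous_const.mul (continuous_abs.div
      (continuous_const.add continuous_abs) p1))).sub (continuous_const.mul
      ((continuous_const.mul continuous_abs).div (continuous_const.add
        (continuous_const.mul continuous_abs)) p2))

end truncPow

/-- A convex `C²` function of at most linear growth on `[0, ∞)`, recorded with its first two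
derivatives. -/
structure IsEntropy (β β₁ β₂ : ℝ → ℝ) (B : ℝ) : Prop where
  hasDerivAt : ∀ s, HasDerivAt β (β₁ s) s
  hasDerivAt_deriv : ∀ s, HasDerivAt β₁ (β₂ s) s
  continuous_snd : Continuous β₂
  snd_nonneg : ∀ s, 0 ≤ β₂ s
  fst_nonneg : ∀ s, 0 ≤ s → 0 ≤ β₁ s
  fst_le : ∀ s, 0 ≤ s → β₁ s ≤ B
  nonneg : ∀ s, 0 ≤ s → 0 ≤ β s
  le : ∀ s, 0 ≤ s → β s ≤ B * s

/-- For every truncated power there is an entropy whose second derivative is the square of the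
derivative of the truncated power. Its size on bounded sets does not depend on the truncation. -/
theorem exists_isEntropy {a ε : ℝ} (ha : -1 < a) (hε : 0 < ε) (hε1 : ε ≤ 1) :
    ∃ β β₁ β₂ B, IsEntropy β β₁ β₂ B ∧ (∀ s, 0 ≤ s → β₂ s = truncPowDeriv a ε s ^ 2) ∧
      ∀ M s, 0 ≤ s → s ≤ M → β s ≤ ((2 * |a| + 2) * (1 + M) ^ |a|) ^ 2 * M * s := by
  set β₂ : ℝ → ℝ := fun s => truncPowDeriv a ε |s| ^ 2 with hβ₂
  have c2 : Continuous β₂ := (continuous_truncPowDeriv_abs hε).pow 2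
  set β₁ : ℝ → ℝ := fun s => ∫ r in 0..s, β₂ r with hβ₁
  have d1 (s : ℝ) : HasDerivAt β₁ (β₂ s) s := (c2.integral_hasStrictDerivAt 0 s).hasDerivAt
  have c1 : Continuous β₁ := continuous_iff_continuousAt.2 fun s => (d1 s).continuousAt
  set β : ℝ → ℝ := fun s => ∫ r in 0..s, β₁ r with hβ
  have d0 (s : ℝ) : HasDerivAt β (β₁ s) s := (c1.integral_hasStrictDerivAt 0 s).hasDerivAt
  have n2 (s : ℝ) : 0 ≤ β₂ s := sq_nonneg _
  have e2 (s : ℝ) (hs : 0 ≤ s) : β₂ s = truncPowDeriv a ε s ^ 2 := by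
    simp only [hβ₂, abs_of_nonneg hs]
  have n1 (s : ℝ) (hs : 0 ≤ s) : 0 ≤ β₁ s :=
    intervalIntegral.integral_nonneg hs fun r _ => n2 r
  have n0 (s : ℝ) (hs : 0 ≤ s) : 0 ≤ β s :=
    intervalIntegral.integral_nonneg hs fun r hr => n1 r hr.1
  set B := ((2 * |a| + 2) * ε ^ (-(a + 1))) ^ 2 with hB
  have hB0 : 0 ≤ B := sq_nonneg _
  have lift {f : ℝ → ℝ} (hf : Continuous f) {c s : ℝ} (hs : 0 ≤ s)
      (h : ∀ r ∈ Icc 0 s, f r ≤ c) : ∫ r in 0..s, f r ≤ c * s := by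
    calc _ ≤ ∫ r in 0..s, c := intervalIntegral.integral_mono_on hs
          (hf.intervalIntegrable _ _) intervalIntegrable_const h
      _ = _ := by simp [mul_comm]
  -- `β₂` is integrable at infinity, so that `β₁` is bounded
  have b1 (s : ℝ) (hs : 0 ≤ s) : β₁ s ≤ B := by
    have hc : ContinuousOn (fun r => B / (1 + r) ^ 2) (uIcc 0 s) := by
      refine ContinuousOn.div (by fun_prop) (by fun_prop) fun r hr => ?_
      rw [uIcc_of_le hs] at hr
      have hr0 := hr.1
      positivity
    have hI : ∫ r in 0..s, B / (1 + r) ^ 2 = -B / (1 + s) - -B / (1 + 0) := by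
      refine intervalIntegral.integral_eq_sub_of_hasDerivAt
        (f := fun r => -B / (1 + r)) (fun r hr => ?_) ?_
      · rw [uIcc_of_le hs] at hr
        have hr0 := hr.1
        have p : 1 + r ≠ 0 := by positivity
        refine ((hasDerivAt_const r (-B)).div ((hasDerivAt_id r).const_add 1) p).congr_deriv ?_
        simp
      · exact hc.intervalIntegrable
    calc β₁ s ≤ ∫ r in 0..s, B / (1 + r) ^ 2 := by
          refine intervalIntegral.integral_mono_on hs (c2.intervalIntegrable _ _) ?_ fun r hr => ?_
          · exact hc.intervalIntegrable
          · rw [e2 r hr.1]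
            exact sq_truncPowDeriv_le' ha hε hε1 hr.1
      _ = B - B / (1 + s) := by rw [hI]; ring
      _ ≤ B := by
          have : 0 ≤ B / (1 + s) := by positivity
          linarith
  refine ⟨β, β₁, β₂, B, ⟨d0, d1, c2, n2, n1, b1, n0, fun s hs =>
    lift c1 hs fun r hr => b1 r hr.1⟩, e2, fun M s hs hsM => ?_⟩
  refine lift c1 hs fun r hr => ?_
  refine (lift c2 hr.1 fun q hq => ?_).trans
    (mul_le_mul_of_nonneg_left (hr.2.trans hsM) (sq_nonneg _))
  rw [e2 q hq.1]
  exact sq_truncPowDeriv_le ha hε hq.1 ((hq.2.trans hr.2).trans hsM)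

/-! ### The localized energy inequality -/

section energy

variable {T K : ℝ} {m₀ : Space d → ℝ} {m : Space d → ℝ → ℝ} {F : ℝ → Space d → Space d}
  {β β₁ β₂ : ℝ → ℝ} {B : ℝ}

theorem IsEntropy.contDiff_fst (hβ : IsEntropy β β₁ β₂ B) : ContDiff ℝ 1 β₁ := by
  refine contDiff_one_iff_deriv.2 ⟨fun s => (hβ.hasDerivAt_deriv s).differentiableAt, ?_⟩
  rw [show deriv β₁ = β₂ from funext fun s => (hβ.hasDerivAt_deriv s).deriv]
  exact hβ.continuous_snd

theorem IsEntropy.contDiff (hβ : IsEntropy β β₁ β₂ B) : ContDiff ℝ 1 β := by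
  refine contDiff_one_iff_deriv.2 ⟨fun s => (hβ.hasDerivAt s).differentiableAt, ?_⟩
  rw [show deriv β = β₁ from funext fun s => (hβ.hasDerivAt s).deriv]
  exact hβ.contDiff_fst.continuous

theorem gradient_comp {β : ℝ → ℝ} {b : ℝ} {f : Space d → ℝ} {x : Space d}
    (hβ : HasDerivAt β b (f x)) (hf : DifferentiableAt ℝ f x) :
    ∇ (fun y => β (f y)) x = b • ∇ f x := by
  refine HasGradientAt.gradient (hasGradientAt_iff_hasFDerivAt.2 ?_)
  refine (hβ.comp_hasFDerivAt x hf.hasFDerivAt).congr_fderiv ?_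
  ext v
  simp

/-- Testing the equation with `ψ β₁(m)`. The flux is absorbed by Young's inequality in the term
with the gradient, at the price of the weight. -/
theorem IsFluxSolution.energy_slice_le (hK : 0 ≤ K) (h : IsFluxSolution T K m₀ m F)
    (hβ : IsEntropy β β₁ β₂ B) {ψ : Space d → ℝ} (hψ : ContDiff ℝ 2 ψ) (hc : HasCompactSupport ψ)
    (hψ0 : ∀ x, 0 ≤ ψ x) {c : ℝ} (hc0 : 0 ≤ c) (hψ1 : ∀ x, ‖∇ ψ x‖ ≤ 2 * c * ‖x‖)
    (hψ2 : ∀ x, |Laplacian.laplacian ψ x| ≤ (4 + 2 * d) * c * weight x) {t : ℝ}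
    (ht : t ∈ Icc 0 T) (hw : Integrable fun x => m x t * weight x) :
    ∫ x, ψ x * (β₁ (m x t) * derivWithin (m x) (Icc 0 T) t)
      ≤ -(1 / 2 * ∫ x, ψ x * (β₂ (m x t) * ‖∇ (fun y => m y t) x‖ ^ 2))
        + K ^ 2 * (∫ x, ψ x * (β₂ (m x t) * m x t ^ 2 * weight x))
        + B * c * (4 + 2 * d + 4 * K) * ∫ x, m x t * weight x := by
  have hm := h.regular.contDiff_space t ht
  have hm1 : ContDiff ℝ 1 fun x => m x t := hm.of_le one_le_two
  have hψ' : ContDiff ℝ 1 ψ := hψ.of_le one_le_two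
  have hF := h.contDiff_flux t ht
  have hg : ContDiff ℝ 1 (∇ fun x => m x t) := h.regular.contDiff_gradient ht
  have hb1 : ContDiff ℝ 1 fun x => β₁ (m x t) := hβ.contDiff_fst.comp hm1
  have hb0 : ContDiff ℝ 1 fun x => β (m x t) := hβ.contDiff.comp hm1
  have hb2 : Continuous fun x => β₂ (m x t) := hβ.continuous_snd.comp hm.continuous
  have hwc : Continuous (weight (d := d)) := (contDiff_weight (n := 0)).continuous
  set Ψ : Space d → ℝ := fun x => ψ x * β₁ (m x t) with hΨ
  have hΨ1 : ContDiff ℝ 1 Ψ := hψ'.mul hb1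
  have hΨc : HasCompactSupport Ψ := hc.mul_right
  have dΨ (x v : Space d) : fderiv ℝ Ψ x v = β₁ (m x t) * fderiv ℝ ψ x v
      + ψ x * (β₂ (m x t) * inner ℝ (∇ (fun y => m y t) x) v) := by
    have h1 : fderiv ℝ Ψ x = _ := ((hψ'.differentiable one_ne_zero x).hasFDerivAt.mul
      ((hβ.hasDerivAt_deriv (m x t)).comp_hasFDerivAt x
        (hm.differentiable two_ne_zero x).hasFDerivAt)).fderiv
    rw [h1]
    simp [inner_gradient_left]
    ring
  have ig (v : Space d → Space d) (hv : Continuous v) : Integrable fun x =>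
      β₁ (m x t) * fderiv ℝ ψ x (v x) := by
    refine (hb1.continuous.mul ((hψ'.continuous_fderiv one_ne_zero).clm_apply
      hv)).integrable_of_hasCompactSupport (HasCompactSupport.intro (hc.fderiv ℝ) fun x hx => ?_)
    simp only [Pi.mul_apply]
    rw [image_eq_zero_of_notMem_tsupport hx]
    simp
  have iG : Integrable fun x => ψ x * (β₂ (m x t) * ‖∇ (fun y => m y t) x‖ ^ 2) :=
    (hψ.continuous.mul (hb2.mul (hg.continuous.norm.pow 2))).integrable_of_hasCompactSupport
      hc.mul_right
  have iW : Integrable fun x => ψ x * (β₂ (m x t) * m x t ^ 2 * weight x) :=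
    (hψ.continuous.mul ((hb2.mul (hm.continuous.pow 2)).mul
      hwc)).integrable_of_hasCompactSupport hc.mul_right
  have iF : Integrable fun x => ψ x * (β₂ (m x t) * inner ℝ (∇ (fun y => m y t) x) (F t x)) :=
    (hψ.continuous.mul (hb2.mul (hg.continuous.inner
      hF.continuous))).integrable_of_hasCompactSupport hc.mul_right
  have iL : Integrable fun x => β (m x t) * Laplacian.laplacian ψ x :=
    (hb0.continuous.mul (continuous_laplacian hψ)).integrable_of_hasCompactSupport
      (hasCompactSupport_laplacian hc).mul_left
  have e1 : ∫ x, ψ x * (β₁ (m x t) * derivWithin (m x) (Icc 0 T) t)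
      = -(∫ x, fderiv ℝ Ψ x (∇ (fun y => m y t) x)) - ∫ x, fderiv ℝ Ψ x (F t x) := by
    rw [← h.integral_mul_deriv hΨ1 hΨc ht]
    simp only [hΨ, mul_assoc]
  have e2 : ∫ x, fderiv ℝ Ψ x (∇ (fun y => m y t) x)
      = -(∫ x, β (m x t) * Laplacian.laplacian ψ x)
        + ∫ x, ψ x * (β₂ (m x t) * ‖∇ (fun y => m y t) x‖ ^ 2) := by
    simp_rw [dΨ, real_inner_self_eq_norm_sq]
    rw [integral_add (ig _ hg.continuous) iG, ← integral_fderiv_gradient hψ hb0 hc]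
    congr 1
    refine integral_congr_ae (ae_of_all _ fun x => ?_)
    simp only
    rw [gradient_comp (hβ.hasDerivAt (m x t)) (hm.differentiable two_ne_zero x), map_smul,
      smul_eq_mul]
  have e3 : ∫ x, fderiv ℝ Ψ x (F t x) = (∫ x, β₁ (m x t) * fderiv ℝ ψ x (F t x))
      + ∫ x, ψ x * (β₂ (m x t) * inner ℝ (∇ (fun y => m y t) x) (F t x)) := by
    simp_rw [dΨ]
    rw [integral_add (ig _ hF.continuous) iF]
  have m0 (x : Space d) := h.nonneg x t ht
  have hx3 (x : Space d) : (1 + ‖x‖) * ‖x‖ ≤ 2 * weight x := by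
    rw [weight]
    nlinarith [sq_nonneg (‖x‖ - 1)]
  have hB0 : 0 ≤ B := (hβ.fst_nonneg 0 le_rfl).trans (hβ.fst_le 0 le_rfl)
  have l1 : ∫ x, β (m x t) * Laplacian.laplacian ψ x
      ≤ B * c * (4 + 2 * d) * ∫ x, m x t * weight x := by
    rw [← integral_const_mul]
    refine integral_mono iL (hw.const_mul _) fun x => ?_
    calc β (m x t) * Laplacian.laplacian ψ x ≤ β (m x t) * |Laplacian.laplacian ψ x| :=
          mul_le_mul_of_nonneg_left (le_abs_self _) (hβ.nonneg _ (m0 x))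
      _ ≤ (B * m x t) * ((4 + 2 * d) * c * weight x) := by
          have := m0 x
          exact mul_le_mul (hβ.le _ (m0 x)) (hψ2 x) (abs_nonneg _) (by positivity)
      _ = _ := by ring
  have l2 : -(∫ x, β₁ (m x t) * fderiv ℝ ψ x (F t x))
      ≤ B * c * (4 * K) * ∫ x, m x t * weight x := by
    rw [← integral_neg, ← integral_const_mul]
    refine integral_mono (ig _ hF.continuous).neg (hw.const_mul _) fun x => ?_
    have hm0 := m0 x
    calc -(β₁ (m x t) * fderiv ℝ ψ x (F t x)) = β₁ (m x t) * -fderiv ℝ ψ x (F t x) := by ring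
      _ ≤ β₁ (m x t) * (2 * c * ‖x‖ * (K * (1 + ‖x‖) * m x t)) := by
          refine mul_le_mul_of_nonneg_left ?_ (hβ.fst_nonneg _ hm0)
          rw [← inner_gradient_left]
          refine (neg_le_abs _).trans ((abs_real_inner_le_norm _ _).trans ?_)
          exact mul_le_mul (hψ1 x) (h.norm_flux_le x t ht) (norm_nonneg _) (by positivity)
      _ ≤ B * (2 * c * ‖x‖ * (K * (1 + ‖x‖) * m x t)) := by
          refine mul_le_mul_of_nonneg_right (hβ.fst_le _ hm0) (by positivity)
      _ = 2 * B * c * K * m x t * ((1 + ‖x‖) * ‖x‖) := by ring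
      _ ≤ 2 * B * c * K * m x t * (2 * weight x) :=
          mul_le_mul_of_nonneg_left (hx3 x) (by positivity)
      _ = _ := by ring
  -- the flux term uses half of the energy
  have l3 : -(∫ x, ψ x * (β₂ (m x t) * inner ℝ (∇ (fun y => m y t) x) (F t x)))
      ≤ 1 / 2 * (∫ x, ψ x * (β₂ (m x t) * ‖∇ (fun y => m y t) x‖ ^ 2))
        + K ^ 2 * ∫ x, ψ x * (β₂ (m x t) * m x t ^ 2 * weight x) := by
    rw [← integral_neg, ← integral_const_mul, ← integral_const_mul,
      ← integral_add (iG.const_mul _) (iW.const_mul _)]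
    refine integral_mono iF.neg ((iG.const_mul _).add (iW.const_mul _)) fun x => ?_
    have hm0 := m0 x
    have hin : -inner ℝ (∇ (fun y => m y t) x) (F t x)
        ≤ 1 / 2 * ‖∇ (fun y => m y t) x‖ ^ 2 + K ^ 2 * (m x t ^ 2 * weight x) := by
      have a1 := (neg_le_abs _).trans
        (abs_real_inner_le_norm (∇ (fun y => m y t) x) (F t x))
      have a2 : ‖F t x‖ ^ 2 ≤ (K * (1 + ‖x‖) * m x t) ^ 2 := by
        gcongr
        exact h.norm_flux_le x t ht
      have a3 : (1 + ‖x‖) ^ 2 ≤ 2 * weight x := by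
        rw [weight]
        nlinarith [sq_nonneg (‖x‖ - 1)]
      have a4 : (K * (1 + ‖x‖) * m x t) ^ 2 ≤ 2 * (K ^ 2 * (m x t ^ 2 * weight x)) := by
        calc _ = K ^ 2 * m x t ^ 2 * (1 + ‖x‖) ^ 2 := by ring
          _ ≤ K ^ 2 * m x t ^ 2 * (2 * weight x) := by gcongr
          _ = _ := by ring
      nlinarith [sq_nonneg (‖∇ (fun y => m y t) x‖ - ‖F t x‖)]
    have hψβ : 0 ≤ ψ x * β₂ (m x t) := mul_nonneg (hψ0 x) (hβ.snd_nonneg _)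
    have := mul_le_mul_of_nonneg_left hin hψβ
    calc -(ψ x * (β₂ (m x t) * inner ℝ (∇ (fun y => m y t) x) (F t x)))
        = ψ x * β₂ (m x t) * -inner ℝ (∇ (fun y => m y t) x) (F t x) := by ring
      _ ≤ _ := this
      _ = _ := by ring
  rw [e1, e2, e3]
  linarith

/-- The time-integrated energy inequality. The terms in which the localization `ψ` is
differentiated are of order `c` and contain the only constant `B` that degenerates with the
truncation. -/
theorem IsFluxSolution.energy_le (hT : 0 ≤ T) (hK : 0 ≤ K) (h : IsFluxSolution T K m₀ m F)
    (hβ : IsEntropy β β₁ β₂ B) {ψ : Space d → ℝ} (hψ : ContDiff ℝ 2 ψ) (hc : HasCompactSupport ψ)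
    (hψ0 : ∀ x, 0 ≤ ψ x) {c : ℝ} (hc0 : 0 ≤ c) (hψ1 : ∀ x, ‖∇ ψ x‖ ≤ 2 * c * ‖x‖)
    (hψ2 : ∀ x, |Laplacian.laplacian ψ x| ≤ (4 + 2 * d) * c * weight x) {M : ℝ}
    (hw : ∀ t ∈ Icc 0 T,
      Integrable (fun x => m x t * weight x) ∧ ∫ x, m x t * weight x ≤ M) :
    1 / 2 * ∫ t in 0..T, ∫ x, ψ x * (β₂ (m x t) * ‖∇ (fun y => m y t) x‖ ^ 2)
      ≤ (∫ x, ψ x * β (m₀ x))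
        + K ^ 2 * (∫ t in 0..T, ∫ x, ψ x * (β₂ (m x t) * m x t ^ 2 * weight x))
        + T * (B * c * (4 + 2 * d + 4 * K) * M) := by
  have hB0 : 0 ≤ B := (hβ.fst_nonneg 0 le_rfl).trans (hβ.fst_le 0 le_rfl)
  have cm := h.regular.continuous
  have cψ : ContinuousOn (fun z : Space d × ℝ => ψ z.1) (univ ×ˢ Icc 0 T) :=
    (hψ.continuous.comp continuous_fst).continuousOn
  have cw : ContinuousOn (fun z : Space d × ℝ => weight z.1) (univ ×ˢ Icc 0 T) :=
    ((contDiff_weight (n := 0)).continuous.comp continuous_fst).continuousOn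
  have cb2 := hβ.continuous_snd.comp_continuousOn cm
  have cb1 := hβ.contDiff_fst.continuous.comp_continuousOn cm
  have c1 : ContinuousOn (fun z : Space d × ℝ => ψ z.1 * (β₁ (m z.1 z.2)
      * derivWithin (m z.1) (Icc 0 T) z.2)) (univ ×ˢ Icc 0 T) :=
    cψ.mul (cb1.mul h.regular.continuous_time)
  have hK' : IsCompact (tsupport ψ) := hc
  have cI {f : Space d → ℝ → ℝ}
      (hf : ContinuousOn (fun z : Space d × ℝ => f z.1 z.2) (univ ×ˢ Icc 0 T)) :
      IntervalIntegrable (fun t => ∫ x, ψ x * f x t) volume 0 T :=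
    (continuousOn_integral_strip hK' (f := fun x t => ψ x * f x t) (cψ.mul hf) fun x hx s _ => by
      rw [image_eq_zero_of_notMem_tsupport hx, zero_mul]).intervalIntegrable_of_Icc hT
  have i1 := cI (f := fun x t => β₁ (m x t) * derivWithin (m x) (Icc 0 T) t)
    (cb1.mul h.regular.continuous_time)
  have i2 := cI (f := fun x t => β₂ (m x t) * ‖∇ (fun y => m y t) x‖ ^ 2)
    (cb2.mul (h.regular.continuous_gradient.norm.pow 2))
  have i3 := cI (f := fun x t => β₂ (m x t) * m x t ^ 2 * weight x)
    ((cb2.mul (cm.pow 2)).mul cw)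
  have hFTC := integral_sub_eq_integral_deriv
    (f := fun x t => ψ x * β (m x t))
    (f' := fun x t => ψ x * (β₁ (m x t) * derivWithin (m x) (Icc 0 T) t)) hT hK'
    (fun x s hs => ((hβ.hasDerivAt (m x s)).comp_hasDerivWithinAt s
      (h.regular.hasDerivWithinAt x hs)).const_mul (ψ x)) c1 fun x hx s => by
      rw [image_eq_zero_of_notMem_tsupport hx, zero_mul]
  have h0 : (0 : ℝ) ∈ Icc 0 T := ⟨le_rfl, hT⟩
  have hT' : T ∈ Icc 0 T := ⟨hT, le_rfl⟩
  have ib {t : ℝ} (ht : t ∈ Icc 0 T) : Integrable fun x => ψ x * β (m x t) :=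
    (hψ.continuous.mul (hβ.contDiff.continuous.comp
      (h.regular.contDiff_space t ht).continuous)).integrable_of_hasCompactSupport hc.mul_right
  rw [integral_sub (ib hT') (ib h0)] at hFTC
  simp_rw [h.initial] at hFTC
  have hfin : 0 ≤ ∫ x, ψ x * β (m x T) :=
    integral_nonneg fun x => mul_nonneg (hψ0 x) (hβ.nonneg _ (h.nonneg x T hT'))
  have hle : ∫ t in 0..T, ∫ x, ψ x * (β₁ (m x t) * derivWithin (m x) (Icc 0 T) t)
      ≤ ∫ t in 0..T, (-(1 / 2 * ∫ x, ψ x * (β₂ (m x t) * ‖∇ (fun y => m y t) x‖ ^ 2))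
        + K ^ 2 * (∫ x, ψ x * (β₂ (m x t) * m x t ^ 2 * weight x))
        + B * c * (4 + 2 * d + 4 * K) * M) := by
    refine intervalIntegral.integral_mono_on hT i1
      (((i2.const_mul _).neg.add (i3.const_mul _)).add intervalIntegrable_const) fun t ht => ?_
    refine (h.energy_slice_le hK hβ hψ hc hψ0 hc0 hψ1 hψ2 ht (hw t ht).1).trans ?_
    gcongr
    exact (hw t ht).2
  have hn : IntervalIntegrable
      (fun t => -(1 / 2 * ∫ x, ψ x * (β₂ (m x t) * ‖∇ (fun y => m y t) x‖ ^ 2))) volume 0 T :=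
    (i2.const_mul _).neg
  rw [intervalIntegral.integral_add (hn.add (i3.const_mul _)) intervalIntegrable_const,
    intervalIntegral.integral_add hn (i3.const_mul _), intervalIntegral.integral_neg,
    intervalIntegral.integral_const_mul, intervalIntegral.integral_const_mul,
    intervalIntegral.integral_const] at hle
  simp only [sub_zero, smul_eq_mul] at hle
  linarith

end energy

/-! ### Sobolev inequality and interpolation -/

theorem sobolevExponent_pos (hd : 2 < d) : 0 < sobolevExponent d := by
  have h : (2 : ℝ) < d := mod_cast hd
  unfold sobolevExponent
  have : 0 < (d : ℝ) - 2 := by linarith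
  positivity

theorem two_div_sobolevExponent (hd : 2 < d) :
    2 / sobolevExponent d = ((d : ℝ) - 2) / d := by
  have h : (2 : ℝ) < d := mod_cast hd
  unfold sobolevExponent
  have : (d : ℝ) - 2 ≠ 0 := by linarith
  field_simp

/-- The Gagliardo-Nirenberg-Sobolev inequality for compactly supported `C¹` functions, written
with real integrals. -/
theorem exists_sobolev_constant (hd : 2 < d) : ∃ S > (0 : ℝ), ∀ z : Space d → ℝ, ContDiff ℝ 1 z →
    HasCompactSupport z →
    (∫ x, ‖z x‖ ^ sobolevExponent d) ^ (2 / sobolevExponent d) ≤ S * ∫ x, ‖∇ z x‖ ^ 2 := by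
  set q := sobolevExponent d with hq
  have hq0 : 0 < q := sobolevExponent_pos hd
  have hd2 : (2 : ℝ) < d := mod_cast hd
  set S₀ : NNReal := eLpNormLESNormFDerivOfEqInnerConst (volume : Measure (Space d))
    ((2 : NNReal) : ℝ) with hS₀
  refine ⟨(S₀ : ℝ) ^ 2 + 1, by positivity, fun z hz hzc => ?_⟩
  have hp' : ((q.toNNReal : NNReal) : ℝ)⁻¹
      = ((2 : NNReal) : ℝ)⁻¹ - (Module.finrank ℝ (Space d) : ℝ)⁻¹ := by
    rw [Real.coe_toNNReal _ hq0.le, finrank_euclideanSpace_fin, hq, sobolevExponent]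
    have : (d : ℝ) - 2 ≠ 0 := by linarith
    push_cast
    field_simp
  have h := eLpNorm_le_eLpNorm_fderiv_of_eq_inner (volume : Measure (Space d)) hz hzc
    (p := 2) (p' := q.toNNReal) (by norm_num)
    (by rw [finrank_euclideanSpace_fin]; omega) hp'
  have hzq : MemLp z (q.toNNReal : ℝ≥0∞) := hz.continuous.memLp_of_hasCompactSupport hzc
  have hdz : MemLp (fderiv ℝ z) ((2 : NNReal) : ℝ≥0∞) :=
    (hz.continuous_fderiv one_ne_zero).memLp_of_hasCompactSupport (hzc.fderiv ℝ)
  have hqt : (q.toNNReal : ℝ≥0∞).toReal = q := by simp [hq0.le]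
  rw [hzq.eLpNorm_eq_integral_rpow_norm (by simpa using hq0) (by simp),
    hdz.eLpNorm_eq_integral_rpow_norm (by simp) (by simp), hqt, ← hS₀,
    ← ENNReal.ofReal_coe_nnreal (p := S₀), ← ENNReal.ofReal_mul S₀.coe_nonneg,
    ENNReal.ofReal_le_ofReal_iff (by positivity)] at h
  have e2 : ∫ x, ‖fderiv ℝ z x‖ ^ ((2 : NNReal) : ℝ≥0∞).toReal = ∫ x, ‖∇ z x‖ ^ 2 := by
    simp [norm_gradient]
  rw [e2] at h
  have i0 : 0 ≤ ∫ x, ‖z x‖ ^ q := integral_nonneg fun x => by positivity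
  have i1 : 0 ≤ ∫ x, ‖∇ z x‖ ^ 2 := integral_nonneg fun x => by positivity
  calc (∫ x, ‖z x‖ ^ q) ^ (2 / q) = ((∫ x, ‖z x‖ ^ q) ^ q⁻¹) ^ 2 := by
        rw [← Real.rpow_natCast, ← Real.rpow_mul i0]
        congr 1
        push_cast
        ring
    _ ≤ (S₀ * (∫ x, ‖∇ z x‖ ^ 2) ^ (((2 : NNReal) : ℝ≥0∞).toReal)⁻¹) ^ 2 := by gcongr
    _ = S₀ ^ 2 * ∫ x, ‖∇ z x‖ ^ 2 := by
        rw [mul_pow, ← Real.rpow_natCast (_ ^ _), ← Real.rpow_mul i1]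
        norm_num
    _ ≤ _ := by gcongr; linarith

/-- Hölder's inequality for non-negative integrable functions, in the form `∫ A^e B^(1-e)`. -/
theorem integral_rpow_mul_rpow_le {A B : Space d → ℝ} (hA : Integrable A) (hB : Integrable B)
    (hA0 : ∀ x, 0 ≤ A x) (hB0 : ∀ x, 0 ≤ B x) {e : ℝ} (he0 : 0 < e) (he1 : e < 1) :
    Integrable (fun x => A x ^ e * B x ^ (1 - e)) ∧
      ∫ x, A x ^ e * B x ^ (1 - e) ≤ (∫ x, A x) ^ e * (∫ x, B x) ^ (1 - e) := by
  have h1e : 0 < 1 - e := by linarith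
  have hpq : (1 / e).HolderConjugate (1 / (1 - e)) := by
    rw [Real.holderConjugate_iff]
    exact ⟨by rw [lt_div_iff₀ he0]; linarith, by simp⟩
  have mem {f : Space d → ℝ} (hf : Integrable f) (hf0 : ∀ x, 0 ≤ f x) {r : ℝ} (hr : 0 < r) :
      MemLp (fun x => f x ^ r) (ENNReal.ofReal (1 / r)) := by
    have hr' : 0 < 1 / r := by positivity
    have hm : AEStronglyMeasurable (fun x => f x ^ r) volume :=
      (hf.1.aemeasurable.pow_const r).aestronglyMeasurable
    rw [← integrable_norm_rpow_iff hm (by simpa using hr) ENNReal.ofReal_ne_top,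
      ENNReal.toReal_ofReal hr'.le]
    refine hf.congr (ae_of_all _ fun x => ?_)
    simp only
    rw [Real.norm_of_nonneg (Real.rpow_nonneg (hf0 x) _), ← Real.rpow_mul (hf0 x),
      mul_one_div_cancel hr.ne', Real.rpow_one]
  have mA := mem hA hA0 he0
  have mB := mem hB hB0 h1e
  have pw {f : Space d → ℝ} (hf0 : ∀ x, 0 ≤ f x) {r : ℝ} (hr : 0 < r) :
      ∫ x, (f x ^ r) ^ (1 / r) = ∫ x, f x := by
    refine integral_congr_ae (ae_of_all _ fun x => ?_)
    simp only
    rw [← Real.rpow_mul (hf0 x), mul_one_div_cancel hr.ne', Real.rpow_one]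
  constructor
  · have := hpq.ennrealOfReal
    exact mA.integrable_mul mB
  · have := integral_mul_le_Lp_mul_Lq_of_nonneg hpq
      (ae_of_all _ fun x => Real.rpow_nonneg (hA0 x) e)
      (ae_of_all _ fun x => Real.rpow_nonneg (hB0 x) (1 - e)) mA mB
    rwa [pw hA0 he0, pw hB0 h1e, one_div_one_div, one_div_one_div] at this

/-- Young's inequality for a sublinear power. -/
theorem exists_rpow_le_add {C δ e : ℝ} (hC : 0 ≤ C) (hδ : 0 < δ) (he0 : 0 < e) (he1 : e < 1) :
    ∃ D ≥ (0 : ℝ), ∀ Y ≥ (0 : ℝ), C * Y ^ e ≤ δ * Y + D := by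
  have h1e : 0 < 1 - e := by linarith
  set Y₀ := (C / δ) ^ (1 / (1 - e)) with hY₀
  have hY₀0 : 0 ≤ Y₀ := by positivity
  refine ⟨C * Y₀ ^ e, by positivity, fun Y hY => ?_⟩
  rcases le_total Y Y₀ with h | h
  · have : C * Y ^ e ≤ C * Y₀ ^ e := by gcongr
    nlinarith [mul_nonneg hδ.le hY]
  · rcases hY.lt_or_eq with hYp | hYp
    · have h2 : C / δ ≤ Y ^ (1 - e) := by
        have := Real.rpow_le_rpow hY₀0 h h1e.le
        rwa [hY₀, ← Real.rpow_mul (by positivity), one_div_mul_cancel h1e.ne',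
          Real.rpow_one] at this
      rw [div_le_iff₀ hδ] at h2
      have h3 : Y ^ (1 - e) * Y ^ e = Y := by
        rw [← Real.rpow_add hYp]
        simp
      have h4 := mul_le_mul_of_nonneg_right h2 (by positivity : 0 ≤ Y ^ e)
      have h5 : 0 ≤ C * Y₀ ^ e := by positivity
      nlinarith
    · rw [← hYp, Real.zero_rpow he0.ne']
      simp
      positivity

theorem contDiff_truncPow_comp {a ε : ℝ} (hε : 0 < ε) {f : Space d → ℝ} (hf : ContDiff ℝ 1 f)
    (hf0 : ∀ x, 0 ≤ f x) : ContDiff ℝ 1 fun x => truncPow a ε (f x) := by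
  unfold truncPow
  refine hf.mul (ContDiff.mul ?_ ?_)
  · refine (contDiff_const.add hf).rpow_const_of_ne fun x => ?_
    have := hf0 x
    positivity
  · refine (contDiff_const.add (contDiff_const.mul hf)).rpow_const_of_ne fun x => ?_
    have := hf0 x
    positivity

/-- Pointwise interpolation of the square of the truncated power between the Sobolev exponent and
the density itself. -/
theorem mul_truncPow_sq_le {a ε l : ℝ} (ha : -1 < a) (hε : 0 < ε) (hl0 : 0 < l) (hl1 : l < 1)
    {s c : ℝ} (hs : 0 ≤ s) (hc0 : 0 ≤ c) (hc1 : c ≤ 1) :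
    (c * truncPow a ε s) ^ 2 ≤ (2 ^ |a|) ^ 2 * s
      + (2 ^ |a|) ^ 2 * ((c * truncPow a ε s) ^ (2 * (1 - l)) * s ^ (2 * (a + 1) * l)) := by
  have hΦ0 : 0 ≤ truncPow a ε s := truncPow_nonneg hε hs
  have hz0 : 0 ≤ c * truncPow a ε s := mul_nonneg hc0 hΦ0
  have hzΦ : c * truncPow a ε s ≤ truncPow a ε s := mul_le_of_le_one_left hΦ0 hc1
  have h2 : (1 : ℝ) ≤ 2 ^ |a| := Real.one_le_rpow one_le_two (abs_nonneg a)
  rcases le_total s 1 with h | h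
  · have h1 : c * truncPow a ε s ≤ 2 ^ |a| * s := by
      refine hzΦ.trans ((truncPow_le ha hε hs).trans ?_)
      rw [mul_comm]
      gcongr
      calc (1 + s) ^ a ≤ (1 + s) ^ |a| :=
            Real.rpow_le_rpow_of_exponent_le (by linarith) (le_abs_self a)
        _ ≤ 2 ^ |a| := by
            gcongr
            linarith
    have h3 : 0 ≤ (2 ^ |a|) ^ 2 *
        ((c * truncPow a ε s) ^ (2 * (1 - l)) * s ^ (2 * (a + 1) * l)) := by positivity
    calc (c * truncPow a ε s) ^ 2 ≤ (2 ^ |a| * s) ^ 2 := by gcongr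
      _ = (2 ^ |a|) ^ 2 * (s * s) := by ring
      _ ≤ (2 ^ |a|) ^ 2 * (s * 1) := by gcongr
      _ ≤ _ := by linarith
  · have hs0 : 0 < s := by linarith
    have h1 : c * truncPow a ε s ≤ 2 ^ |a| * s ^ (a + 1) := by
      refine hzΦ.trans ((truncPow_le ha hε hs).trans ?_)
      rw [Real.rpow_add_one hs0.ne', mul_comm s, ← mul_assoc]
      gcongr
      rcases le_total 0 a with ha0 | ha0
      · rw [abs_of_nonneg ha0, ← Real.mul_rpow zero_le_two hs]
        gcongr
        linarith
      · calc (1 + s) ^ a ≤ s ^ a := Real.rpow_le_rpow_of_nonpos hs0 (by linarith) ha0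
          _ ≤ _ := le_mul_of_one_le_left (by positivity) h2
    have e : (c * truncPow a ε s) ^ 2
        = (c * truncPow a ε s) ^ (2 * (1 - l)) * (c * truncPow a ε s) ^ (2 * l) := by
      rw [← Real.rpow_add_of_nonneg hz0 (by nlinarith) (by linarith), ← Real.rpow_natCast]
      congr 1
      push_cast
      ring
    have h3 : (c * truncPow a ε s) ^ (2 * l) ≤ (2 ^ |a|) ^ 2 * s ^ (2 * (a + 1) * l) := by
      calc _ ≤ (2 ^ |a| * s ^ (a + 1)) ^ (2 * l) := by gcongr
        _ = (2 ^ |a|) ^ (2 * l) * s ^ (2 * (a + 1) * l) := by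
            rw [Real.mul_rpow (by positivity) (by positivity), ← Real.rpow_mul hs]
            congr 2
            ring
        _ ≤ (2 ^ |a|) ^ (2 : ℝ) * s ^ (2 * (a + 1) * l) := by
            gcongr
            linarith
        _ = _ := by rw [Real.rpow_two]
    rw [e]
    have h4 : 0 ≤ (c * truncPow a ε s) ^ (2 * (1 - l)) := by positivity
    have h5 := mul_le_mul_of_nonneg_left h3 h4
    have h6 : 0 ≤ (2 ^ |a|) ^ 2 * s := by positivity
    linarith

/-- The interpolation parameter `l` for which the two Hölder exponents are conjugate. It satisfies
`d (1 - (1 - l) 2 / 2*) ≥ 1`, because `d (1 - 2 / 2*) = 2`; so a moment of order `d` is enough to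
carry the weight. -/
theorem exists_interpolation_parameter (hd : 2 < d) {a : ℝ} (ha : -1 / 2 < a) :
    ∃ l : ℝ, 0 < l ∧ l < 1 ∧ 1 - (1 - l) * (2 / sobolevExponent d) = 2 * (a + 1) * l ∧
      1 ≤ d * (2 * (a + 1) * l) := by
  have hd2 : (2 : ℝ) < d := mod_cast hd
  set q := sobolevExponent d with hq
  have hq0 : 0 < q := sobolevExponent_pos hd
  set κ := 2 / q with hκ
  have hκ' : κ = ((d : ℝ) - 2) / d := two_div_sobolevExponent hd
  have hκ0 : 0 < κ := by positivity
  have hκd : (1 - κ) * d = 2 := by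
    rw [hκ']
    field_simp
    ring
  have hκ1 : κ < 1 := by
    rw [hκ', div_lt_one (by linarith)]
    linarith
  set p := 2 * (a + 1) with hp
  have hp1 : 1 < p := by rw [hp]; linarith
  have hpκ : 0 < p - κ := by linarith
  set l := (1 - κ) / (p - κ) with hl
  have hl0 : 0 < l := div_pos (by linarith) hpκ
  have hl1 : l < 1 := (div_lt_one hpκ).2 (by linarith)
  set e₁ := (1 - l) * κ with he₁
  have he₁0 : 0 < e₁ := mul_pos (by linarith) hκ0
  have he₁1 : e₁ < 1 := by nlinarith
  have he₂ : 1 - e₁ = p * l := by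
    rw [he₁, hl]
    field_simp
    ring
  have hde : 1 ≤ d * (1 - e₁) := by
    have : 1 - κ ≤ 1 - e₁ := by
      rw [he₁]
      nlinarith
    nlinarith
  exact ⟨l, hl0, hl1, he₂, he₂ ▸ hde⟩

/-- Weighted `L²` bound by interpolation between `L^q` and a moment of order `d`, for a function
that satisfies the corresponding pointwise inequality. -/
theorem integral_sq_mul_weight_le {q l r A M : ℝ} (hq : 0 < q) (hl1 : l < 1)
    (hr0 : 0 < r) (hl : 1 - (1 - l) * (2 / q) = r) (hd : d ≠ 0) (hdl : 1 ≤ d * r)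
    (hA : 0 ≤ A) {z f : Space d → ℝ} (hzc : Continuous z) (hzs : HasCompactSupport z)
    (hz0 : ∀ x, 0 ≤ z x) (hf0 : ∀ x, 0 ≤ f x) (hfi : Integrable fun x => f x * weight x ^ d)
    (hfM : ∫ x, f x * weight x ^ d ≤ M)
    (hpt : ∀ x, z x ^ 2 ≤ A * f x + A * (z x ^ (2 * (1 - l)) * f x ^ r)) :
    ∫ x, z x ^ 2 * weight x
      ≤ A * M + A * M ^ r * ((∫ x, ‖z x‖ ^ q) ^ (2 / q)) ^ (1 - l) := by
  obtain ⟨e, he⟩ : ∃ e, e = (1 - l) * (2 / q) := ⟨_, rfl⟩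
  have he0 : 0 < e := by
    rw [he]
    have : 0 < 1 - l := by linarith
    positivity
  have he1 : e < 1 := by linarith
  have her : 1 - e = r := by rw [he, hl]
  have hwc : Continuous (weight (d := d)) := (contDiff_weight (n := 0)).continuous
  have hsuppq : HasCompactSupport fun x => ‖z x‖ ^ q :=
    HasCompactSupport.intro hzs.isCompact fun x hx => by
      simp [image_eq_zero_of_notMem_tsupport hx, hq.ne']
  have izq : Integrable fun x => ‖z x‖ ^ q :=
    (hzc.norm.rpow_const fun x => Or.inr hq.le).integrable_of_hasCompactSupport hsuppq
  have hsupp : HasCompactSupport fun x => z x ^ 2 * weight x :=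
    HasCompactSupport.intro hzs.isCompact fun x hx => by
      simp [image_eq_zero_of_notMem_tsupport hx]
  have iz : Integrable fun x => z x ^ 2 * weight x :=
    ((hzc.pow 2).mul hwc).integrable_of_hasCompactSupport hsupp
  have hB0 (x : Space d) : 0 ≤ f x * weight x ^ d :=
    mul_nonneg (hf0 x) (pow_nonneg (weight_pos x).le _)
  have hA0 (x : Space d) : 0 ≤ ‖z x‖ ^ q := Real.rpow_nonneg (norm_nonneg _) _
  obtain ⟨iH, hH⟩ := integral_rpow_mul_rpow_le izq hfi hA0 hB0 he0 he1
  rw [her] at iH hH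
  have hpt' (x : Space d) : z x ^ 2 * weight x ≤ A * (f x * weight x ^ d)
      + A * ((‖z x‖ ^ q) ^ e * (f x * weight x ^ d) ^ r) := by
    have hw1 := one_le_weight x
    have hw0 := weight_pos x
    have hfx := hf0 x
    have h2 := mul_le_mul_of_nonneg_right (hpt x) hw0.le
    have h3 : (‖z x‖ ^ q) ^ e = z x ^ (2 * (1 - l)) := by
      rw [Real.norm_of_nonneg (hz0 x), ← Real.rpow_mul (hz0 x), he]
      congr 1
      field_simp
    have h4 : weight x ≤ (weight x ^ d) ^ r := by
      rw [← Real.rpow_natCast, ← Real.rpow_mul hw0.le]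
      exact Real.self_le_rpow_of_one_le hw1 hdl
    have h5 : weight x ≤ weight x ^ d := le_self_pow₀ hw1 hd
    rw [h3, Real.mul_rpow hfx (by positivity)]
    have hzr : 0 ≤ z x ^ (2 * (1 - l)) := Real.rpow_nonneg (hz0 x) _
    have hfr : 0 ≤ f x ^ r := Real.rpow_nonneg hfx _
    have h6 := mul_le_mul_of_nonneg_left h5 (mul_nonneg hA hfx)
    have h7 := mul_le_mul_of_nonneg_left h4 (mul_nonneg hA (mul_nonneg hzr hfr))
    linarith
  have i0 : 0 ≤ ∫ x, ‖z x‖ ^ q := integral_nonneg hA0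
  have hm0 : 0 ≤ ∫ x, f x * weight x ^ d := integral_nonneg hB0
  have hYe : (∫ x, ‖z x‖ ^ q) ^ e = ((∫ x, ‖z x‖ ^ q) ^ (2 / q)) ^ (1 - l) := by
    rw [← Real.rpow_mul i0, he, mul_comm]
  have hY0 : 0 ≤ (∫ x, ‖z x‖ ^ q) ^ e := Real.rpow_nonneg i0 _
  have hMr := mul_le_mul_of_nonneg_left (Real.rpow_le_rpow hm0 hfM hr0.le) hY0
  have h1 : ∫ x, z x ^ 2 * weight x ≤ ∫ x, (A * (f x * weight x ^ d)
        + A * ((‖z x‖ ^ q) ^ e * (f x * weight x ^ d) ^ r)) :=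
    integral_mono iz ((hfi.const_mul _).add (iH.const_mul _)) hpt'
  rw [integral_add (hfi.const_mul _) (iH.const_mul _), integral_const_mul,
    integral_const_mul] at h1
  have h2 := mul_le_mul_of_nonneg_left hfM hA
  have h3 := mul_le_mul_of_nonneg_left (hH.trans hMr) hA
  rw [← hYe]
  linarith

/-! ### The estimate for the localized truncated powers -/

/-- The Sobolev inequality for the localized truncated power of a density with finite second
moment. -/
theorem exists_sobolev_truncPow_le (hd : 2 < d) {a : ℝ} (ha : -1 < a) :
    ∃ S > (0 : ℝ), ∀ ε, 0 < ε → ε ≤ 1 → ∃ D ≥ (0 : ℝ), ∀ R ≥ (1 : ℝ), ∀ f : Space d → ℝ,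
      ContDiff ℝ 1 f → (∀ x, 0 ≤ f x) → Integrable (fun x => f x * weight x) →
      (∫ x, ‖spaceCutoff R x * truncPow a ε (f x)‖ ^ sobolevExponent d) ^ (2 / sobolevExponent d)
        ≤ S * (∫ x, spaceCutoff R x ^ 2 * (truncPowDeriv a ε (f x) ^ 2 * ‖∇ f x‖ ^ 2))
          + D / R * ∫ x, f x * weight x := by
  obtain ⟨S, hS, hsob⟩ := exists_sobolev_constant hd
  obtain ⟨C, hC, hcut⟩ := exists_bound_deriv_cutoff
  refine ⟨S * 2, by positivity, fun ε hε hε1 =>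
    ⟨S * (8 * C ^ 2 * (ε ^ (-(a + 1))) ^ 2), by positivity, fun R hR f hf hf0 hfw => ?_⟩⟩
  have hR0 : 0 < R := zero_lt_one.trans_le hR
  have hχ : ContDiff ℝ 1 (spaceCutoff (d := d) R) := contDiff_spaceCutoff R (n := 1)
  have hχc : HasCompactSupport (spaceCutoff (d := d) R) := hasCompactSupport_spaceCutoff hR0
  have hΦ := contDiff_truncPow_comp (a := a) hε hf hf0
  have hz : ContDiff ℝ 1 fun x => spaceCutoff R x * truncPow a ε (f x) := hχ.mul hΦ
  have hzc : HasCompactSupport fun x => spaceCutoff R x * truncPow a ε (f x) := hχc.mul_right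
  have hdχ (x : Space d) : ‖∇ (spaceCutoff R) x‖ ≤ 2 * (C / R) * ‖x‖ :=
    norm_gradient_radial_le (contDiff_cutoff R (n := 2)) (fun s => (hcut R hR s).1) x
  have hgrad (x : Space d) : ∇ (fun x => spaceCutoff R x * truncPow a ε (f x)) x
      = (spaceCutoff R x * truncPowDeriv a ε (f x)) • ∇ f x
        + truncPow a ε (f x) • ∇ (spaceCutoff R) x := by
    have h1 := (hχ.differentiable one_ne_zero x).hasGradientAt
    have h2 := (hΦ.differentiable one_ne_zero x).hasGradientAt
    rw [gradient_comp (hasDerivAt_truncPow hε (hf0 x)) (hf.differentiable one_ne_zero x)] at h2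
    refine HasGradientAt.gradient (hasGradientAt_iff_hasFDerivAt.2 ?_)
    refine (h1.hasFDerivAt.mul h2.hasFDerivAt).congr_fderiv ?_
    ext v
    simp
    ring
  have hpt (x : Space d) : ‖∇ (fun x => spaceCutoff R x * truncPow a ε (f x)) x‖ ^ 2
      ≤ 2 * (spaceCutoff R x ^ 2 * (truncPowDeriv a ε (f x) ^ 2 * ‖∇ f x‖ ^ 2))
        + 8 * C ^ 2 * (ε ^ (-(a + 1))) ^ 2 / R * (f x * weight x) := by
    rw [hgrad]
    have h1 : ‖(spaceCutoff R x * truncPowDeriv a ε (f x)) • ∇ f x‖ ^ 2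
        = spaceCutoff R x ^ 2 * (truncPowDeriv a ε (f x) ^ 2 * ‖∇ f x‖ ^ 2) := by
      rw [norm_smul, mul_pow, Real.norm_eq_abs, sq_abs]
      ring
    have h2 : ‖truncPow a ε (f x) • ∇ (spaceCutoff R) x‖ ^ 2
        ≤ 4 * C ^ 2 * (ε ^ (-(a + 1))) ^ 2 / R * (f x * weight x) := by
      have hx2 : ‖x‖ ^ 2 ≤ weight x := by unfold weight; linarith
      have hRi : (1 / R) ^ 2 ≤ 1 / R := by
        have : 1 / R ≤ 1 := (div_le_one hR0).2 hR
        have : 0 ≤ 1 / R := by positivity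
        nlinarith
      have hfx := hf0 x
      calc _ = truncPow a ε (f x) ^ 2 * ‖∇ (spaceCutoff R) x‖ ^ 2 := by
            rw [norm_smul, mul_pow, Real.norm_eq_abs, sq_abs]
        _ ≤ ((ε ^ (-(a + 1))) ^ 2 * f x) * (2 * (C / R) * ‖x‖) ^ 2 := by
            gcongr
            · exact truncPow_sq_le ha hε hε1 hfx
            · exact hdχ x
        _ = 4 * C ^ 2 * (ε ^ (-(a + 1))) ^ 2 * f x * ((1 / R) ^ 2 * ‖x‖ ^ 2) := by ring
        _ ≤ 4 * C ^ 2 * (ε ^ (-(a + 1))) ^ 2 * f x * (1 / R * weight x) := by gcongr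
        _ = _ := by ring
    have h3 := norm_add_le ((spaceCutoff R x * truncPowDeriv a ε (f x)) • ∇ f x)
      (truncPow a ε (f x) • ∇ (spaceCutoff R) x)
    have h4 := pow_le_pow_left₀ (norm_nonneg _) h3 2
    have h5 := sq_nonneg (‖(spaceCutoff R x * truncPowDeriv a ε (f x)) • ∇ f x‖
      - ‖truncPow a ε (f x) • ∇ (spaceCutoff R) x‖)
    have h6 : 8 * C ^ 2 * (ε ^ (-(a + 1))) ^ 2 / R * (f x * weight x)
        = 2 * (4 * C ^ 2 * (ε ^ (-(a + 1))) ^ 2 / R * (f x * weight x)) := by ring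
    rw [h6, ← h1]
    linarith
  have hθ : Continuous fun x => truncPowDeriv a ε (f x) := by
    have := (continuous_truncPowDeriv_abs (a := a) hε).comp hf.continuous
    simpa only [Function.comp_def, abs_of_nonneg (hf0 _)] using this
  have hgc : Continuous (∇ f) :=
    (InnerProductSpace.toDual ℝ (Space d)).symm.continuous.comp
      (hf.continuous_fderiv one_ne_zero)
  have hs1 : HasCompactSupport fun x =>
      spaceCutoff R x ^ 2 * (truncPowDeriv a ε (f x) ^ 2 * ‖∇ f x‖ ^ 2) :=
    HasCompactSupport.intro hχc.isCompact fun x hx => by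
      simp [image_eq_zero_of_notMem_tsupport hx]
  have i1 : Integrable fun x =>
      spaceCutoff R x ^ 2 * (truncPowDeriv a ε (f x) ^ 2 * ‖∇ f x‖ ^ 2) :=
    ((hχ.continuous.pow 2).mul ((hθ.pow 2).mul
      (hgc.norm.pow 2))).integrable_of_hasCompactSupport hs1
  refine (hsob _ hz hzc).trans ?_
  have h : ∫ x, ‖∇ (fun x => spaceCutoff R x * truncPow a ε (f x)) x‖ ^ 2 ≤ _ :=
    integral_mono_of_nonneg (ae_of_all _ fun x => sq_nonneg _)
      ((i1.const_mul 2).add (hfw.const_mul (8 * C ^ 2 * (ε ^ (-(a + 1))) ^ 2 / R)))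
      (ae_of_all _ hpt)
  simp only [Pi.add_apply] at h
  rw [integral_add (i1.const_mul _) (hfw.const_mul _), integral_const_mul,
    integral_const_mul] at h
  have := mul_le_mul_of_nonneg_left h hS.le
  refine this.trans_eq ?_
  ring

theorem IsC21.contDiff_one {T : ℝ} {f : Space d → ℝ → ℝ} (hf : IsC21 T f) {t : ℝ}
    (ht : t ∈ Icc 0 T) : ContDiff ℝ 1 fun x => f x t :=
  (hf.contDiff_space t ht).of_le (by norm_num)

theorem continuousOn_truncPow {a ε : ℝ} (hε : 0 < ε) : ContinuousOn (truncPow a ε) (Ici 0) :=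
  fun _ hs => (hasDerivAt_truncPow hε hs).continuousAt.continuousWithinAt

/-- Bound of the truncated powers of the density in `L²(0,T; L^{2*})`, localized to a ball of
radius of order `√R`. The leading constant depends neither on the solution nor on the
truncation. -/
theorem exists_integral_truncPow_le (hd : 2 < d) {T K a : ℝ} (hT : 0 ≤ T) (hK : 0 ≤ K)
    (ha : -1 / 2 < a) {m₀ : Space d → ℝ} (hm₀ : Continuous m₀) (hc₀ : HasCompactSupport m₀) :
    ∃ C ≥ (0 : ℝ), ∀ (m : Space d → ℝ → ℝ) (F : ℝ → Space d → Space d),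
      IsFluxSolution T K m₀ m F → ∀ ε, 0 < ε → ε ≤ 1 → ∃ D ≥ (0 : ℝ), ∀ R ≥ (1 : ℝ),
      ContinuousOn (fun t => (∫ x, ‖spaceCutoff R x * truncPow a ε (m x t)‖ ^ sobolevExponent d)
          ^ (2 / sobolevExponent d)) (Icc 0 T) ∧
      ∫ t in 0..T, (∫ x, ‖spaceCutoff R x * truncPow a ε (m x t)‖ ^ sobolevExponent d)
          ^ (2 / sobolevExponent d) ≤ C + D / R := by
  have ha1 : -1 < a := by linarith
  have hq0 : 0 < sobolevExponent d := sobolevExponent_pos hd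
  have hκ0 : 0 < 2 / sobolevExponent d := by positivity
  obtain ⟨S, hS, hsob⟩ := exists_sobolev_truncPow_le hd ha1
  obtain ⟨M, hM, hmom⟩ := exists_moment_bound (T := T) hK hm₀ hc₀ d
  obtain ⟨l, hl0, hl1, hl, hdl⟩ := exists_interpolation_parameter hd ha
  obtain ⟨c, hc, hcut⟩ := exists_bound_deriv_cutoff_sq
  obtain ⟨M₀, hM₀⟩ := hc₀.exists_bound_of_continuous hm₀
  obtain ⟨r, hr⟩ : ∃ r, r = 2 * (a + 1) * l := ⟨_, rfl⟩
  rw [← hr] at hl hdl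
  have hr0 : 0 < r := by
    rw [hr]
    have : 0 < a + 1 := by linarith
    positivity
  obtain ⟨A, hA⟩ : ∃ A, A = ((2 : ℝ) ^ |a|) ^ 2 := ⟨_, rfl⟩
  have hA0 : 0 ≤ A := by rw [hA]; positivity
  obtain ⟨L, hL⟩ : ∃ L, L = (2 * |a| + 2) ^ 2 := ⟨_, rfl⟩
  have hL0 : 0 ≤ L := by rw [hL]; positivity
  obtain ⟨D₀, hD₀, hyoung⟩ := exists_rpow_le_add (C := 2 * S * K ^ 2 * L * (A * M ^ r))
    (δ := 1 / 2) (e := 1 - l) (by positivity) (by norm_num) (by linarith) (by linarith)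
  obtain ⟨L₁, hL₁⟩ : ∃ L₁, L₁ = ((2 * |a| + 2) * (1 + M₀) ^ |a|) ^ 2 * M₀ := ⟨_, rfl⟩
  have hM₀0 : 0 ≤ M₀ := (norm_nonneg _).trans (hM₀ 0)
  have hL₁0 : 0 ≤ L₁ := by rw [hL₁]; positivity
  have I₀0 : 0 ≤ ∫ x, |m₀ x| := integral_nonneg fun x => abs_nonneg _
  refine ⟨2 * (2 * S * (L₁ * ∫ x, |m₀ x|) + T * (2 * S * K ^ 2 * L * (A * M) + D₀)),
    by positivity, fun m F h ε hε hε1 => ?_⟩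
  obtain ⟨D₁, hD₁, hsob⟩ := hsob ε hε hε1
  obtain ⟨β, β₁, β₂, B, hβ, hβ₂, hβ0⟩ := exists_isEntropy ha1 hε hε1
  have hB0 : 0 ≤ B := (hβ.fst_nonneg 0 le_rfl).trans (hβ.fst_le 0 le_rfl)
  refine ⟨2 * (2 * S * (T * (B * c * (4 + 2 * d + 4 * K) * M)) + T * (D₁ * M)),
    by positivity, fun R hR => ?_⟩
  have hR0 : 0 < R := zero_lt_one.trans_le hR
  have hw1 : ∀ t ∈ Icc 0 T,
      Integrable (fun x => m x t * weight x) ∧ ∫ x, m x t * weight x ≤ M := by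
    intro t ht
    obtain ⟨i, hi⟩ := hmom m F h t ht
    have hle (x : Space d) : m x t * weight x ≤ m x t * weight x ^ d :=
      mul_le_mul_of_nonneg_left (le_self_pow₀ (one_le_weight x) (by omega)) (h.nonneg x t ht)
    have hn (x : Space d) : 0 ≤ m x t * weight x :=
      mul_nonneg (h.nonneg x t ht) (weight_pos x).le
    have i1 : Integrable fun x => m x t * weight x := by
      refine i.mono' (((h.regular.contDiff_one ht).continuous.mul
        (contDiff_weight (n := 0)).continuous).aestronglyMeasurable) (ae_of_all _ fun x => ?_)
      rw [Real.norm_of_nonneg (hn x)]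
      exact hle x
    exact ⟨i1, (integral_mono i1 i hle).trans hi⟩
  have hχ : Continuous (spaceCutoff (d := d) R) := (contDiff_spaceCutoff R (n := 0)).continuous
  have hχc : HasCompactSupport (spaceCutoff (d := d) R) := hasCompactSupport_spaceCutoff hR0
  have cm := h.regular.continuous
  have cχ : ContinuousOn (fun z : Space d × ℝ => spaceCutoff R z.1) (univ ×ˢ Icc 0 T) :=
    (hχ.comp continuous_fst).continuousOn
  have cw : ContinuousOn (fun z : Space d × ℝ => weight z.1) (univ ×ˢ Icc 0 T) :=
    ((contDiff_weight (n := 0)).continuous.comp continuous_fst).continuousOn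
  have cz : ContinuousOn (fun z : Space d × ℝ => spaceCutoff R z.1 * truncPow a ε (m z.1 z.2))
      (univ ×ˢ Icc 0 T) :=
    cχ.mul ((continuousOn_truncPow hε).comp cm fun z hz => h.nonneg z.1 z.2 hz.2)
  have hsupp {x : Space d} (hx : x ∉ tsupport (spaceCutoff (d := d) R)) : spaceCutoff R x = 0 :=
    image_eq_zero_of_notMem_tsupport hx
  obtain ⟨Y, hY⟩ : ∃ Y : ℝ → ℝ, Y = fun t =>
    (∫ x, ‖spaceCutoff R x * truncPow a ε (m x t)‖ ^ sobolevExponent d)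
      ^ (2 / sobolevExponent d) := ⟨_, rfl⟩
  obtain ⟨J, hJ⟩ : ∃ J : ℝ → ℝ, J = fun t =>
    ∫ x, (spaceCutoff R x * truncPow a ε (m x t)) ^ 2 * weight x := ⟨_, rfl⟩
  obtain ⟨X, hX⟩ : ∃ X : ℝ → ℝ, X = fun t =>
    ∫ x, spaceCutoff R x ^ 2 * (β₂ (m x t) * ‖∇ (fun y => m y t) x‖ ^ 2) := ⟨_, rfl⟩
  obtain ⟨W, hW⟩ : ∃ W : ℝ → ℝ, W = fun t =>
    ∫ x, spaceCutoff R x ^ 2 * (β₂ (m x t) * m x t ^ 2 * weight x) := ⟨_, rfl⟩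
  have cY : ContinuousOn Y (Icc 0 T) := by
    rw [hY]
    refine ContinuousOn.rpow_const ?_ fun t _ => Or.inr hκ0.le
    refine continuousOn_integral_strip (f := fun x t =>
      ‖spaceCutoff R x * truncPow a ε (m x t)‖ ^ sobolevExponent d) hχc
      (cz.norm.rpow_const fun _ _ => Or.inr hq0.le) fun x hx t _ => ?_
    simp [hsupp hx, hq0.ne']
  have cJ : ContinuousOn J (Icc 0 T) := by
    rw [hJ]
    refine continuousOn_integral_strip (f := fun x t =>
      (spaceCutoff R x * truncPow a ε (m x t)) ^ 2 * weight x) hχc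
      ((cz.pow 2).mul cw) fun x hx t _ => ?_
    simp [hsupp hx]
  have cX : ContinuousOn X (Icc 0 T) := by
    rw [hX]
    refine continuousOn_integral_strip (f := fun x t =>
      spaceCutoff R x ^ 2 * (β₂ (m x t) * ‖∇ (fun y => m y t) x‖ ^ 2)) hχc
      ((cχ.pow 2).mul ((hβ.continuous_snd.comp_continuousOn cm).mul
        (h.regular.continuous_gradient.norm.pow 2))) fun x hx t _ => ?_
    simp [hsupp hx]
  have cW : ContinuousOn W (Icc 0 T) := by
    rw [hW]
    refine continuousOn_integral_strip (f := fun x t =>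
      spaceCutoff R x ^ 2 * (β₂ (m x t) * m x t ^ 2 * weight x)) hχc
      ((cχ.pow 2).mul (((hβ.continuous_snd.comp_continuousOn cm).mul (cm.pow 2)).mul
        cw)) fun x hx t _ => ?_
    simp [hsupp hx]
  have iY : IntervalIntegrable Y volume 0 T := cY.intervalIntegrable_of_Icc hT
  have iX : IntervalIntegrable X volume 0 T := cX.intervalIntegrable_of_Icc hT
  have iW : IntervalIntegrable W volume 0 T := cW.intervalIntegrable_of_Icc hT
  -- the initial entropy is bounded independently of `ε`, since `m₀` is bounded
  have henergy : 1 / 2 * ∫ t in 0..T, X t ≤ L₁ * (∫ x, |m₀ x|) + K ^ 2 * (∫ t in 0..T, W t)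
      + T * (B * (c / R) * (4 + 2 * d + 4 * K) * M) := by
    have := h.energy_le hT hK hβ (ψ := fun x => spaceCutoff R x ^ 2) (c := c / R)
      ((contDiff_spaceCutoff R (n := 2)).pow 2) (HasCompactSupport.intro hχc.isCompact
        fun x hx => by simp [hsupp hx]) (fun x => sq_nonneg _) (by positivity)
      (norm_gradient_radial_le ((contDiff_cutoff R (n := 2)).pow 2) fun s => (hcut R hR s).1)
      (abs_laplacian_radial_le ((contDiff_cutoff R (n := 2)).pow 2)
        (fun s => (hcut R hR s).1) fun s => (hcut R hR s).2) hw1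
    rw [hX, hW]
    refine this.trans ?_
    gcongr
    rw [← integral_const_mul]
    refine integral_mono_of_nonneg (ae_of_all _ fun x => ?_)
      (((hm₀.abs.integrable_of_hasCompactSupport hc₀.abs)).const_mul _) (ae_of_all _ fun x => ?_)
    · have : 0 ≤ m₀ x := h.initial x ▸ h.nonneg x 0 ⟨le_rfl, hT⟩
      exact mul_nonneg (sq_nonneg _) (hβ.nonneg _ this)
    · have h0 : 0 ≤ m₀ x := h.initial x ▸ h.nonneg x 0 ⟨le_rfl, hT⟩
      have h1 := hβ0 M₀ (m₀ x) h0 ((le_abs_self _).trans (hM₀ x))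
      have h2 : spaceCutoff R x ^ 2 ≤ 1 :=
        pow_le_one₀ (spaceCutoff_nonneg R x) (spaceCutoff_le_one R x)
      simp only [abs_of_nonneg h0, hL₁]
      exact (mul_le_of_le_one_left (hβ.nonneg _ h0) h2).trans h1
  have hSY : ∀ t ∈ Icc 0 T, Y t ≤ S * X t + D₁ / R * M := by
    intro t ht
    have := hsob R hR (fun x => m x t) (h.regular.contDiff_one ht) (fun x => h.nonneg x t ht)
      (hw1 t ht).1
    rw [hY, hX]
    simp only [hβ₂ _ (h.nonneg _ t ht)]
    refine this.trans ?_
    gcongr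
    exact (hw1 t ht).2
  have hWJ : ∀ t ∈ Icc 0 T, W t ≤ L * J t := by
    intro t ht
    rw [hW, hJ]
    simp only
    rw [← integral_const_mul]
    have cwt : Continuous (weight (d := d)) := (contDiff_weight (n := 0)).continuous
    have cmt := (h.regular.contDiff_one ht).continuous
    have s1 : HasCompactSupport fun x =>
        spaceCutoff R x ^ 2 * (β₂ (m x t) * m x t ^ 2 * weight x) :=
      HasCompactSupport.intro hχc.isCompact fun x hx => by simp [hsupp hx]
    have s2 : HasCompactSupport fun x =>
        L * ((spaceCutoff R x * truncPow a ε (m x t)) ^ 2 * weight x) :=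
      HasCompactSupport.intro hχc.isCompact fun x hx => by simp [hsupp hx]
    have czt : Continuous fun x => spaceCutoff R x * truncPow a ε (m x t) :=
      continuous_slice cz ht
    refine integral_mono (((hχ.pow 2).mul (((hβ.continuous_snd.comp cmt).mul
      (cmt.pow 2)).mul cwt)).integrable_of_hasCompactSupport s1)
      ((continuous_const.mul ((czt.pow 2).mul cwt)).integrable_of_hasCompactSupport s2)
      fun x => ?_
    have h1 := sq_truncPowDeriv_mul_sq_le ha1 hε (h.nonneg x t ht)
    rw [← hβ₂ _ (h.nonneg x t ht), ← hL] at h1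
    have h2 := mul_le_mul_of_nonneg_left h1
      (mul_nonneg (sq_nonneg (spaceCutoff R x)) (weight_pos x).le)
    simp only
    linarith
  have hJY : ∀ t ∈ Icc 0 T, J t ≤ A * M + A * M ^ r * Y t ^ (1 - l) := by
    intro t ht
    have hz0 (x : Space d) : 0 ≤ spaceCutoff R x * truncPow a ε (m x t) :=
      mul_nonneg (spaceCutoff_nonneg R x) (truncPow_nonneg hε (h.nonneg x t ht))
    have hzs : HasCompactSupport fun x => spaceCutoff R x * truncPow a ε (m x t) :=
      hχc.mul_right
    have hpt (x : Space d) := mul_truncPow_sq_le ha1 hε hl0 hl1 (h.nonneg x t ht)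
      (spaceCutoff_nonneg R x) (spaceCutoff_le_one R x)
    rw [← hA, ← hr] at hpt
    rw [hJ, hY]
    exact integral_sq_mul_weight_le hq0 hl1 hr0 hl (by omega) hdl hA0
      (continuous_slice cz ht) hzs hz0 (fun x => h.nonneg x t ht) (hmom m F h t ht).1
      (hmom m F h t ht).2 hpt
  have hY0 : ∀ t, 0 ≤ Y t := fun t => by
    rw [hY]
    exact Real.rpow_nonneg (integral_nonneg fun x => Real.rpow_nonneg (norm_nonneg _) _) _
  -- the interpolation is absorbed in half of the integral of `Y`
  have hWY : 2 * S * K ^ 2 * ∫ t in 0..T, W t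
      ≤ 1 / 2 * (∫ t in 0..T, Y t) + T * (2 * S * K ^ 2 * L * (A * M) + D₀) := by
    rw [← intervalIntegral.integral_const_mul, ← intervalIntegral.integral_const_mul]
    have : T * (2 * S * K ^ 2 * L * (A * M) + D₀)
        = ∫ t in 0..T, (2 * S * K ^ 2 * L * (A * M) + D₀) := by
      rw [intervalIntegral.integral_const, sub_zero, smul_eq_mul]
    rw [this, ← intervalIntegral.integral_add (iY.const_mul _) intervalIntegrable_const]
    refine intervalIntegral.integral_mono_on hT (iW.const_mul _)
      ((iY.const_mul _).add intervalIntegrable_const) fun t ht => ?_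
    have h1 := mul_le_mul_of_nonneg_left ((hWJ t ht).trans
      (mul_le_mul_of_nonneg_left (hJY t ht) hL0)) (by positivity : 0 ≤ 2 * S * K ^ 2)
    have h2 := hyoung (Y t) (hY0 t)
    linarith
  have hXY : ∫ t in 0..T, Y t ≤ S * (∫ t in 0..T, X t) + T * (D₁ / R * M) := by
    rw [← intervalIntegral.integral_const_mul]
    have : T * (D₁ / R * M) = ∫ t in 0..T, D₁ / R * M := by
      rw [intervalIntegral.integral_const, sub_zero, smul_eq_mul]
    rw [this, ← intervalIntegral.integral_add (iX.const_mul _) intervalIntegrable_const]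
    exact intervalIntegral.integral_mono_on hT iY ((iX.const_mul _).add intervalIntegrable_const)
      hSY
  have hfinal : ∫ t in 0..T, Y t
      ≤ 2 * (2 * S * (L₁ * ∫ x, |m₀ x|) + T * (2 * S * K ^ 2 * L * (A * M) + D₀))
        + 2 * (2 * S * (T * (B * c * (4 + 2 * d + 4 * K) * M)) + T * (D₁ * M)) / R := by
    have h1 := mul_le_mul_of_nonneg_left henergy (by positivity : 0 ≤ 2 * S)
    have e : 2 * (2 * S * (T * (B * c * (4 + 2 * d + 4 * K) * M)) + T * (D₁ * M)) / R
        = 2 * (2 * S * (T * (B * (c / R) * (4 + 2 * d + 4 * K) * M)) + T * (D₁ / R * M)) := by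
      ring
    rw [e]
    linarith
  rw [hY] at cY hfinal
  exact ⟨cY, hfinal⟩

/-! ### Passage to the limit -/

theorem tendsto_truncPow (a : ℝ) (s : ℝ) {ε : ℕ → ℝ} (hε : Tendsto ε atTop (𝓝 0)) :
    Tendsto (fun n => truncPow a (ε n) s) atTop (𝓝 (s * (1 + s) ^ a)) := by
  have h1 : Tendsto (fun n => 1 + ε n * s) atTop (𝓝 1) := by
    simpa using (hε.mul_const s).const_add 1
  have h2 := h1.rpow_const (p := -(a + 1)) (Or.inl one_ne_zero)
  rw [Real.one_rpow] at h2
  simpa [truncPow] using (h2.const_mul ((1 + s) ^ a)).const_mul s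

theorem tendsto_spaceCutoff {R : ℕ → ℝ} (hR : Tendsto R atTop atTop) (x : Space d) :
    Tendsto (fun n => spaceCutoff (R n) x) atTop (𝓝 1) := by
  refine tendsto_const_nhds.congr' ?_
  filter_upwards [hR.eventually_ge_atTop (weight x)] with n hn
  exact (spaceCutoff_eq_one ((weight_pos x).trans_le hn) hn).symm

/-- The power of the density in the final estimate is controlled by the density where it is small
and by the limit of the truncated powers where it is large. -/
theorem rpow_le_add_rpow {a q s : ℝ} (hq : 0 < q) (h1 : 1 ≤ q * (a + 1)) (hs : 0 ≤ s) :
    s ^ (q * (a + 1)) ≤ s + (2 ^ |a|) ^ q * (s * (1 + s) ^ a) ^ q := by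
  have hw : 0 ≤ s * (1 + s) ^ a := by positivity
  rcases le_total s 1 with h | h
  · have h2 : s ^ (q * (a + 1)) ≤ s := by
      rcases hs.lt_or_eq with h0 | h0
      · simpa using Real.rpow_le_rpow_of_exponent_ge h0 h h1
      · rw [← h0, Real.zero_rpow (by linarith)]
    have h3 : 0 ≤ (2 ^ |a|) ^ q * (s * (1 + s) ^ a) ^ q := by positivity
    linarith
  · have hs0 : 0 < s := by linarith
    have h2 : s ^ (a + 1) ≤ 2 ^ |a| * (s * (1 + s) ^ a) := by
      have h3 : s ^ a ≤ 2 ^ |a| * (1 + s) ^ a := by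
        rcases le_total 0 a with ha | ha
        · calc s ^ a ≤ (1 + s) ^ a := by gcongr; linarith
            _ ≤ _ := le_mul_of_one_le_left (by positivity)
              (Real.one_le_rpow one_le_two (abs_nonneg a))
        · have h4 : (2 * s) ^ a ≤ (1 + s) ^ a :=
            Real.rpow_le_rpow_of_nonpos (by linarith) (by linarith) ha
          rw [Real.mul_rpow zero_le_two hs] at h4
          have h5 : (2 : ℝ) ^ |a| * 2 ^ a = 1 := by
            rw [abs_of_nonpos ha, ← Real.rpow_add two_pos]
            simp
          calc s ^ a = 2 ^ |a| * (2 ^ a * s ^ a) := by rw [← mul_assoc, h5, one_mul]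
            _ ≤ _ := by gcongr
      rw [Real.rpow_add_one hs0.ne']
      have := mul_le_mul_of_nonneg_left h3 hs
      linarith
    calc s ^ (q * (a + 1)) = (s ^ (a + 1)) ^ q := by rw [← Real.rpow_mul hs, mul_comm]
      _ ≤ (2 ^ |a| * (s * (1 + s) ^ a)) ^ q := by gcongr
      _ = (2 ^ |a|) ^ q * (s * (1 + s) ^ a) ^ q := Real.mul_rpow (by positivity) hw
      _ ≤ _ := by linarith

/-- The global bound for the limit of the truncated powers. -/
theorem exists_lintegral_rpow_le (hd : 2 < d) {T K a : ℝ} (hT : 0 ≤ T) (hK : 0 ≤ K)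
    (ha : -1 / 2 < a) {m₀ : Space d → ℝ} (hm₀ : Continuous m₀) (hc₀ : HasCompactSupport m₀) :
    ∃ C ≥ (0 : ℝ), ∀ (m : Space d → ℝ → ℝ) (F : ℝ → Space d → Space d),
      IsFluxSolution T K m₀ m F →
      ∫⁻ t in Ioo 0 T, (∫⁻ x, ENNReal.ofReal ((m x t * (1 + m x t) ^ a) ^ sobolevExponent d))
        ^ (2 / sobolevExponent d) ≤ ENNReal.ofReal C := by
  have hq0 : 0 < sobolevExponent d := sobolevExponent_pos hd
  have hκ0 : 0 < 2 / sobolevExponent d := by positivity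
  obtain ⟨C, hC, hmain⟩ := exists_integral_truncPow_le hd hT hK ha hm₀ hc₀
  refine ⟨C + 1, by linarith, fun m F h => ?_⟩
  have hε0 (n : ℕ) : 0 < 1 / ((n : ℝ) + 1) := by positivity
  have hε1 (n : ℕ) : 1 / ((n : ℝ) + 1) ≤ 1 :=
    (div_le_one (by positivity)).2 (by linarith [Nat.cast_nonneg (α := ℝ) n])
  choose D hD hDR using fun n : ℕ => hmain m F h (1 / ((n : ℝ) + 1)) (hε0 n) (hε1 n)
  -- the radius beats the constant that degenerates with the truncation
  obtain ⟨R, hR⟩ : ∃ R : ℕ → ℝ, R = fun n : ℕ => max ((n : ℝ) + 1) (D n) := ⟨_, rfl⟩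
  have hRn (n : ℕ) : (n : ℝ) + 1 ≤ R n := hR ▸ le_max_left _ _
  have hRD (n : ℕ) : D n ≤ R n := hR ▸ le_max_right _ _
  have hR1 (n : ℕ) : 1 ≤ R n := by linarith [hRn n, Nat.cast_nonneg (α := ℝ) n]
  have hRt : Tendsto R atTop atTop :=
    tendsto_atTop_mono (fun n => (by linarith [hRn n] : (n : ℝ) ≤ R n))
      tendsto_natCast_atTop_atTop
  obtain ⟨z, hz⟩ : ∃ z : ℕ → Space d → ℝ → ℝ, z = fun n x t =>
    spaceCutoff (R n) x * truncPow a (1 / ((n : ℝ) + 1)) (m x t) := ⟨_, rfl⟩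
  have hzc (n : ℕ) : ∀ t ∈ Icc 0 T, Continuous fun x => z n x t := fun t ht => by
    rw [hz]
    exact (contDiff_spaceCutoff (R n) (n := 0)).continuous.mul
      (contDiff_truncPow_comp (hε0 n) (h.regular.contDiff_one ht)
        fun x => h.nonneg x t ht).continuous
  have hzs (n : ℕ) (t : ℝ) : HasCompactSupport fun x => z n x t := by
    rw [hz]
    exact (hasCompactSupport_spaceCutoff (zero_lt_one.trans_le (hR1 n))).mul_right
  have hzlim (x : Space d) (t : ℝ) :
      Tendsto (fun n => z n x t) atTop (𝓝 (m x t * (1 + m x t) ^ a)) := by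
    rw [hz]
    simpa using (tendsto_spaceCutoff hRt x).mul
      (tendsto_truncPow a (m x t) tendsto_one_div_add_atTop_nhds_zero_nat)
  have hDR' (n : ℕ) : ContinuousOn (fun t => (∫ x, ‖z n x t‖ ^ sobolevExponent d)
        ^ (2 / sobolevExponent d)) (Icc 0 T) ∧
      ∫ t in 0..T, (∫ x, ‖z n x t‖ ^ sobolevExponent d) ^ (2 / sobolevExponent d) ≤ C + 1 := by
    obtain ⟨h1, h2⟩ := hDR n (R n) (hR1 n)
    have h3 : D n / R n ≤ 1 := (div_le_one (zero_lt_one.trans_le (hR1 n))).2 (hRD n)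
    rw [hz]
    exact ⟨h1, h2.trans (by linarith)⟩
  have hint (n : ℕ) : ∀ t ∈ Icc 0 T,
      (∫⁻ x, ENNReal.ofReal (‖z n x t‖ ^ sobolevExponent d)) ^ (2 / sobolevExponent d)
        = ENNReal.ofReal ((∫ x, ‖z n x t‖ ^ sobolevExponent d) ^ (2 / sobolevExponent d)) := by
    intro t ht
    have hs : HasCompactSupport fun x => ‖z n x t‖ ^ sobolevExponent d :=
      HasCompactSupport.intro (hzs n t).isCompact fun x hx => by
        have := image_eq_zero_of_notMem_tsupport hx
        simp [this, hq0.ne']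
    have hn (x : Space d) : 0 ≤ ‖z n x t‖ ^ sobolevExponent d :=
      Real.rpow_nonneg (norm_nonneg _) _
    rw [← ofReal_integral_eq_lintegral_ofReal
      (((hzc n t ht).norm.rpow_const fun _ =>
        Or.inr hq0.le).integrable_of_hasCompactSupport hs) (ae_of_all _ hn),
      ENNReal.ofReal_rpow_of_nonneg (integral_nonneg hn) hκ0.le]
  have hfatou : ∀ t ∈ Icc 0 T,
      (∫⁻ x, ENNReal.ofReal ((m x t * (1 + m x t) ^ a) ^ sobolevExponent d))
        ^ (2 / sobolevExponent d)
      ≤ liminf (fun n => ENNReal.ofReal ((∫ x, ‖z n x t‖ ^ sobolevExponent d)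
        ^ (2 / sobolevExponent d))) atTop := by
    intro t ht
    have hpt (x : Space d) : ENNReal.ofReal ((m x t * (1 + m x t) ^ a) ^ sobolevExponent d)
        = liminf (fun n => ENNReal.ofReal (‖z n x t‖ ^ sobolevExponent d)) atTop := by
      have h0 : 0 ≤ m x t * (1 + m x t) ^ a := by
        have := h.nonneg x t ht
        positivity
      have := (hzlim x t).norm.rpow_const (p := sobolevExponent d) (Or.inr hq0.le)
      rw [Real.norm_of_nonneg h0] at this
      exact ((ENNReal.continuous_ofReal.tendsto _).comp this).liminf_eq.symm
    have h1 : ∫⁻ x, ENNReal.ofReal ((m x t * (1 + m x t) ^ a) ^ sobolevExponent d)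
        ≤ liminf (fun n => ∫⁻ x, ENNReal.ofReal (‖z n x t‖ ^ sobolevExponent d)) atTop := by
      simp_rw [hpt]
      exact lintegral_liminf_le fun n => (ENNReal.continuous_ofReal.comp
        ((hzc n t ht).norm.rpow_const fun _ => Or.inr hq0.le)).measurable
    refine (ENNReal.rpow_le_rpow h1 hκ0.le).trans_eq ?_
    have h2 := (ENNReal.orderIsoRpow (2 / sobolevExponent d) hκ0).liminf_apply (f := atTop)
      (u := fun n => ∫⁻ x, ENNReal.ofReal (‖z n x t‖ ^ sobolevExponent d))
    simp only [ENNReal.orderIsoRpow_apply] at h2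
    rw [h2]
    exact liminf_congr (Eventually.of_forall fun n => hint n t ht)
  calc _ ≤ ∫⁻ t in Ioo 0 T, liminf (fun n => ENNReal.ofReal
        ((∫ x, ‖z n x t‖ ^ sobolevExponent d) ^ (2 / sobolevExponent d))) atTop :=
        setLIntegral_mono' measurableSet_Ioo fun t ht => hfatou t (Ioo_subset_Icc_self ht)
    _ ≤ liminf (fun n => ∫⁻ t in Ioo 0 T, ENNReal.ofReal
        ((∫ x, ‖z n x t‖ ^ sobolevExponent d) ^ (2 / sobolevExponent d))) atTop :=
        lintegral_liminf_le' fun n =>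
          (((hDR' n).1.mono Ioo_subset_Icc_self).aemeasurable measurableSet_Ioo).ennreal_ofReal
    _ ≤ liminf (fun _ : ℕ => ENNReal.ofReal (C + 1)) atTop := by
        refine liminf_le_liminf (Eventually.of_forall fun n => ?_)
        have i1 : IntegrableOn (fun t => (∫ x, ‖z n x t‖ ^ sobolevExponent d)
            ^ (2 / sobolevExponent d)) (Ioo 0 T) :=
          ((hDR' n).1.integrableOn_Icc).mono_set Ioo_subset_Icc_self
        have i0 (t : ℝ) : 0 ≤ (∫ x, ‖z n x t‖ ^ sobolevExponent d)
            ^ (2 / sobolevExponent d) :=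
          Real.rpow_nonneg (integral_nonneg fun x => Real.rpow_nonneg (norm_nonneg _) _) _
        rw [← ofReal_integral_eq_lintegral_ofReal i1 (ae_of_all _ i0),
          ← integral_Ioc_eq_integral_Ioo, ← intervalIntegral.integral_of_le hT]
        exact ENNReal.ofReal_le_ofReal (hDR' n).2
    _ = ENNReal.ofReal (C + 1) := liminf_const _

/-- The a priori estimate for densities whose drift has a prescribed linear growth. -/
theorem exists_mixedNorm_le (hd : 2 < d) {T K α : ℝ} (hT : 0 ≤ T) (hK : 0 ≤ K) (hα : 0 < α)
    {m₀ : Space d → ℝ} (hm₀ : Continuous m₀) (hc₀ : HasCompactSupport m₀) :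
    ∃ C > (0 : ℝ), ∀ (m : Space d → ℝ → ℝ) (F : ℝ → Space d → Space d),
      IsFluxSolution T K m₀ m F →
      mixedNorm T (α + 1) (sobolevExponent d * (α + 1) / 2) m ≤ ENNReal.ofReal C := by
  obtain ⟨a, ha⟩ : ∃ a, a = (α - 1) / 2 := ⟨_, rfl⟩
  have ha' : -1 / 2 < a := by rw [ha]; linarith
  have hq0 : 0 < sobolevExponent d := sobolevExponent_pos hd
  have hq2 : 2 ≤ sobolevExponent d := by
    have hd2 : (2 : ℝ) < d := mod_cast hd
    rw [sobolevExponent, le_div_iff₀ (by linarith)]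
    linarith
  have hκ0 : 0 < 2 / sobolevExponent d := by positivity
  have hκ1 : 2 / sobolevExponent d ≤ 1 := (div_le_one hq0).2 hq2
  have hexp : sobolevExponent d * (α + 1) / 2 = sobolevExponent d * (a + 1) := by
    rw [ha]
    ring
  have hr1 : 1 ≤ sobolevExponent d * (a + 1) := by nlinarith
  have hp0 : 0 < α + 1 := by linarith
  obtain ⟨M, hM, hmom⟩ := exists_moment_bound (T := T) hK hm₀ hc₀ 0
  obtain ⟨C, hC, hmain⟩ := exists_lintegral_rpow_le hd hT hK ha' hm₀ hc₀
  obtain ⟨c, hc⟩ : ∃ c, c = ((2 : ℝ) ^ |a|) ^ sobolevExponent d := ⟨_, rfl⟩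
  have hc0 : 0 ≤ c := by rw [hc]; positivity
  obtain ⟨N, hN⟩ : ∃ N, N = M ^ (2 / sobolevExponent d) * T + c ^ (2 / sobolevExponent d) * C :=
    ⟨_, rfl⟩
  have hN0 : 0 ≤ N := by rw [hN]; positivity
  refine ⟨N ^ (1 / (α + 1)) + 1, by positivity, fun m F h => ?_⟩
  have hslice : ∀ t ∈ Ioo 0 T,
      ‖eLpNorm (fun x => m x t) (ENNReal.ofReal (sobolevExponent d * (a + 1))) volume‖ₑ ^ (α + 1)
        ≤ ENNReal.ofReal (M ^ (2 / sobolevExponent d))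
          + ENNReal.ofReal (c ^ (2 / sobolevExponent d)) *
            (∫⁻ x, ENNReal.ofReal ((m x t * (1 + m x t) ^ a) ^ sobolevExponent d))
              ^ (2 / sobolevExponent d) := by
    intro t ht
    have ht' := Ioo_subset_Icc_self ht
    have hm0 (x : Space d) : 0 ≤ m x t := h.nonneg x t ht'
    have hr0 : 0 < sobolevExponent d * (a + 1) := by linarith
    obtain ⟨i, hi⟩ := hmom m F h t ht'
    simp only [pow_zero, mul_one] at i hi
    rw [enorm_eq_self, eLpNorm_eq_lintegral_rpow_enorm_toReal (by simpa using hr0)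
      ENNReal.ofReal_ne_top, ENNReal.toReal_ofReal hr0.le, ← ENNReal.rpow_mul]
    have e : 1 / (sobolevExponent d * (a + 1)) * (α + 1) = 2 / sobolevExponent d := by
      rw [← hexp]
      field_simp
    rw [e]
    have h1 : ∫⁻ x, ‖m x t‖ₑ ^ (sobolevExponent d * (a + 1))
        ≤ ENNReal.ofReal M + ENNReal.ofReal c *
          ∫⁻ x, ENNReal.ofReal ((m x t * (1 + m x t) ^ a) ^ sobolevExponent d) := by
      have hmi : ∫⁻ x, ENNReal.ofReal (m x t) ≤ ENNReal.ofReal M := by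
        rw [← ofReal_integral_eq_lintegral_ofReal i (ae_of_all _ hm0)]
        exact ENNReal.ofReal_le_ofReal hi
      have hmm : Measurable fun x => ENNReal.ofReal (m x t) :=
        (ENNReal.continuous_ofReal.comp (h.regular.contDiff_one ht').continuous).measurable
      rw [← lintegral_const_mul' _ _ ENNReal.ofReal_ne_top]
      refine le_trans ?_ (add_le_add hmi le_rfl)
      rw [← lintegral_add_left hmm]
      refine lintegral_mono fun x => ?_
      rw [Real.enorm_of_nonneg (hm0 x), ENNReal.ofReal_rpow_of_nonneg (hm0 x) hr0.le,
        ← ENNReal.ofReal_mul hc0, ← ENNReal.ofReal_add (hm0 x) (by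
          have := hm0 x
          positivity), hc]
      exact ENNReal.ofReal_le_ofReal (rpow_le_add_rpow hq0 hr1 (hm0 x))
    refine (ENNReal.rpow_le_rpow h1 hκ0.le).trans
      ((ENNReal.rpow_add_le_add_rpow _ _ hκ0.le hκ1).trans_eq ?_)
    rw [ENNReal.mul_rpow_of_nonneg _ _ hκ0.le, ENNReal.ofReal_rpow_of_nonneg hM.le hκ0.le,
      ENNReal.ofReal_rpow_of_nonneg hc0 hκ0.le]
  have htotal : ∫⁻ t in Ioo 0 T, ‖eLpNorm (fun x => m x t)
      (ENNReal.ofReal (sobolevExponent d * (a + 1))) volume‖ₑ ^ (α + 1) ≤ ENNReal.ofReal N := by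
    refine (setLIntegral_mono' measurableSet_Ioo hslice).trans ?_
    rw [lintegral_add_left measurable_const, lintegral_const_mul' _ _ ENNReal.ofReal_ne_top,
      setLIntegral_const, Real.volume_Ioo, sub_zero, ← ENNReal.ofReal_mul (by positivity), hN,
      ENNReal.ofReal_add (by positivity) (by positivity),
      ENNReal.ofReal_mul (p := c ^ (2 / sobolevExponent d)) (by positivity)]
    gcongr
    exact hmain m F h
  rw [mixedNorm, hexp, eLpNorm_eq_lintegral_rpow_enorm_toReal (by simpa using hp0)
    ENNReal.ofReal_ne_top, ENNReal.toReal_ofReal hp0.le]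
  refine (ENNReal.rpow_le_rpow htotal (by positivity)).trans ?_
  rw [ENNReal.ofReal_rpow_of_nonneg hN0 (by positivity)]
  exact ENNReal.ofReal_le_ofReal (by linarith)

end MeanField

end

theorem lemma3 (d : ℕ) (hd : 2 < d) (T : ℝ) (hT : 0 < T) (α : ℝ) (hα : 0 < α)
    (H : MeanField.Space d → MeanField.Space d → ℝ) (g : ℝ → ℝ)
    (uT m₀ : MeanField.Space d → ℝ)
    (hH : MeanField.HamiltonianAssumption H)
    (hdata : MeanField.DataAssumption uT m₀)
    (hL : MeanField.LagrangianAssumption H)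
    (hgrowth : MeanField.GrowthAssumption H)
    (hg : MeanField.CouplingAssumption g α)
    (hhess : MeanField.HessianAssumption H) :
    ∃ C : ℝ, 0 < C ∧ ∀ u m : MeanField.Space d → ℝ → ℝ,
      MeanField.IsSolution T H g uT m₀ u m →
        MeanField.mixedNorm T (α + 1) (MeanField.sobolevExponent d * (α + 1) / 2) m
          ≤ ENNReal.ofReal C := by
  by_cases hex : ∃ u₁ m₁, MeanField.IsSolution T H g uT m₀ u₁ m₁
  · obtain ⟨u₁, m₁, h₁⟩ := hex
    -- the growth constant of the drift of this one solution serves for every solution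
    obtain ⟨K, hK, hdrift⟩ := h₁.exists_norm_drift_le hH hgrowth hhess
    obtain ⟨C, hC, hmain⟩ := MeanField.exists_mixedNorm_le hd hT.le hK hα
      hdata.smooth_m₀.continuous hdata.compactSupport_m₀
    refine ⟨C, hC, fun u m h => hmain m (MeanField.hamiltonianFlux H u m)
      (h.isFluxSolution hH fun x t ht => ?_)⟩
    rw [MeanField.hamiltonianFlux_eq hT hH hdata hgrowth hhess hg.monotone h₁ h x ht, norm_smul,
      Real.norm_of_nonneg (h.nonneg_m x t ht), mul_comm]
    exact mul_le_mul_of_nonneg_right (hdrift x t ht) (h.nonneg_m x t ht)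
  · exact ⟨1, one_pos, fun u m h => (hex ⟨u, m, h⟩).elim⟩
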